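/- **Model.** $n$ asynchronous deterministic processes communicate through an array $REG[1..m]$ of atomic multi-writer/multi-reader (MWMR) registers. At each instant one process is activated by an arbitrary scheduler. If it is not executing an operation, it invokes $\mathsf{propose}(s,v)$ for its next instance $s=1,2,\dots$ with an arbitrary value $v$ of a totally ordered set $V$; otherwise it performs one access to the shared memory; either is followed by local computation, possibly including the return of the current operation with a decided value. Any process may crash (be activated only finitely often); the others are correct. Processes are *anonymous* if they have the same code and the same initial local state, and the code does not depend on the index of the process. A protocol *solves repeated obstruction-free $(n,k)$-set agreement* if in every run: (Validity) a value decided in instance $s$ has been proposed to instance $s$; (Agreement) at most $k$ different values are decided in each instance; (OB-termination) if there is a time after which a process executes solo, it decides in every instance that it has started. **Algorithm.** A register holds a sixuplet $\langle sn,rd,lvl,cfl,val,dcd\rangle$ (sequence number, round, level $\mathrm{down}<\mathrm{up}$, conflict flag $\mathrm{false}<\mathrm{true}$, value in $V\cup\{\bot\}$ with $\bot$ smallest, list of past decisions), initially $\langle 0,0,\mathrm{down},\mathrm{false},\bot,[\,]\rangle$. Sixuplets are compared lexicographically on their first five fields. $\sup(T)$ is a maximal element of $T$ (ties resolved by any fixed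 rule) whose conflict flag is set to true iff, among the elements of $T$ with the same $sn$ and $rd$, one has $cfl=\mathrm{true}$ or two have different values. Each process keeps a list $dcd_i$, initially empty. In $\mathsf{propose}(s,v)$ it repeats: take a snapshot $view$ of $REG[1..m]$; then * if all entries agree on their first five fields, with $sn=s$ and $rd=r>0$, and have level, conflict flag and value $\ell,c,w$: if $\ell=\mathrm{up}$ and $c=\mathrm{false}$, set $dcd_i[s]\leftarrow w$ and return $w$; if $\ell=\mathrm{down}$ and $c=\mathrm{false}$, write $\langle s,r+1,\mathrm{up},\mathrm{false},w,dcd_i\rangle$ into $REG[1]$; if $c=\mathrm{true}$, write $\langle s,r+1,\mathrm{down},\mathrm{false},w,dcd_i\rangle$ into $REG[1]$; * otherwise let $X=\sup(view[1],\dots,view[m],\langle s,1,\mathrm{down},\mathrm{false},v,dcd_i\rangle)$; if $X.sn>s$, set $dcd_i[s]\leftarrow X.dcd[s]$ and return it; else write $X$ into $REG[x]$, where $x$ is the smallest index of a minimal entry of $view$. The *register version* of the algorithm replaces the snapshot object by the following implementation, which uses only reads and writes of the same $m$ registers. A register holds a pair (timestamp, value), with initially an undefined timestamp and the initial sixuplet.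 Each process has a counter, initially $0$; a write tags the value with the counter and increments the counter; a snapshot reads the whole array, register by register, again and again until $m(n-1)+2$ consecutive readings are identical, and returns their values. **Theorem.** Let $1\le k\le n$ and $m=n-k+1$, let $V$ be a totally ordered set, and let all processes be anonymous. 1. With an atomic snapshot object of $m=n-k+1$ entries, the algorithm solves repeated obstruction-free $(n,k)$-set agreement. Moreover (SV-termination), for every $s$, if to each instance $j\le s$ at most one value is proposed, then every correct process that proposes to instance $s$ decides in it. 2. The register version accesses the shared memory only through reads and writes of its $n-k+1$ MWMR registers, and it solves repeated obstruction-free $(n,k)$-set agreement. 3. This number of registers is optimal: if $k<n$ and $V$ has more than $k$ elements, every protocol (anonymous or not, with registers of any size, even if it may take atomic snapshots of the registers) that solves repeated obstruction-free $(n,k)$-set agreement for $n$ processes and the value set $V$ uses at least $n-k+1$ registers. -/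

import Mathlib

universe u v w

/-! ## Asynchronous shared memory: programs, protocols, runs -/

/-- Result of the local computation that follows an event of a process: either the running
operation `propose` returns a value (and the process keeps the local state `s` for its next
invocation), or the process goes on executing `propose` in local state `b`. -/
inductive Outcome (V : Type u) (Idle Busy : Type w) where
  | ret (val : V) (s : Idle)
  | stay (b : Busy)

/-- One atomic access to an array of `m` multi-writer/multi-reader registers with content in `R`,
together with the local computation that follows it. A `snapshot` returns the whole array;
a read/write program does not use it. -/
inductive Access (m : ℕ) (R : Type v) (O : Type*) where
  | read (x : Fin m) (next : R → O)
  | snapshot (next : (Fin m → R) → O)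
  | write (x : Fin m) (r : R) (next : O)

/-- The deterministic code of one process. `start` is the local state before the first invocation,
`propose sn val s` starts the invocation `propose(sn, val)` from the local state `s`, and
`access b` is the next access to the shared memory of a process that is executing `propose`. -/
structure Program (V : Type u) (R : Type v) (m : ℕ) where
  Idle : Type w
  Busy : Type w
  start : Idle
  propose : ℕ → V → Idle → Outcome V Idle Busy
  access : Busy → Access m R (Outcome V Idle Busy)

/-- A protocol for `n` processes and `m` registers: the initial content of the registers and the
code of every process. The processes need not be anonymous. -/
structure Protocol (V : Type u) (n m : ℕ) where
  Reg : Type v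
  memStart : Fin m → Reg
  code : Fin n → Program.{u, v, w} V Reg m

/-- The protocol in which all processes are anonymous: they have the same code and the same
initial local state, and the code does not receive the index of the process. -/
def Protocol.anonymous {V : Type u} (n : ℕ) {m : ℕ} {R : Type v} (memStart : Fin m → R)
    (A : Program.{u, v, w} V R m) : Protocol.{u, v, w} V n m where
  Reg := R
  memStart := memStart
  code := fun _ => A

namespace Protocol

variable {V : Type u} {n m : ℕ}

/-- Every access to the shared memory is a read or a write of a single register. -/
def ReadWrite (P : Protocol.{u, v, w} V n m) : Prop :=
  ∀ i b next, (P.code i).access b ≠ Access.snapshot next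

/-- A global state. `sn i` is the number of invocations of `propose` by process `i` so far.
`prop` and `dec` are the history seen by an external observer: `prop i s` is the value that
process `i` has proposed to instance `s`, and `dec i s` the value that it has decided in
instance `s` (`none` as long as it has not done so). -/
structure Config (P : Protocol.{u, v, w} V n m) where
  mem : Fin m → P.Reg
  loc : ∀ i : Fin n, (P.code i).Idle ⊕ (P.code i).Busy
  sn : Fin n → ℕ
  prop : Fin n → ℕ → Option V
  dec : Fin n → ℕ → Option V

variable (P : Protocol.{u, v, w} V n m)

/-- The initial global state. -/
def first : P.Config where
  mem := P.memStart
  loc := fun i => Sum.inl (P.code i).start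
  sn := fun _ => 0
  prop := fun _ _ => none
  dec := fun _ _ => none

variable {P}

/-- Process `i` performs the outcome `o` of its local computation. -/
def Config.settle (C : P.Config) (i : Fin n)
    (o : Outcome V (P.code i).Idle (P.code i).Busy) : P.Config :=
  match o with
  | .ret val s =>
      { C with
        loc := Function.update C.loc i (Sum.inl s)
        dec := Function.update C.dec i (Function.update (C.dec i) (C.sn i) (some val)) }
  | .stay b => { C with loc := Function.update C.loc i (Sum.inr b) }

/-- Event `(i, val)`: process `i` is activated. If it is not executing `propose`, it invokes
`propose` on its next instance with the value `val`; otherwise it performs its next access to the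
shared memory (and `val` is not used). -/
def Config.step (C : P.Config) (e : Fin n × V) : P.Config :=
  match C.loc e.1 with
  | Sum.inl s =>
      let j := C.sn e.1 + 1
      Config.settle
        { C with
          sn := Function.update C.sn e.1 j
          prop := Function.update C.prop e.1 (Function.update (C.prop e.1) j (some e.2)) }
        e.1 ((P.code e.1).propose j e.2 s)
  | Sum.inr b =>
      match (P.code e.1).access b with
      | .read x next => C.settle e.1 (next (C.mem x))
      | .snapshot next => C.settle e.1 (next C.mem)
      | .write x r next => Config.settle { C with mem := Function.update C.mem x r } e.1 next

variable (P)

/-- The global state after the first `t` events of the schedule `σ`. A schedule is arbitrary: any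
interleaving, any proposals, and any process may crash, i.e. be activated only finitely often. -/
def run (σ : ℕ → Fin n × V) : ℕ → P.Config
  | 0 => P.first
  | t + 1 => (run σ t).step (σ t)

/-- A value decided in an instance has been proposed to this instance by some process. -/
def Validity : Prop :=
  ∀ (σ : ℕ → Fin n × V) (t : ℕ) (i : Fin n) (s : ℕ) (val : V),
    (P.run σ t).dec i s = some val → ∃ j, (P.run σ t).prop j s = some val

/-- At most `k` different values are decided in each instance. -/
def Agreement (k : ℕ) : Prop :=
  ∀ (σ : ℕ → Fin n × V) (s : ℕ),
    {val : V | ∃ t i, (P.run σ t).dec i s = some val}.encard ≤ k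

/-- If there is a time after which a process executes solo, it decides in all the instances in
which it has proposed a value. -/
def OBTermination : Prop :=
  ∀ (σ : ℕ → Fin n × V) (i : Fin n) (T : ℕ), (∀ t, T ≤ t → (σ t).1 = i) →
    ∀ t s, (P.run σ t).prop i s ≠ none → ∃ t', (P.run σ t').dec i s ≠ none

/-- At most one value is proposed to instance `s`. -/
def SingleValued (σ : ℕ → Fin n × V) (s : ℕ) : Prop :=
  ∀ t i j a b, (P.run σ t).prop i s = some a → (P.run σ t).prop j s = some b → a = b

/-- If a single value is proposed to each instance up to `s`, then all correct processes that
propose to instance `s` decide in it. -/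
def SVTermination : Prop :=
  ∀ (σ : ℕ → Fin n × V) (s : ℕ), (∀ j, j ≤ s → P.SingleValued σ j) →
    ∀ i : Fin n, (∀ T, ∃ t, T ≤ t ∧ (σ t).1 = i) →
      ∀ t, (P.run σ t).prop i s ≠ none → ∃ t', (P.run σ t').dec i s ≠ none

/-- The protocol solves repeated obstruction-free `(n, k)`-set agreement. -/
def SolvesRepeatedSetAgreement (k : ℕ) : Prop :=
  P.Validity ∧ P.Agreement k ∧ P.OBTermination

end Protocol

/-! ## The algorithm for repeated set agreement, on a snapshot object -/

/-- Content of a register: sequence number, round number, level (`up = true` for "up"),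
conflict flag, value, and list of the values decided in the past instances. -/
structure Sixuplet (V : Type u) where
  sn : ℕ
  rd : ℕ
  up : Bool
  cfl : Bool
  val : WithBot V
  dcd : List V
  deriving DecidableEq

namespace Sixuplet

variable {V : Type u}

/-- The first five fields, with the lexicographical order. -/
def key (X : Sixuplet V) : ℕ ×ₗ ℕ ×ₗ Bool ×ₗ Bool ×ₗ WithBot V :=
  toLex (X.sn, toLex (X.rd, toLex (X.up, toLex (X.cfl, X.val))))

/-- The initial content of the registers. -/
def bottom : Sixuplet V := ⟨0, 0, false, false, ⊥, []⟩

variable [LinearOrder V]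

/-- `mx` selects a maximal element of every nonempty list. Only the first five fields are compared,
so that there may be several maximal elements, with different lists of past decisions; which one
is selected is left open. -/
def IsMaxRule (mx : List (Sixuplet V) → Sixuplet V) : Prop :=
  ∀ T, T ≠ [] → mx T ∈ T ∧ ∀ X ∈ T, X.key ≤ (mx T).key

/-- The function `sup`: the maximal element of `T`, whose conflict flag is set if, among the
sixuplets of `T` with the same sequence number and round, there is one with its flag set
(inherited conflict) or there are two with different values (discovered conflict). -/
def sup (mx : List (Sixuplet V) → Sixuplet V) (T : List (Sixuplet V)) : Sixuplet V :=
  { mx T with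
    cfl := decide (
      (∃ X ∈ T, X.sn = (mx T).sn ∧ X.rd = (mx T).rd ∧ X.cfl = true) ∨
      (∃ X ∈ T, ∃ Y ∈ T, (X.sn = (mx T).sn ∧ X.rd = (mx T).rd) ∧
        (Y.sn = (mx T).sn ∧ Y.rd = (mx T).rd) ∧ X.val ≠ Y.val)) }

theorem exists_minimal {d : ℕ} (view : Fin (d + 1) → Sixuplet V) :
    (Finset.univ.filter fun x => ∀ y, (view x).key ≤ (view y).key).Nonempty := by
  obtain ⟨x, hx⟩ := Finite.exists_min fun x => (view x).key
  exact ⟨x, by simpa using hx⟩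

/-- The smallest index of a minimal entry of `view`. -/
def minIndex {d : ℕ} (view : Fin (d + 1) → Sixuplet V) : Fin (d + 1) :=
  (Finset.univ.filter fun x => ∀ y, (view x).key ≤ (view y).key).min' (exists_minimal view)

end Sixuplet

/-- Local state of a process that is executing `propose(sn, val)`, where `dcd` is its list of past
decisions: it is about to take a snapshot if `pending = none`, and to write `X` into register `x`
if `pending = some (x, X)`. -/
structure Proposing (V : Type u) (d : ℕ) where
  sn : ℕ
  val : V
  dcd : List V
  pending : Option (Fin (d + 1) × Sixuplet V)

namespace Proposing

variable {V : Type u} {d : ℕ}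

/-- The process records the decided value in its list and returns it. During `propose(sn, _)` the
list has length `sn - 1`, so that appending sets its entry number `sn`. If the value does not
exist (which cannot happen in a run) the process merely repeats its loop. -/
def finish (b : Proposing V d) : Option V → Outcome V (List V) (Proposing V d)
  | some a => .ret a (b.dcd ++ [a])
  | none => .stay { b with pending := none }

/-- The process decides to write `X` into register `x`. -/
def goWrite (b : Proposing V d) (x : Fin (d + 1)) (X : Sixuplet V) :
    Outcome V (List V) (Proposing V d) :=
  .stay { b with pending := some (x, X) }

variable [LinearOrder V]

/-- The local computation after a snapshot has returned `view`. The first test says that all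
entries have the same first five fields, with sequence number `b.sn` and a positive round. -/
def afterSnapshot (mx : List (Sixuplet V) → Sixuplet V) (b : Proposing V d)
    (view : Fin (d + 1) → Sixuplet V) : Outcome V (List V) (Proposing V d) :=
  let X := view 0
  if (∀ x, (view x).key = X.key) ∧ X.sn = b.sn ∧ 0 < X.rd then
    match X.up, X.cfl with
    | true, false => b.finish X.val
    | false, false => b.goWrite 0 ⟨b.sn, X.rd + 1, true, false, X.val, b.dcd⟩
    | _, true => b.goWrite 0 ⟨b.sn, X.rd + 1, false, false, X.val, b.dcd⟩
  else
    let S := Sixuplet.sup mx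
      (List.ofFn view ++ [⟨b.sn, 1, false, false, (b.val : WithBot V), b.dcd⟩])
    if b.sn < S.sn then b.finish S.dcd[b.sn - 1]?
    else b.goWrite (Sixuplet.minIndex view) S

end Proposing

/-- The code of the repeated set agreement algorithm, for `d + 1` registers that can be accessed
with the operations `snapshot` and `write`. Between two invocations of `propose`, a process
remembers its list of past decisions only (and its sequence number). -/
def repeatedProgram {V : Type u} [LinearOrder V] (d : ℕ)
    (mx : List (Sixuplet V) → Sixuplet V) : Program.{u, u, u} V (Sixuplet V) (d + 1) where
  Idle := List V
  Busy := Proposing V d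
  start := []
  propose := fun sn val dcd => .stay ⟨sn, val, dcd, none⟩
  access := fun b =>
    match b.pending with
    | none => .snapshot fun view => b.afterSnapshot mx view
    | some (x, X) => .write x X (.stay { b with pending := none })

/-- The algorithm for `n` anonymous processes on a snapshot object with `n - k + 1` entries. -/
def snapshotProtocol {V : Type u} [LinearOrder V] (n k : ℕ)
    (mx : List (Sixuplet V) → Sixuplet V) : Protocol.{u, u, u} V n (n - k + 1) :=
  Protocol.anonymous n (fun _ => Sixuplet.bottom) (repeatedProgram (n - k) mx)

/-! ## The snapshot object implemented from the same number of read/write registers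

A register holds a pair of a timestamp (initially `none`) and a value. A write tags the value with
the local counter `ts` of the process and increments it. A snapshot reads the whole array again and
again until it has obtained the same array `m * (n - 1) + 2` times in a row. -/

/-- Local variables of a process that is executing a snapshot: `y` is the next register to read,
`sm2` the array being read, `sm1` the array read before it (meaningless while `initial`, i.e. during
the first reading of the array), and `count` the number of consecutive identical arrays so far. -/
structure Scan (m : ℕ) (R : Type v) where
  y : Fin m
  sm1 : Fin m → Option ℕ × R
  sm2 : Fin m → Option ℕ × R
  initial : Bool
  count : ℕ

namespace Scan

variable {m : ℕ} {R : Type v}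

/-- The beginning of a snapshot (the content of the local arrays is irrelevant). -/
def begin [NeZero m] (mem : Fin m → R) : Scan m R :=
  ⟨0, fun x => (none, mem x), fun x => (none, mem x), true, 0⟩

/-- The read of register `y` has returned `r`: the snapshot continues, or returns an array. -/
def next [NeZero m] [DecidableEq R] (n : ℕ) (S : Scan m R) (r : Option ℕ × R) :
    Scan m R ⊕ (Fin m → R) :=
  let sm2 := Function.update S.sm2 S.y r
  if h : S.y.val + 1 < m then .inl { S with y := ⟨S.y.val + 1, h⟩, sm2 := sm2 }
  else
    if S.initial = false ∧ S.sm1 = sm2 then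
      if S.count + 1 = m * (n - 1) + 2 then .inr fun x => (S.sm1 x).2
      else .inl ⟨0, sm2, sm2, false, S.count + 1⟩
    else .inl ⟨0, sm2, sm2, false, 1⟩

end Scan

/-- Local state of a process that executes the program `A` on read/write registers. -/
structure Layered {V : Type u} {R : Type v} {m : ℕ} (A : Program.{u, v, max v w} V R m) where
  inner : A.Busy
  ts : ℕ
  scan : Scan m R

/-- A process with counter `ts` performs the outcome of a local computation of `A`. -/
def Layered.lift {V : Type u} {R : Type v} {m : ℕ} [NeZero m] {A : Program.{u, v, max v w} V R m}
    (mem : Fin m → R) (ts : ℕ) :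
    Outcome V A.Idle A.Busy → Outcome V (A.Idle × ℕ) (Layered.{u, v, w} A)
  | .ret val s => .ret val (s, ts)
  | .stay b => .stay ⟨b, ts, Scan.begin mem⟩

/-- The program `A` executed by one of `n` processes on read/write registers, where snapshots and
writes are replaced by their implementation. `mem` is the initial content of the array. -/
def Program.onRegisters {V : Type u} {R : Type v} {m : ℕ} [NeZero m] [DecidableEq R]
    (n : ℕ) (mem : Fin m → R) (A : Program.{u, v, max v w} V R m) :
    Program.{u, v, max v w} V (Option ℕ × R) m where
  Idle := A.Idle × ℕ
  Busy := Layered.{u, v, w} A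
  start := (A.start, 0)
  propose := fun sn val s => Layered.lift mem s.2 (A.propose sn val s.1)
  access := fun b =>
    match A.access b.inner with
    | .read x next => .read x fun r => Layered.lift mem b.ts (next r.2)
    | .snapshot next => .read b.scan.y fun r =>
        match b.scan.next n r with
        | .inl S => .stay { b with scan := S }
        | .inr view => Layered.lift mem b.ts (next view)
    | .write x r next => .write x (some b.ts, r) (Layered.lift mem (b.ts + 1) next)

/-- The algorithm for `n` anonymous processes on `n - k + 1` read/write registers. -/
def registerProtocol {V : Type u} [LinearOrder V] (n k : ℕ)
    (mx : List (Sixuplet V) → Sixuplet V) : Protocol.{u, u, u} V n (n - k + 1) :=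
  Protocol.anonymous n (fun _ => (none, Sixuplet.bottom))
    (Program.onRegisters.{u, u, u} n (fun _ => Sixuplet.bottom) (repeatedProgram (n - k) mx))

/-! Safety is proved one instance s at a time. Put d = n - k, so that there are d + 1 registers.
Call a property of sixuplets inherited if whatever a process decides to write after a snapshot has
it as soon as one register of the snapshot has it. While at most d registers and pending writes
together lack an inherited property, some register has it, hence every new pending write has it too,
and a write merely moves a defect from a process to a register. So the bound d lasts forever
(`Move.badCount_le`). Such bounds arise by counting processes. Call a value live for round r if it
is decided or carried by a sixuplet in play at level "up" of round r or beyond. If all registers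
have the property, none is that far yet, and k values are live, then k different processes carry
them; if these have no bad pending write, at most n - k = d others do (`badCount_le_of_live`).

A value becomes live only through a snapshot in which all registers agree. The invariant
`Controlled` says of each round that either no decision is possible in it any more, or at most k
values are live, and if they are exactly k then some inherited property seals the round against
newcomers from below. A decision in round r is based on registers that refute the first alternative,
and all decided values are live for r, so there are at most k of them (`Move.controlled`,
`Move.safe`).

A process running solo fills the registers with one sixuplet, the result of `sup`, and then raises
it to a new round. At most two such raises lead to level "up" without conflict, where it decides;
`measure` counts the writes that remain. If a single value is proposed to each instance up to s, no
conflict ever occurs, and the sixuplets of these instances climb a ladder of 2s + 2 ranks. A correct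
process that never decides keeps overwriting minimal registers, which pushes all of them to
instances beyond s, where it finds its decision in a list of past decisions.

For the register version, each process writes a given timestamped pair at most once, so the
processes other than the reader can rewrite the entries of a given array at most m(n-1) times. A
reading that returns this array although the memory differed from it when the reading began needs
such a rewriting. Hence among m(n-1) + 2 identical readings one begins when the memory is exactly
this array, and the snapshot can be moved to that time. This turns every run on registers into a run
on the snapshot object with the same history of decisions (`exists_linearization`), which transfers
safety. A solo process meets constant memory and simulates its solo run on the snapshot object,
which transfers termination.

The lower bound is a covering argument. With at most n - k registers, a set of processes can be made
to cover registers such that another process q, running solo, writes only into covered ones. In an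
instance that nobody has started, q alone decides its own value; the covering processes then
overwrite all its traces, and the processes other than q repeat the game with the remaining values.
This yields k + 1 decisions in one instance (`exists_decisions`). -/

/-! ### Finite executions, reachability and the history of an instance -/

namespace Protocol

variable {V : Type u} {n m : ℕ} {P : Protocol.{u, v, w} V n m}

/-- The global state after a finite sequence of events. -/
def Config.exec (C : P.Config) (L : List (Fin n × V)) : P.Config := L.foldl Config.step C

@[simp] theorem Config.exec_nil (C : P.Config) : C.exec [] = C := rfl

@[simp] theorem Config.exec_cons (C : P.Config) (e : Fin n × V) (L : List (Fin n × V)) :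
    C.exec (e :: L) = (C.step e).exec L := rfl

theorem Config.exec_append (C : P.Config) (L M : List (Fin n × V)) :
    C.exec (L ++ M) = (C.exec L).exec M := List.foldl_append

/-- A global state is reachable if a finite sequence of events leads to it. -/
def Reachable (C : P.Config) : Prop := ∃ L, P.first.exec L = C

theorem Reachable.exec {C : P.Config} (h : Reachable C) (L : List (Fin n × V)) :
    Reachable (C.exec L) := by
  obtain ⟨M, rfl⟩ := h
  exact ⟨M ++ L, Config.exec_append _ _ _⟩

theorem Reachable.step {C : P.Config} (h : Reachable C) (e : Fin n × V) :
    Reachable (C.step e) := h.exec [e]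

theorem Reachable.induction {p : P.Config → Prop} (h0 : p P.first)
    (hs : ∀ C e, Reachable C → p C → p (C.step e)) {C : P.Config} (h : Reachable C) : p C := by
  obtain ⟨L, rfl⟩ := h
  induction L using List.reverseRecOn with
  | nil => exact h0
  | append_singleton L e ih =>
    rw [Config.exec_append]
    exact hs _ _ ⟨L, rfl⟩ ih

theorem run_add (σ : ℕ → Fin n × V) (s t : ℕ) :
    P.run σ (s + t) = (P.run σ s).exec ((List.range t).map fun j => σ (s + j)) := by
  induction t with
  | zero => rfl
  | succ t ih =>
    rw [List.range_succ, List.map_append, Config.exec_append, ← ih]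
    rfl

theorem reachable_run (σ : ℕ → Fin n × V) (t : ℕ) : Reachable (P.run σ t) :=
  ⟨_, by have := run_add (P := P) σ 0 t; rw [Nat.zero_add] at this; exact this.symm⟩

/-- The schedule that starts with the events of a list and continues with a constant event. -/
def listSchedule (L : List (Fin n × V)) (e : Fin n × V) : ℕ → Fin n × V := fun t => L.getD t e

theorem run_listSchedule (L : List (Fin n × V)) (e : Fin n × V) (t : ℕ) :
    P.run (listSchedule L e) (L.length + t) = (P.first.exec L).exec (List.replicate t e) := by
  rw [run_add]
  congr 1
  · have := run_add (P := P) (listSchedule L e) 0 L.length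
    rw [Nat.zero_add] at this
    rw [this]
    change P.first.exec _ = _
    congr 1
    apply List.ext_getElem
    · simp
    · intro j h1 h2
      simp [listSchedule, List.getElem?_eq_getElem h2]
  · apply List.ext_getElem
    · simp
    · intro j h1 h2
      simp [listSchedule]

theorem Reachable.exists_run {C : P.Config} (h : Reachable C) (e : Fin n × V) :
    ∃ σ t, P.run σ t = C := by
  obtain ⟨L, rfl⟩ := h
  exact ⟨listSchedule L e, L.length, by simpa using run_listSchedule (P := P) L e 0⟩

/-- The parts of two global states that concern process `i` are equal. -/
def SameAt (i : Fin n) (C D : P.Config) : Prop :=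
  C.loc i = D.loc i ∧ C.sn i = D.sn i ∧ C.prop i = D.prop i ∧ C.dec i = D.dec i

theorem SameAt.symm {i : Fin n} {C D : P.Config} (h : SameAt i C D) : SameAt i D C :=
  ⟨h.1.symm, h.2.1.symm, h.2.2.1.symm, h.2.2.2.symm⟩

theorem SameAt.trans {i : Fin n} {C D E : P.Config} (h : SameAt i C D) (h' : SameAt i D E) :
    SameAt i C E :=
  ⟨h.1.trans h'.1, h.2.1.trans h'.2.1, h.2.2.1.trans h'.2.2.1, h.2.2.2.trans h'.2.2.2⟩

theorem settle_mem (C : P.Config) (i : Fin n) (o) : (C.settle i o).mem = C.mem := by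
  cases o <;> rfl

theorem settle_sn (C : P.Config) (i : Fin n) (o) : (C.settle i o).sn = C.sn := by
  cases o <;> rfl

theorem settle_prop (C : P.Config) (i : Fin n) (o) : (C.settle i o).prop = C.prop := by
  cases o <;> rfl

theorem sameAt_settle (C : P.Config) {i j : Fin n} (o) (h : j ≠ i) : SameAt j (C.settle i o) C := by
  cases o <;> simp [SameAt, Config.settle, h]

theorem SameAt.settle {C D : P.Config} {i : Fin n} (o) (h : SameAt i C D) :
    SameAt i (C.settle i o) (D.settle i o) := by
  obtain ⟨h1, h2, h3, h4⟩ := h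
  cases o <;> simp [SameAt, Config.settle, *]

theorem sameAt_step (C : P.Config) (e : Fin n × V) {j : Fin n} (h : j ≠ e.1) :
    SameAt j (C.step e) C := by
  unfold Config.step
  split
  · refine (sameAt_settle _ _ h).trans ?_
    simp [SameAt, h]
  · split <;> exact (sameAt_settle _ _ h).trans ⟨rfl, rfl, rfl, rfl⟩

theorem sameAt_exec (C : P.Config) (L : List (Fin n × V)) {j : Fin n} (h : ∀ e ∈ L, e.1 ≠ j) :
    SameAt j (C.exec L) C := by
  induction L generalizing C with
  | nil => exact ⟨rfl, rfl, rfl, rfl⟩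
  | cons e L ih =>
    simp only [List.mem_cons, forall_eq_or_imp] at h
    exact (ih _ h.2).trans (sameAt_step _ _ h.1.symm)

theorem SameAt.step {C D : P.Config} (e : Fin n × V) (hm : C.mem = D.mem)
    (h : SameAt e.1 C D) :
    (C.step e).mem = (D.step e).mem ∧ SameAt e.1 (C.step e) (D.step e) := by
  obtain ⟨h1, h2, h3, h4⟩ := h
  unfold Config.step
  rw [h1]
  cases D.loc e.1 with
  | inl s =>
    dsimp only
    rw [h2]
    refine ⟨by simp [settle_mem, hm], SameAt.settle _ ?_⟩
    simp [SameAt, *]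
  | inr b =>
    dsimp only
    rw [hm]
    cases (P.code e.1).access b with
    | read x next => exact ⟨by simp [settle_mem, hm], SameAt.settle _ ⟨h1, h2, h3, h4⟩⟩
    | snapshot next => exact ⟨by simp [settle_mem, hm], SameAt.settle _ ⟨h1, h2, h3, h4⟩⟩
    | write x r next => exact ⟨by simp [settle_mem], SameAt.settle _ ⟨h1, h2, h3, h4⟩⟩

/-- Indistinguishability: an event depends only on the memory and on the part of the acting process,
so an execution by processes of `S` proceeds alike from both states, however the other processes
differ. -/
theorem exec_congr {C D : P.Config} (S : Set (Fin n)) (L : List (Fin n × V))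
    (hL : ∀ e ∈ L, e.1 ∈ S) (hm : C.mem = D.mem) (h : ∀ i ∈ S, SameAt i C D) :
    (C.exec L).mem = (D.exec L).mem ∧ ∀ i ∈ S, SameAt i (C.exec L) (D.exec L) := by
  induction L generalizing C D with
  | nil => exact ⟨hm, h⟩
  | cons e L ih =>
    simp only [List.mem_cons, forall_eq_or_imp] at hL
    obtain ⟨h1, h2⟩ := SameAt.step e hm (h _ hL.1)
    refine ih hL.2 h1 fun i hi => ?_
    by_cases hie : i = e.1
    · subst hie; exact h2
    · exact (sameAt_step C e hie).trans ((h i hi).trans (sameAt_step D e hie).symm)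

/-- Which instances a process has started and finished in a global state. -/
structure History (C : P.Config) (i : Fin n) : Prop where
  prop_iff : ∀ s, C.prop i s ≠ none ↔ 1 ≤ s ∧ s ≤ C.sn i
  dec_iff : ∀ s, C.dec i s ≠ none ↔
    1 ≤ s ∧ (s < C.sn i ∨ s = C.sn i ∧ (C.loc i).isLeft = true)
  pos : (C.loc i).isRight = true → 1 ≤ C.sn i

theorem SameAt.history {C D : P.Config} {i : Fin n} (h : SameAt i C D) (hD : History D i) :
    History C i := by
  obtain ⟨h1, h2, h3, h4⟩ := h
  constructor
  · rw [h2, h3]; exact hD.prop_iff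
  · rw [h1, h2, h4]; exact hD.dec_iff
  · rw [h1, h2]; exact hD.pos

/-- In either kind of event the instance `C.sn i` is open at this point, so that the outcome alone
determines whether it becomes decided. -/
theorem History.settle {C : P.Config} {i : Fin n} (o)
    (hp : ∀ s, C.prop i s ≠ none ↔ 1 ≤ s ∧ s ≤ C.sn i)
    (hd : ∀ s, C.dec i s ≠ none ↔ 1 ≤ s ∧ s < C.sn i) (h1 : 1 ≤ C.sn i) :
    History (C.settle i o) i := by
  refine ⟨by rw [settle_prop, settle_sn]; exact hp, ?_, by rw [settle_sn]; exact fun _ => h1⟩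
  intro s
  cases o with
  | ret val s' =>
    by_cases hs : s = C.sn i
    · subst hs
      simp [Config.settle, h1]
    · simp only [Config.settle, Function.update_self, Sum.isLeft_inl, and_true]
      rw [Function.update_of_ne hs, hd]
      omega
  | stay b =>
    simp only [Config.settle, Function.update_self, Sum.isLeft_inr, Bool.false_eq_true, and_false,
      or_false]
    exact hd s

theorem History.step {C : P.Config} {i : Fin n} (h : History C i) (e : Fin n × V) :
    History (C.step e) i := by
  by_cases hi : i = e.1
  swap
  · exact (sameAt_step C e hi).history h
  subst hi
  unfold Config.step
  split
  · rename_i s hs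
    apply History.settle
    · intro s
      by_cases hs' : s = C.sn e.1 + 1
      · simp [hs']
      · simp only [Function.update_self, Function.update_of_ne hs']
        rw [h.prop_iff s]
        omega
    · intro s
      simp only [Function.update_self]
      rw [h.dec_iff s, hs]
      simp
      omega
    · simp
  · rename_i b hb
    have hd : ∀ s, C.dec e.1 s ≠ none ↔ 1 ≤ s ∧ s < C.sn e.1 := by
      intro s
      rw [h.dec_iff s, hb]
      simp
    have h1 : 1 ≤ C.sn e.1 := h.pos (by rw [hb]; rfl)
    split <;> exact History.settle _ h.prop_iff hd h1

theorem Reachable.history {C : P.Config} (h : Reachable C) (i : Fin n) : History C i := by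
  refine Reachable.induction (p := fun C => History C i) ?_ (fun C e _ hC => hC.step e) h
  constructor <;> simp [first] <;> intros <;> omega

theorem step_prop_of_some {C : P.Config} (hC : Reachable C) (e : Fin n × V) {i : Fin n} {s : ℕ}
    {a : V} (h : C.prop i s = some a) : (C.step e).prop i s = some a := by
  by_cases hi : i = e.1
  swap
  · rw [(sameAt_step C e hi).2.2.1, h]
  subst hi
  have hs := ((hC.history e.1).prop_iff s).1 (by simp [h])
  unfold Config.step
  split
  · rw [settle_prop]
    simp only [Function.update_self]
    rw [Function.update_of_ne (by omega), h]
  · split <;> rw [settle_prop] <;> exact h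

/-- An outcome sets the entry of the running instance only, and by `History` this entry was still
empty. -/
theorem step_dec_of_some {C : P.Config} (hC : Reachable C) (e : Fin n × V) {i : Fin n} {s : ℕ}
    {a : V} (h : C.dec i s = some a) : (C.step e).dec i s = some a := by
  by_cases hi : i = e.1
  swap
  · rw [(sameAt_step C e hi).2.2.2, h]
  subst hi
  have hs := ((hC.history e.1).dec_iff s).1 (by simp [h])
  have key : ∀ (D : P.Config) o, D.dec = C.dec → s ≠ D.sn e.1 →
      (D.settle e.1 o).dec e.1 s = some a := by
    intro D o hD hne
    cases o with
    | ret => simp [Config.settle, hne, hD, h]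
    | stay => simp [Config.settle, hD, h]
  unfold Config.step
  split
  · exact key _ _ rfl (by simp; omega)
  · rename_i b hb
    rw [hb] at hs
    simp at hs
    split <;> exact key _ _ rfl (by simp; omega)

theorem exec_dec_of_some {C : P.Config} (hC : Reachable C) (L : List (Fin n × V)) {i : Fin n}
    {s : ℕ} {a : V} (h : C.dec i s = some a) : (C.exec L).dec i s = some a := by
  induction L generalizing C with
  | nil => exact h
  | cons e L ih => exact ih (hC.step e) (step_dec_of_some hC e h)

theorem run_dec_of_some {σ : ℕ → Fin n × V} {t t' : ℕ} (htt : t ≤ t') {i : Fin n} {s : ℕ} {a : V}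
    (h : (P.run σ t).dec i s = some a) : (P.run σ t').dec i s = some a := by
  obtain ⟨d, rfl⟩ := Nat.exists_eq_add_of_le htt
  rw [run_add]
  exact exec_dec_of_some (reachable_run σ t) _ h

/-- The sequence of events in which process `i` is activated `t` times. -/
def solo (i : Fin n) (a : V) (t : ℕ) : List (Fin n × V) := List.replicate t (i, a)

theorem exec_solo_succ (C : P.Config) (i : Fin n) (a : V) (t : ℕ) :
    C.exec (solo i a (t + 1)) = (C.exec (solo i a t)).step (i, a) := by
  rw [solo, List.replicate_succ', Config.exec_append]
  rfl

theorem exec_solo_add (C : P.Config) (i : Fin n) (a : V) (s t : ℕ) :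
    C.exec (solo i a (s + t)) = (C.exec (solo i a s)).exec (solo i a t) := by
  rw [solo, List.replicate_add, Config.exec_append]
  rfl

theorem mem_solo {i : Fin n} {a : V} {t : ℕ} {e : Fin n × V} (h : e ∈ solo i a t) : e = (i, a) :=
  List.eq_of_mem_replicate h

theorem sn_le_step (C : P.Config) (e : Fin n × V) (i : Fin n) : C.sn i ≤ (C.step e).sn i := by
  by_cases hi : i = e.1
  swap
  · rw [(sameAt_step C e hi).2.1]
  subst hi
  unfold Config.step
  split
  · rw [settle_sn]; simp
  · split <;> rw [settle_sn]

theorem sn_le_exec (C : P.Config) (L : List (Fin n × V)) (i : Fin n) :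
    C.sn i ≤ (C.exec L).sn i := by
  induction L generalizing C with
  | nil => exact le_rfl
  | cons e L ih => exact (sn_le_step C e i).trans (ih _)

theorem sn_step_of_idle {C : P.Config} {e : Fin n × V} (h : (C.loc e.1).isLeft = true) :
    (C.step e).sn e.1 = C.sn e.1 + 1 := by
  obtain ⟨s, hs⟩ := Sum.isLeft_iff.1 h
  unfold Config.step
  rw [hs]
  simp [settle_sn]

end Protocol

/-! ### The lower bound: covering arguments -/

namespace Protocol

variable {V : Type u} {n m : ℕ} {P : Protocol.{u, v, w} V n m}

/-- Process `i` is about to write into register `x`. -/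
def Poised (C : P.Config) (i : Fin n) (x : Fin m) : Prop :=
  ∃ b r next, C.loc i = Sum.inr b ∧ (P.code i).access b = .write x r next

theorem SameAt.poised {C D : P.Config} {i : Fin n} (h : SameAt i C D) {x : Fin m}
    (hD : Poised D i x) : Poised C i x := by
  obtain ⟨b, r, next, h1, h2⟩ := hD
  exact ⟨b, r, next, h.1.trans h1, h2⟩

theorem step_mem_of_not_poised {C : P.Config} {e : Fin n × V} {x : Fin m}
    (h : ¬ Poised C e.1 x) : (C.step e).mem x = C.mem x := by
  unfold Config.step
  split
  · rw [settle_mem]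
  · rename_i b hb
    split
    · rw [settle_mem]
    · rw [settle_mem]
    · rename_i y r next ha
      rw [settle_mem]
      have : x ≠ y := by
        rintro rfl
        exact h ⟨b, r, next, hb, ha⟩
      simp [this]

theorem Poised.step {C D : P.Config} {e : Fin n × V} {x : Fin m} (h : Poised C e.1 x)
    (hs : SameAt e.1 C D) : SameAt e.1 (C.step e) (D.step e) ∧
      (C.step e).mem x = (D.step e).mem x ∧
      ∀ y, C.mem y = D.mem y → (C.step e).mem y = (D.step e).mem y := by
  obtain ⟨b, r, next, h1, h2⟩ := h
  have h1' := hs.1.symm.trans h1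
  unfold Config.step
  rw [h1, h1']
  dsimp only
  rw [h2]
  dsimp only
  refine ⟨SameAt.settle _ hs, by simp [settle_mem], fun y hy => ?_⟩
  rw [settle_mem, settle_mem]
  by_cases hyx : y = x
  · simp [hyx]
  · simp [hyx, hy]

/-- A block write makes the memory independent of what was in the registers that it covers. -/
theorem exec_block_write {S : Set (Fin n)} (a : V) (Q : List (Fin n)) (hQ : Q.Nodup)
    (hQS : ∀ i ∈ Q, i ∈ S) {C D : P.Config} (hs : ∀ i ∈ S, SameAt i C D)
    (hp : ∀ i ∈ Q, ∃ x, Poised C i x)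
    (hm : ∀ x, C.mem x = D.mem x ∨ ∃ i ∈ Q, Poised C i x) :
    (C.exec (Q.map fun i => (i, a))).mem = (D.exec (Q.map fun i => (i, a))).mem ∧
      ∀ i ∈ S, SameAt i (C.exec (Q.map fun i => (i, a))) (D.exec (Q.map fun i => (i, a))) := by
  -- Along the block write, a register on which the two memories differ is always covered by a
  -- process that has not written yet; at the end there is no such process.
  induction Q generalizing C D with
  | nil =>
    refine ⟨funext fun x => ?_, hs⟩
    simpa using hm x
  | cons q Q ih =>
    obtain ⟨hq, hQ⟩ := List.nodup_cons.1 hQ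
    obtain ⟨x, hx⟩ := hp q (by simp)
    obtain ⟨h1, h2, h3⟩ := Poised.step (e := (q, a)) hx (hs q (hQS q (by simp)))
    have hne : ∀ i ∈ Q, i ≠ q := fun i hi h => hq (h ▸ hi)
    refine ih hQ (fun i hi => hQS i (by simp [hi])) (fun i hi => ?_) (fun i hi => ?_) fun y => ?_
    · by_cases hiq : i = q
      · subst hiq; exact h1
      · exact (sameAt_step C (q, a) hiq).trans
          ((hs i hi).trans (sameAt_step D (q, a) hiq).symm)
    · obtain ⟨z, hz⟩ := hp i (by simp [hi])
      exact ⟨z, (sameAt_step C (q, a) (hne i hi)).poised hz⟩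
    · rcases hm y with h | ⟨i, hi, h⟩
      · exact Or.inl (h3 y h)
      · by_cases hiq : i = q
        · subst hiq
          left
          have : y = x := by
            obtain ⟨b, r, next, e1, e2⟩ := hx
            obtain ⟨b', r', next', e1', e2'⟩ := h
            rw [e1] at e1'
            cases e1'
            rw [e2] at e2'
            cases e2'
            rfl
          rw [this]
          exact h2
        · right
          have hi' : i ∈ Q := (List.mem_cons.1 hi).resolve_left hiq
          exact ⟨i, hi', (sameAt_step C (q, a) hiq).poised h⟩

/-- Some processes of a large enough set can cover a set of registers such that another process
of the set writes only into these registers when it executes solo. -/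
theorem exists_covering (a : V) (S : Finset (Fin n)) (hS : m + 1 ≤ S.card) (C : P.Config)
    (Q : Finset (Fin n)) (A : Finset (Fin m)) (hQS : Q ⊆ S) (hcard : Q.card ≤ A.card)
    (h1 : ∀ i ∈ Q, ∃ x, Poised C i x) (h2 : ∀ x ∈ A, ∃ i ∈ Q, Poised C i x) :
    ∃ (L : List (Fin n × V)) (Q : Finset (Fin n)) (A : Finset (Fin m)) (q : Fin n),
      (∀ e ∈ L, e.1 ∈ S) ∧ Q ⊆ S ∧ (∀ i ∈ Q, ∃ x, Poised (C.exec L) i x) ∧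
      (∀ x ∈ A, ∃ i ∈ Q, Poised (C.exec L) i x) ∧ q ∈ S ∧ q ∉ Q ∧
      ∀ t x, Poised ((C.exec L).exec (solo q a t)) q x → x ∈ A := by
  -- As `Q.card ≤ A.card ≤ m < S.card`, some `q` of `S` lies outside `Q`. Either its solo run writes
  -- only into `A`, or it is stopped when poised on a register outside `A`; then `q` joins `Q`, the
  -- register joins `A`, and `A` can grow at most m times.
  induction hd : m - A.card using Nat.strong_induction_on generalizing C Q A with
  | _ d ih =>
    have hA : A.card ≤ m := by simpa using A.card_le_univ
    obtain ⟨q, hqS, hqQ⟩ : ∃ q ∈ S, q ∉ Q := Finset.exists_mem_notMem_of_card_lt_card (by omega)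
    by_cases hout : ∀ t x, Poised (C.exec (solo q a t)) q x → x ∈ A
    · exact ⟨[], Q, A, q, by simp, hQS, h1, h2, hqS, hqQ, hout⟩
    · push Not at hout
      obtain ⟨t, x, hx, hxA⟩ := hout
      have hA' : (insert x A).card ≤ m := by simpa using (insert x A).card_le_univ
      rw [Finset.card_insert_of_notMem hxA] at hA'
      have hsame : ∀ i ∈ Q, SameAt i (C.exec (solo q a t)) C := fun i hi =>
        sameAt_exec _ _ fun e he h => hqQ (by
          rw [mem_solo he] at h
          exact (show q = i from h) ▸ hi)
      obtain ⟨L, Q', A', q', k1, k2, k3⟩ := ih (m - (insert x A).card)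
        (by rw [Finset.card_insert_of_notMem hxA]; omega) (C.exec (solo q a t)) (insert q Q)
        (insert x A) (Finset.insert_subset hqS hQS)
        (by rw [Finset.card_insert_of_notMem hxA, Finset.card_insert_of_notMem hqQ]; omega)
        (by
          simp only [Finset.mem_insert, forall_eq_or_imp]
          refine ⟨⟨x, hx⟩, fun i hi => ?_⟩
          obtain ⟨y, hy⟩ := h1 i hi
          exact ⟨y, (hsame i hi).poised hy⟩)
        (by
          simp only [Finset.mem_insert, forall_eq_or_imp]
          refine ⟨⟨q, Or.inl rfl, hx⟩, fun y hy => ?_⟩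
          obtain ⟨i, hi, h⟩ := h2 y hy
          exact ⟨i, Or.inr hi, (hsame i hi).poised h⟩) rfl
      refine ⟨solo q a t ++ L, Q', A', q', ?_, k2, by rwa [Config.exec_append]⟩
      intro e he
      rcases List.mem_append.1 he with he | he
      · rw [mem_solo he]; exact hqS
      · exact k1 e he

/-- If the number of invocations stopped growing, `q` would be busy in the same instance forever,
because an idle process starts a new instance when it is activated; this contradicts termination. -/
theorem exists_sn_solo (hP : P.OBTermination) {C : P.Config} (hC : Reachable C) (q : Fin n)
    (a : V) (s : ℕ) : ∃ t, s ≤ (C.exec (solo q a t)).sn q := by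
  induction s with
  | zero => exact ⟨0, Nat.zero_le _⟩
  | succ s ih =>
    obtain ⟨t, ht⟩ := ih
    by_contra! hcon
    have hR : ∀ t, Reachable (C.exec (solo q a t)) := fun t => hC.exec _
    have hsn : ∀ d, (C.exec (solo q a (t + d))).sn q = s := fun d => by
      have h1 := hcon (t + d)
      have h2 := sn_le_exec (C.exec (solo q a t)) (solo q a d) q
      rw [← exec_solo_add] at h2
      omega
    have hbusy : ∀ d, ((C.exec (solo q a (t + d))).loc q).isRight = true := fun d => by
      by_contra h
      have := sn_step_of_idle (e := (q, a)) (C := C.exec (solo q a (t + d))) (by simpa using h)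
      rw [← exec_solo_succ] at this
      have h' := hcon (t + d + 1)
      rw [show (_ : ℕ) = _ from this] at h'
      have := hsn d
      dsimp only at h'
      omega
    have hs : 1 ≤ s := by
      have := ((hR (t + 0)).history q).pos (hbusy 0)
      rwa [hsn] at this
    obtain ⟨L, rfl⟩ := hC
    have hrun : ∀ d, P.run (listSchedule L (q, a)) (L.length + d) =
        (P.first.exec L).exec (solo q a d) := run_listSchedule L (q, a)
    obtain ⟨t', ht'⟩ := hP (listSchedule L (q, a)) q L.length
      (fun j hj => by simp [listSchedule, hj]) (L.length + t) s
      (by rw [hrun, ((hR t).history q).prop_iff]; exact ⟨hs, ht⟩)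
    obtain ⟨b, hb⟩ := Option.ne_none_iff_exists'.1 ht'
    have := run_dec_of_some (show t' ≤ L.length + (t + t') by omega) hb
    rw [hrun] at this
    have := (((hR (t + t')).history q).dec_iff s).1 (by simp [this])
    rw [hsn] at this
    have hb := hbusy t'
    rw [← Sum.not_isLeft] at hb
    rcases this.2 with h | h
    · exact lt_irrefl _ h
    · exact absurd h.2 (by simpa using hb)

theorem prop_solo {C : P.Config} {q : Fin n} {a : V} {s : ℕ} (hs : C.prop q s = none) (t : ℕ) :
    ∀ b, (C.exec (solo q a t)).prop q s = some b → b = a := by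
  induction t with
  | zero => intro b hb; simp [solo, hs] at hb
  | succ t ih =>
    rw [exec_solo_succ]
    generalize C.exec (solo q a t) = D at ih
    intro b hb
    unfold Config.step at hb
    split at hb
    · rw [settle_prop] at hb
      by_cases h : s = D.sn q + 1
      · simp [h] at hb
        exact hb.symm
      · simp [h] at hb
        exact ih b hb
    · split at hb <;> exact ih b (by rwa [settle_prop] at hb)

/-- If there are enough processes, different values can be decided in every late enough
instance. -/
theorem exists_decisions (hval : P.Validity) (hob : P.OBTermination) (vals : List V)
    (S : Finset (Fin n)) (hS : m + vals.length ≤ S.card + 1) (hS' : vals.length ≤ S.card)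
    {C : P.Config} (hC : Reachable C) : ∃ N, ∀ s, N ≤ s → ∃ L : List (Fin n × V),
      (∀ e ∈ L, e.1 ∈ S) ∧ ∀ a ∈ vals, ∃ i ∈ S, (C.exec L).dec i s = some a := by
  -- One bound `N` has to serve all later instances, since the same instance must be unstarted both
  -- for the solo run of this step and for the remaining values. The assumption `hS'` adds something
  -- only for m = 0, where `hS` does not ensure that `S` is large enough.
  induction vals generalizing S C with
  | nil => exact ⟨0, fun s _ => ⟨[], by simp, by simp⟩⟩
  | cons a vals ih =>
    -- Nobody has started instance `s`, so after the solo run `a` is the only value proposed to it,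
    -- and validity forces the decision.
    have solo_dec : ∀ {C : P.Config}, Reachable C → ∀ q s, (∀ i, C.sn i < s) →
        ∃ t, (C.exec (solo q a t)).dec q s = some a := by
      intro C hC q s hs
      obtain ⟨t, ht⟩ := exists_sn_solo hob hC q a (s + 1)
      have hR := hC.exec (solo q a t)
      obtain ⟨b, hb⟩ := Option.ne_none_iff_exists'.1
        (((hR.history q).dec_iff s).2 ⟨by have := hs q; omega, by omega⟩)
      refine ⟨t, ?_⟩
      obtain ⟨σ, T, hσ⟩ := hR.exists_run (q, a)
      obtain ⟨j, hj⟩ := hval σ T q s b (by rw [hσ, hb])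
      rw [hσ] at hj
      have hnone : ∀ i, C.prop i s = none := fun i => by
        by_contra h
        have := ((hC.history i).prop_iff s).1 h
        have := hs i
        omega
      by_cases hjq : j = q
      · subst hjq
        rw [hb, prop_solo (hnone _) t b hj]
      · rw [(sameAt_exec C (solo q a t) fun e he => by
          rw [mem_solo he]; exact fun h => hjq h.symm).2.2.1, hnone] at hj
        cases hj
    by_cases hm : m + 1 ≤ S.card
    swap
    -- With at most m processes left, `hS` leaves room for the value `a` only, and a single solo run
    -- is enough.
    · simp only [List.length_cons] at hS hS'
      have : vals = [] := List.length_eq_zero_iff.1 (by omega)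
      subst this
      obtain ⟨q, hq⟩ : S.Nonempty := Finset.card_pos.1 (by omega)
      refine ⟨(Finset.univ.sup C.sn) + 1, fun s hs => ?_⟩
      obtain ⟨t, ht⟩ := solo_dec hC q s fun i =>
        lt_of_le_of_lt (Finset.le_sup (Finset.mem_univ i)) hs
      refine ⟨solo q a t, fun e he => by rw [mem_solo he]; exact hq, ?_⟩
      simp only [List.mem_singleton, forall_eq]
      exact ⟨q, hq, ht⟩
    obtain ⟨L₁, Q, A, q, hL₁, hQS, hQ1, hQ2, hqS, hqQ, hq⟩ :=
      exists_covering a S hm C ∅ ∅ (by simp) (by simp) (by simp) (by simp)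
    have hC₁ := hC.exec L₁
    set C₁ := C.exec L₁ with hC₁def
    set B := Q.toList.map fun i => (i, a) with hB
    simp only [List.length_cons] at hS hS'
    -- The remaining values are decided after the block write in an execution in which `q` does not
    -- move. The solo run of `q` is inserted before the block write afterwards.
    obtain ⟨N, hN⟩ := ih (S.erase q) (by rw [Finset.card_erase_of_mem hqS]; omega)
      (by rw [Finset.card_erase_of_mem hqS]; omega) (hC₁.exec B)
    refine ⟨max N (Finset.univ.sup C₁.sn + 1), fun s hs => ?_⟩
    obtain ⟨L₂, hL₂, hdec⟩ := hN s (le_trans (le_max_left _ _) hs)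
    obtain ⟨t, ht⟩ := solo_dec hC₁ q s fun i =>
      lt_of_le_of_lt (Finset.le_sup (Finset.mem_univ i)) (le_trans (le_max_right _ _) hs)
    have hBq : ∀ e ∈ B, e.1 ∈ Q := by
      intro e he
      obtain ⟨i, hi, rfl⟩ := List.mem_map.1 he
      exact Finset.mem_toList.1 hi
    have hsame : ∀ i, i ≠ q → SameAt i C₁ (C₁.exec (solo q a t)) := fun i hi =>
      (sameAt_exec _ _ fun e he => by rw [mem_solo he]; exact hi.symm).symm
    -- The solo run leaves traces in `A` only, and every register of `A` is overwritten by the block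
    -- write.
    have hmem : ∀ t x, (C₁.exec (solo q a t)).mem x = C₁.mem x ∨ x ∈ A := by
      intro t x
      induction t with
      | zero => exact Or.inl rfl
      | succ t iht =>
        by_cases hx : Poised (C₁.exec (solo q a t)) q x
        · exact Or.inr (hq t x hx)
        · rw [exec_solo_succ, step_mem_of_not_poised hx]
          exact iht
    obtain ⟨e1, e2⟩ := exec_block_write (S := {i | i ≠ q}) a Q.toList Q.nodup_toList
      (fun i hi h => hqQ (by rw [← h]; exact Finset.mem_toList.1 hi)) hsame
      (fun i hi => hQ1 i (Finset.mem_toList.1 hi))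
      (fun x => by
        rcases hmem t x with h | h
        · exact Or.inl h.symm
        · obtain ⟨i, hi, h⟩ := hQ2 x h
          exact Or.inr ⟨i, Finset.mem_toList.2 hi, h⟩)
    obtain ⟨f1, f2⟩ := exec_congr {i | i ≠ q} L₂
      (fun e he => (Finset.mem_erase.1 (hL₂ e he)).1) e1 e2
    refine ⟨L₁ ++ (solo q a t ++ (B ++ L₂)), ?_, ?_⟩
    · intro e he
      simp only [List.mem_append] at he
      rcases he with he | he | he | he
      · exact hL₁ e he
      · rw [mem_solo he]; exact hqS
      · exact hQS (hBq e he)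
      · exact (Finset.mem_erase.1 (hL₂ e he)).2
    · simp only [Config.exec_append]
      rw [← hC₁def]
      simp only [List.mem_cons, forall_eq_or_imp]
      constructor
      · exact ⟨q, hqS, exec_dec_of_some ((hC₁.exec _).exec _) _
          (exec_dec_of_some (hC₁.exec _) _ ht)⟩
      · intro b hb
        obtain ⟨i, hi, h⟩ := hdec b hb
        obtain ⟨hiq, hiS⟩ := Finset.mem_erase.1 hi
        refine ⟨i, hiS, ?_⟩
        rw [← (f2 i hiq).2.2.2]
        exact h

/-- If m ≤ n - k, then m + (k + 1) ≤ n + 1, which is exactly the room that `exists_decisions` needs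
for k + 1 values. -/
theorem register_lower_bound {k : ℕ} (hkn : k < n) (hV : (k : ℕ∞) < ENat.card V)
    (hP : P.SolvesRepeatedSetAgreement k) : n - k + 1 ≤ m := by
  by_contra hm
  obtain ⟨hval, hagr, hob⟩ := hP
  have hcard : ((k + 1 : ℕ) : ℕ∞) ≤ (Set.univ : Set V).encard := by
    rw [Set.encard_univ]
    exact_mod_cast Order.add_one_le_of_lt hV
  obtain ⟨T, -, hT⟩ := Set.exists_subset_encard_eq hcard
  have hfin : T.Finite := Set.finite_of_encard_eq_coe hT
  have hlen : hfin.toFinset.toList.length = k + 1 := by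
    rw [Finset.length_toList]
    rw [hfin.encard_eq_coe_toFinset_card] at hT
    exact_mod_cast hT
  obtain ⟨N, hN⟩ := exists_decisions hval hob hfin.toFinset.toList Finset.univ
    (by simp only [hlen, Finset.card_univ, Fintype.card_fin]; omega)
    (by simp only [hlen, Finset.card_univ, Fintype.card_fin]; omega) (⟨[], rfl⟩ : Reachable P.first)
  obtain ⟨L, -, hL⟩ := hN N le_rfl
  have hne : T.Nonempty := by
    rw [← Set.encard_pos, hT]
    exact_mod_cast Nat.succ_pos k
  obtain ⟨a, -⟩ := hne
  obtain ⟨σ, t, hσ⟩ := (show Reachable (P.first.exec L) from ⟨L, rfl⟩).exists_run (⟨0, by omega⟩, a)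
  have h1 := hagr σ N
  have h2 : T ⊆ {val : V | ∃ t i, (P.run σ t).dec i N = some val} := fun b hb => by
    obtain ⟨i, -, hi⟩ := hL b (by simpa using hb)
    exact ⟨t, i, by rw [hσ]; exact hi⟩
  have h3 := (Set.encard_le_encard h2).trans h1
  rw [hT] at h3
  have : k + 1 ≤ k := by exact_mod_cast h3
  omega

end Protocol

/-! ### Safety of one instance: inherited properties -/

/-- What matters for the decisions in one instance: the registers, the sixuplets that the processes
are about to write, and the decisions in this instance. -/
structure Situation (V : Type u) (n d : ℕ) where
  mem : Fin (d + 1) → Sixuplet V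
  pend : Fin n → Option (Sixuplet V)
  dec : Fin n → Option V

namespace Situation

variable {V : Type u} {n d : ℕ}

/-- What is known about the sixuplet `X` that a process decides to write after a snapshot that has
returned `mem`, from the point of view of instance `s`. -/
inductive Fresh (s : ℕ) (mem : Fin (d + 1) → Sixuplet V) (X : Sixuplet V) : Prop
  | later (h : s < X.sn)
  | earlier (h : X.sn < s) (hm : ∀ x, (mem x).sn < s)
  | raise (r : ℕ) (l c : Bool) (y : WithBot V) (hr : 1 ≤ r)
      (hm : ∀ x, (mem x).sn = s ∧ (mem x).rd = r ∧ (mem x).up = l ∧ (mem x).cfl = c ∧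
        (mem x).val = y)
      (hl : c = false → l = false) (h1 : X.sn = s) (h2 : X.rd = r + 1) (h3 : X.up = !c)
      (h4 : X.cfl = false) (h5 : X.val = y)
  | adopt (h1 : X.sn = s)
      (hm : ∀ x, (mem x).sn < s ∨ (mem x).sn = s ∧ ((mem x).rd < X.rd ∨ (mem x).rd = X.rd ∧
        ((mem x).up = true → X.up = true) ∧ ((mem x).cfl = true → X.cfl = true) ∧
        ((mem x).val ≠ X.val → X.cfl = true)))
      (hX : X.rd = 1 ∧ X.up = false ∨ ∃ x, (mem x).sn = s ∧ (mem x).rd = X.rd ∧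
        (mem x).up = X.up ∧ (mem x).val = X.val)

/-- One event, from the point of view of instance `s`. -/
inductive Move (s : ℕ) (C : Situation V n d) : Situation V n d → Prop
  | idle : Move s C C
  | decide (i : Fin n) (a : V) (r : ℕ) (hr : 1 ≤ r) (hp : C.pend i = none) (hd : C.dec i = none)
      (hm : ∀ x, (C.mem x).sn = s ∧ (C.mem x).rd = r ∧ (C.mem x).up = true ∧
        (C.mem x).cfl = false ∧ (C.mem x).val = a) :
      Move s C { C with dec := Function.update C.dec i (some a) }
  | copy (i j : Fin n) (a : V) (hp : C.pend i = none) (hj : C.dec j = some a) :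
      Move s C { C with dec := Function.update C.dec i (some a) }
  | snap (i : Fin n) (X : Sixuplet V) (hp : C.pend i = none) (hX : Fresh s C.mem X)
      (hd : C.dec i ≠ none → s < X.sn) :
      Move s C { C with pend := Function.update C.pend i (some X) }
  | write (i : Fin n) (x : Fin (d + 1)) (X : Sixuplet V) (hp : C.pend i = some X) :
      Move s C { C with mem := Function.update C.mem x X, pend := Function.update C.pend i none }

/-- The sixuplet is in a register or about to be written. -/
def InPlay (C : Situation V n d) (Z : Sixuplet V) : Prop :=
  (∃ x, C.mem x = Z) ∨ ∃ i, C.pend i = some Z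

/-- The sixuplet has reached level "up" of round `r` of instance `s`. -/
def Ahead (s r : ℕ) (Z : Sixuplet V) : Prop :=
  s < Z.sn ∨ Z.sn = s ∧ (r < Z.rd ∨ Z.rd = r ∧ Z.up = true)

/-- The sixuplet has reached round `r` of instance `s`. -/
def AtLeast (s r : ℕ) (Z : Sixuplet V) : Prop :=
  s < Z.sn ∨ Z.sn = s ∧ r ≤ Z.rd

/-- The sixuplet has passed round `r` of instance `s`, or it is in this round with a conflict or
with the value `y`. -/
def Tied (s r : ℕ) (y : WithBot V) (Z : Sixuplet V) : Prop :=
  s < Z.sn ∨ Z.sn = s ∧ (r < Z.rd ∨ Z.rd = r ∧ (Z.cfl = true ∨ Z.val = y))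

/-- The sixuplet has passed round `r` of instance `s`, or it is in this round with a conflict or
with a value different from `y`. -/
def Against (s r : ℕ) (y : WithBot V) (Z : Sixuplet V) : Prop :=
  s < Z.sn ∨ Z.sn = s ∧ (r < Z.rd ∨ Z.rd = r ∧ (Z.cfl = true ∨ Z.val ≠ y))

open Classical in
/-- The number of registers and pending writes that do not satisfy `G`. -/
noncomputable def badCount (G : Sixuplet V → Prop) (C : Situation V n d) : ℕ :=
  (Finset.univ.filter fun x => ¬ G (C.mem x)).card +
    (Finset.univ.filter fun i => ∃ X, C.pend i = some X ∧ ¬ G X).card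

/-- `G` is inherited from some register by whatever is written after a snapshot. -/
def Inherited (s : ℕ) (d : ℕ) (G : Sixuplet V → Prop) : Prop :=
  ∀ (mem : Fin (d + 1) → Sixuplet V) X, Fresh s mem X → (∃ x, G (mem x)) → G X

/-- An adopted sixuplet is not below any register in instance, round and level, and a raised one is
a full round above all of them. -/
theorem inherited_ahead (s r : ℕ) : Inherited s d (Ahead (V := V) s r) := by
  rintro mem X hX ⟨x, hx⟩
  cases hX with
  | later h => exact Or.inl h
  | earlier h hm =>
    have := hm x
    unfold Ahead at hx
    omega
  | raise ρ l c y hr hm hl h1 h2 h3 h4 h5 =>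
    have := hm x
    unfold Ahead at hx ⊢
    omega
  | adopt h1 hm hX =>
    have := hm x
    unfold Ahead at hx ⊢
    grind

theorem inherited_atLeast (s r : ℕ) : Inherited s d (AtLeast (V := V) s r) := by
  rintro mem X hX ⟨x, hx⟩
  cases hX with
  | later h => exact Or.inl h
  | earlier h hm =>
    have := hm x
    unfold AtLeast at hx
    omega
  | raise ρ l c y hr hm hl h1 h2 h3 h4 h5 =>
    have := hm x
    unfold AtLeast at hx ⊢
    omega
  | adopt h1 hm hX =>
    have := hm x
    unfold AtLeast at hx ⊢
    clear hX
    omega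

/-- Within round `r`, `sup` passes on a conflict flag, and adopting a value that differs from that
of a register in the same round is itself a conflict. `inherited_against` holds for the same reason.
-/
theorem inherited_tied (s r : ℕ) (y : WithBot V) : Inherited s d (Tied s r y) := by
  rintro mem X hX ⟨x, hx⟩
  cases hX with
  | later h => exact Or.inl h
  | earlier h hm =>
    have := hm x
    unfold Tied at hx
    omega
  | raise ρ l c y hr hm hl h1 h2 h3 h4 h5 =>
    have := hm x
    unfold Tied at hx ⊢
    omega
  | adopt h1 hm hX =>
    have := hm x
    unfold Tied at hx ⊢
    grind

theorem inherited_against (s r : ℕ) (y : WithBot V) : Inherited s d (Against s r y) := by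
  rintro mem X hX ⟨x, hx⟩
  cases hX with
  | later h => exact Or.inl h
  | earlier h hm =>
    have := hm x
    unfold Against at hx
    omega
  | raise ρ l c y hr hm hl h1 h2 h3 h4 h5 =>
    have := hm x
    unfold Against at hx ⊢
    omega
  | adopt h1 hm hX =>
    have := hm x
    unfold Against at hx ⊢
    grind

theorem exists_good {G : Sixuplet V → Prop} {C : Situation V n d} (h : badCount G C ≤ d) :
    ∃ x, G (C.mem x) := by
  classical
  by_contra! hx
  have : (Finset.univ.filter fun x => ¬ G (C.mem x)).card = d + 1 := by
    rw [Finset.filter_true_of_mem fun x _ => hx x]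
    simp
  unfold badCount at h
  have h2 : (Finset.univ.filter fun x => ¬ G (C.mem x)).card ≤ d := by
    convert le_trans (Nat.le_add_right _ _) h
  omega

/-- As d + 1 registers cannot all be bad, a snapshot sees a good one and its result is good. A write
transfers its sixuplet from a process to a register, so the sum of the two counts does not grow. -/
theorem Move.badCount_le {s : ℕ} {G : Sixuplet V → Prop} (hG : Inherited s d G)
    {C C' : Situation V n d} (hC : Move s C C') (h : badCount G C ≤ d) : badCount G C' ≤ d := by
  classical
  cases hC with
  | idle => exact h
  | decide => exact h
  | copy => exact h
  | snap i X hp hX hd =>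
    have hGX := hG _ _ hX (exists_good h)
    refine le_trans (Nat.add_le_add_left (Finset.card_le_card fun j hj => ?_) _) h
    simp only [Finset.mem_filter, Finset.mem_univ, true_and] at hj ⊢
    by_cases hji : j = i
    · subst hji
      simp [hGX] at hj
    · simpa [hji] using hj
  | write i x X hp =>
    refine le_trans ?_ h
    unfold badCount
    by_cases hX : G X
    · refine Nat.add_le_add (Finset.card_le_card fun y hy => ?_) (Finset.card_le_card fun j hj => ?_)
      · simp only [Finset.mem_filter, Finset.mem_univ, true_and] at hy ⊢
        by_cases hyx : y = x
        · subst hyx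
          simp [hX] at hy
        · simpa [hyx] using hy
      · simp only [Finset.mem_filter, Finset.mem_univ, true_and] at hj ⊢
        by_cases hji : j = i
        · subst hji
          simp at hj
        · simpa [hji] using hj
    · have h1 : (Finset.univ.filter fun y => ¬ G (Function.update C.mem x X y)).card ≤
          (Finset.univ.filter fun y => ¬ G (C.mem y)).card + 1 := by
        refine le_trans (Finset.card_le_card fun y hy => ?_) (Finset.card_insert_le x _)
        simp only [Finset.mem_filter, Finset.mem_univ, true_and, Finset.mem_insert] at hy ⊢
        by_cases hyx : y = x
        · exact Or.inl hyx
        · exact Or.inr (by simpa [hyx] using hy)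
      have h2 : (Finset.univ.filter fun j => ∃ Y, Function.update C.pend i none j = some Y ∧
          ¬ G Y).card + 1 ≤ (Finset.univ.filter fun j => ∃ Y, C.pend j = some Y ∧ ¬ G Y).card := by
        refine Finset.card_lt_card ⟨fun j hj => ?_, fun hsub => ?_⟩
        · simp only [Finset.mem_filter, Finset.mem_univ, true_and] at hj ⊢
          by_cases hji : j = i
          · subst hji
            simp at hj
          · simpa [hji] using hj
        · have := hsub (show i ∈ _ by
            simp only [Finset.mem_filter, Finset.mem_univ, true_and]
            exact ⟨X, hp, hX⟩)
          simp at this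
      convert (show _ + _ ≤ _ + _ from ?_) using 1
      dsimp only
      omega

end Situation

/-! ### Live values and the agreement invariant -/

namespace Situation

variable {V : Type u} {n d : ℕ}

/-- The values that are decided in instance `s` or occur in a sixuplet in play that has reached
level "up" of round `r`. -/
def live (s r : ℕ) (C : Situation V n d) : Set (WithBot V) :=
  {y | (∃ i a, C.dec i = some a ∧ (a : WithBot V) = y) ∨
    ∃ Z, InPlay C Z ∧ Z.sn = s ∧ (r < Z.rd ∨ Z.rd = r ∧ Z.up = true) ∧ Z.val = y}

/-- The values of the sixuplets in play at level "up" of round `r`. -/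
def liveUp (s r : ℕ) (C : Situation V n d) : Set (WithBot V) :=
  {y | ∃ Z, InPlay C Z ∧ Z.sn = s ∧ Z.rd = r ∧ Z.up = true ∧ Z.val = y}

theorem liveUp_subset_live (s r : ℕ) (C : Situation V n d) : liveUp s r C ⊆ live s r C := by
  rintro y ⟨Z, h1, h2, h3, h4, h5⟩
  exact Or.inr ⟨Z, h1, h2, Or.inr ⟨h3, h4⟩, h5⟩

theorem live_anti {s r r' : ℕ} (h : r ≤ r') (C : Situation V n d) : live s r' C ⊆ live s r C := by
  rintro y (h1 | ⟨Z, h1, h2, h3, h4⟩)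
  · exact Or.inl h1
  · refine Or.inr ⟨Z, h1, h2, ?_, h4⟩
    rcases h3 with h3 | h3
    · left; omega
    · rcases h.lt_or_eq with h | rfl
      · left; omega
      · exact Or.inr h3

/-- No register is ahead, so each live value in `Y` belongs to a process that has decided it or is
about to write it. Such a process has no bad pending write: after its decision it writes only in
later instances, and otherwise `hY` applies. Different values need different processes, so at most n
- k ≤ d processes remain that can be bad. -/
theorem badCount_le_of_live {s r k : ℕ} {C : Situation V n d}
    (hside : ∀ i X, C.dec i ≠ none → C.pend i = some X → s < X.sn)
    (hm : ∀ x, ¬ Ahead s r (C.mem x)) {G : Sixuplet V → Prop} (hmG : ∀ x, G (C.mem x))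
    (hs : ∀ Z, s < Z.sn → G Z) (Y : Set (WithBot V))
    (hY : ∀ Z, Z.sn = s → Ahead s r Z → Z.val ∈ Y → G Z)
    (hk : (k : ℕ∞) ≤ (live s r C ∩ Y).encard) (hn : n ≤ k + d) : badCount G C ≤ d := by
  classical
  have h0 : (Finset.univ.filter fun x => ¬ G (C.mem x)).card = 0 := by
    rw [Finset.card_eq_zero, Finset.filter_eq_empty_iff]
    exact fun x _ h => h (hmG x)
  set B := Finset.univ.filter fun i => ∃ X, C.pend i = some X ∧ ¬ G X with hB
  have hbad : badCount G C = B.card := by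
    unfold badCount
    convert Nat.zero_add _
  rw [hbad]
  -- The value for which a process stands. On the processes without a bad pending write, `f` attains
  -- every live value in `Y`; `⊥` is a dummy.
  let f : Fin n → WithBot V := fun i =>
    match C.dec i with
    | some a => (a : WithBot V)
    | none => match C.pend i with
      | some X => X.val
      | none => ⊥
  have hsub : live s r C ∩ Y ⊆ ((Bᶜ.image f : Finset (WithBot V)) : Set (WithBot V)) := by
    rintro y ⟨hy, hyY⟩
    simp only [Finset.coe_image, Set.mem_image, Finset.mem_coe, Finset.mem_compl]
    have hdec : ∀ i, C.dec i ≠ none → i ∉ B := by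
      intro i hi hiB
      simp only [hB, Finset.mem_filter, Finset.mem_univ, true_and] at hiB
      obtain ⟨X, hX, hGX⟩ := hiB
      exact hGX (hs X (hside i X hi hX))
    rcases hy with ⟨i, a, hi, rfl⟩ | ⟨Z, hZ, hZs, hZr, rfl⟩
    · exact ⟨i, hdec i (by simp [hi]), by simp [f, hi]⟩
    · rcases hZ with ⟨x, rfl⟩ | ⟨i, hi⟩
      · exact absurd (Or.inr ⟨hZs, hZr⟩) (hm x)
      · have hnone : C.dec i = none := by
          by_contra h
          have := hside i Z h hi
          omega
        refine ⟨i, ?_, by simp [f, hnone, hi]⟩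
        simp only [hB, Finset.mem_filter, Finset.mem_univ, true_and]
        rintro ⟨X, hX, hGX⟩
        rw [hi] at hX
        cases hX
        exact hGX (hY Z hZs (Or.inr ⟨hZs, hZr⟩) hyY)
  have h1 := hk.trans (Set.encard_le_encard hsub)
  rw [Set.encard_coe_eq_coe_finsetCard] at h1
  have h2 : k ≤ Bᶜ.card := le_trans (by exact_mod_cast h1) Finset.card_image_le
  have h3 := B.card_add_card_compl
  rw [Fintype.card_fin] at h3
  omega

theorem InPlay.of_snap {C : Situation V n d} {i : Fin n} {X Z : Sixuplet V}
    (h : InPlay { C with pend := Function.update C.pend i (some X) } Z) : InPlay C Z ∨ Z = X := by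
  rcases h with h | ⟨j, hj⟩
  · exact Or.inl (Or.inl h)
  · by_cases hji : j = i
    · subst hji
      simp at hj
      exact Or.inr hj.symm
    · simp [hji] at hj
      exact Or.inl (Or.inr ⟨j, hj⟩)

theorem InPlay.of_write {C : Situation V n d} {i : Fin n} {x : Fin (d + 1)} {X Z : Sixuplet V}
    (hp : C.pend i = some X)
    (h : InPlay (⟨Function.update C.mem x X, Function.update C.pend i none, C.dec⟩ :
      Situation V n d) Z) : InPlay C Z := by
  rcases h with ⟨y, hy⟩ | ⟨j, hj⟩
  · by_cases hyx : y = x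
    · subst hyx
      simp at hy
      exact Or.inr ⟨i, by rw [hp, hy]⟩
    · simp [hyx] at hy
      exact Or.inl ⟨y, hy⟩
  · by_cases hji : j = i
    · subst hji
      simp at hj
    · simp [hji] at hj
      exact Or.inr ⟨j, hj⟩

/-- How new values become live: a decision in a lower round, or an announcement after a snapshot
in which all registers agree. -/
theorem Move.live_subset {s r : ℕ} (hr : 1 ≤ r) {C C' : Situation V n d} (h : Move s C C') :
    live s r C' ⊆ live s r C ∨
    (C'.mem = C.mem ∧ ∃ (ρ : ℕ) (y : WithBot V), live s r C' ⊆ insert y (live s r C) ∧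
      y ∈ live s r C' ∧ 1 ≤ ρ ∧
      ((ρ < r ∧ live s ρ C' ⊆ live s ρ C ∧ ∀ x, (C.mem x).sn = s ∧ (C.mem x).rd = ρ ∧
          (C.mem x).up = true ∧ (C.mem x).cfl = false ∧ (C.mem x).val = y) ∨
        (ρ + 1 = r ∧ ∀ x, (C.mem x).sn = s ∧ (C.mem x).rd = ρ ∧ (C.mem x).up = false ∧
          (C.mem x).cfl = false ∧ (C.mem x).val = y) ∨
        (ρ = r ∧ liveUp s r C' ⊆ liveUp s r C ∧ ∃ c, ∀ x, (C.mem x).sn = s ∧ (C.mem x).rd = r ∧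
          (C.mem x).up = false ∧ (C.mem x).cfl = c ∧ (C.mem x).val = y))) := by
  cases h with
  | idle => exact Or.inl le_rfl
  | decide i a ρ hρ hp hd hm =>
    have hsub : ∀ r, live s r { C with dec := Function.update C.dec i (some a) } ⊆
        insert (a : WithBot V) (live s r C) := by
      rintro r y (⟨j, b, hj, rfl⟩ | hy)
      · by_cases hji : j = i
        · subst hji
          simp at hj
          exact Or.inl (by rw [hj])
        · simp [hji] at hj
          exact Or.inr (Or.inl ⟨j, b, hj, rfl⟩)
      · exact Or.inr (Or.inr hy)
    -- For rounds up to `ρ` the decided value is not new: the registers already hold it at level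
    -- "up" of round `ρ`.
    have hin : ∀ r, r ≤ ρ →
        live s r { C with dec := Function.update C.dec i (some a) } ⊆ live s r C := by
      intro r hr y hy
      rcases hsub r hy with rfl | hy
      · obtain ⟨h1, h2, h3, h4, h5⟩ := hm 0
        exact Or.inr ⟨C.mem 0, Or.inl ⟨0, rfl⟩, h1, by rw [h2]; grind, h5⟩
      · exact hy
    by_cases hρr : r ≤ ρ
    · exact Or.inl (hin r hρr)
    · exact Or.inr ⟨rfl, ρ, a, hsub r, Or.inl ⟨i, a, by simp, rfl⟩, hρ,
        Or.inl ⟨by omega, hin ρ le_rfl, hm⟩⟩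
  | copy i j a hp hj =>
    left
    rintro y (⟨j', b, hj', rfl⟩ | hy)
    · by_cases hji : j' = i
      · subst hji
        simp at hj'
        exact Or.inl ⟨j, a, hj, by rw [hj']⟩
      · simp [hji] at hj'
        exact Or.inl ⟨j', b, hj', rfl⟩
    · exact Or.inr hy
  | write i x X hp =>
    left
    rintro y (hy | ⟨Z, hZ, h⟩)
    · exact Or.inl hy
    · exact Or.inr ⟨Z, hZ.of_write hp, h⟩
  | snap i X hp hX hd =>
    have hnew : ∀ y ∈ live s r { C with pend := Function.update C.pend i (some X) },
        y ∈ live s r C ∨ X.sn = s ∧ (r < X.rd ∨ X.rd = r ∧ X.up = true) ∧ X.val = y := by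
      rintro y (hy | ⟨Z, hZ, h⟩)
      · exact Or.inl (Or.inl hy)
      · rcases hZ.of_snap with hZ | rfl
        · exact Or.inl (Or.inr ⟨Z, hZ, h⟩)
        · exact Or.inr h
    have hXin : InPlay { C with pend := Function.update C.pend i (some X) } X :=
      Or.inr ⟨i, by simp⟩
    cases hX with
    | later h =>
      left
      intro y hy
      rcases hnew y hy with h' | h'
      · exact h'
      · omega
    | earlier h hm =>
      left
      intro y hy
      rcases hnew y hy with h' | h'
      · exact h'
      · omega
    | adopt h1 hm hX =>
      left
      intro y hy
      rcases hnew y hy with h' | ⟨e1, e2, e3⟩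
      · exact h'
      · rcases hX with ⟨h2, h3⟩ | ⟨x, a1, a2, a3, a4⟩
        · grind
        · exact Or.inr ⟨C.mem x, Or.inl ⟨x, rfl⟩, a1, by rw [a2, a3]; exact e2, by rw [a4, e3]⟩
    | raise ρ l c y hρ hm hl h1 h2 h3 h4 h5 =>
      have hsub : live s r { C with pend := Function.update C.pend i (some X) } ⊆
          insert y (live s r C) := by
        intro z hz
        rcases hnew z hz with h' | h'
        · exact Or.inr h'
        · exact Or.inl (by rw [← h'.2.2, h5])
      by_cases hA : r < X.rd ∨ X.rd = r ∧ X.up = true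
      swap
      · left
        intro y hy
        rcases hnew y hy with h' | h'
        · exact h'
        · exact absurd h'.2.1 hA
      have hy : y ∈ live s r { C with pend := Function.update C.pend i (some X) } :=
        Or.inr ⟨X, hXin, h1, hA, h5⟩
      -- If the agreeing registers are themselves at level "up" of round `r` or beyond, their value
      -- was live before. Otherwise they are at level "down" of round `r`, or one round lower.
      by_cases hB : r < ρ ∨ ρ = r ∧ l = true
      · left
        intro z hz
        rcases hsub hz with rfl | hz
        · obtain ⟨a1, a2, a3, a4, a5⟩ := hm 0
          exact Or.inr ⟨C.mem 0, Or.inl ⟨0, rfl⟩, a1, by rw [a2, a3]; exact hB, a5⟩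
        · exact hz
      refine Or.inr ⟨rfl, ρ, y, hsub, hy, hρ, ?_⟩
      by_cases hρr : ρ = r
      · subst hρr
        have hl' : l = false := by cases l <;> simp_all
        subst hl'
        refine Or.inr (Or.inr ⟨rfl, ?_, c, hm⟩)
        rintro z ⟨Z, hZ, b1, b2, b3, b4⟩
        rcases hZ.of_snap with hZ | rfl
        · exact ⟨Z, hZ, b1, b2, b3, b4⟩
        · omega
      · have : ρ + 1 = r := by omega
        have hup : X.up = true := by grind
        have hc : c = false := by
          rw [h3] at hup
          simpa using hup
        subst hc
        obtain rfl := hl rfl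
        exact Or.inr (Or.inl ⟨this, hm⟩)

/-- Each way for a new value to become live requires all registers to be below level "up" of round
`r`. -/
theorem Move.live_subset_of_ahead {s r : ℕ} (hr : 1 ≤ r) {C C' : Situation V n d}
    (h : Move s C C') (hA : ∃ x, Ahead s r (C.mem x)) : live s r C' ⊆ live s r C := by
  obtain ⟨x, hx⟩ := hA
  unfold Ahead at hx
  rcases h.live_subset hr with h | ⟨-, ρ, y, -, -, -, ⟨h1, -, h⟩ | ⟨h1, h⟩ | ⟨h1, -, c, h⟩⟩
  · exact h
  all_goals
    have := h x
    exfalso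
    grind

/-- A new value enters level "up" of round `r` only from registers that all agree in round `r - 1`;
an adoption at level "up" copies the value of a register. -/
theorem Move.liveUp_subset {s r : ℕ} {C C' : Situation V n d}
    (h : Move s C C') (hA : ∃ x, AtLeast s r (C.mem x)) : liveUp s r C' ⊆ liveUp s r C := by
  obtain ⟨x, hx⟩ := hA
  unfold AtLeast at hx
  rintro y ⟨Z, hZ, e1, e2, e3, e4⟩
  cases h with
  | idle => exact ⟨Z, hZ, e1, e2, e3, e4⟩
  | decide => exact ⟨Z, hZ, e1, e2, e3, e4⟩
  | copy => exact ⟨Z, hZ, e1, e2, e3, e4⟩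
  | write i x X hp => exact ⟨Z, hZ.of_write hp, e1, e2, e3, e4⟩
  | snap i X hp hX hd =>
    rcases hZ.of_snap with hZ | rfl
    · exact ⟨Z, hZ, e1, e2, e3, e4⟩
    · cases hX with
      | later h => omega
      | earlier h hm => omega
      | raise ρ l c y hρ hm hl h1 h2 h3 h4 h5 =>
        have := hm x
        omega
      | adopt h1 hm hX =>
        rcases hX with ⟨h2, h3⟩ | ⟨x, a1, a2, a3, a4⟩
        · simp_all
        · exact ⟨C.mem x, Or.inl ⟨x, rfl⟩, a1, by rw [a2, e2], by rw [a3, e3], by rw [a4, e4]⟩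

/-- No process can decide `y` in round `r` any more. -/
def Excluded (s r : ℕ) (y : WithBot V) (C : Situation V n d) : Prop :=
  badCount (Against s r y) C ≤ d ∨ badCount (AtLeast s r) C ≤ d ∧ y ∉ liveUp s r C

/-- No value can enter level "up" of round `r` any more, except for values that are live. -/
def Sealed (s k r : ℕ) (C : Situation V n d) : Prop :=
  (∃ ρ, 1 ≤ ρ ∧ ρ < r ∧ badCount (Ahead s ρ) C ≤ d ∧ (live s ρ C).encard ≤ k) ∨
  (∃ y ∈ live s r C, ∃ ρ, ρ + 1 = r ∧ badCount (Tied s ρ y) C ≤ d) ∨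
  badCount (AtLeast s r) C ≤ d

/-- Either no decision can be made in round `r`, or the number of live values is controlled. -/
def Controlled (s k r : ℕ) (C : Situation V n d) : Prop :=
  (∀ y, Excluded s r y C) ∨
    (live s r C).encard ≤ k ∧ ((live s r C).encard = k → Sealed s k r C)

theorem Move.excluded {s r : ℕ} {y : WithBot V} {C C' : Situation V n d} (h : Move s C C')
    (hE : Excluded s r y C) : Excluded s r y C' := by
  rcases hE with hE | ⟨h1, h2⟩
  · exact Or.inl (h.badCount_le (inherited_against s r y) hE)
  · exact Or.inr ⟨h.badCount_le (inherited_atLeast s r) h1,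
      fun hy => h2 (h.liveUp_subset (exists_good h1) hy)⟩

/-- The registers on which a decision is based refute both alternatives of `Excluded`: none of them
is against `y`, and they hold `y` at level "up" of round `r`. -/
theorem not_excluded {s r : ℕ} {y : WithBot V} {C : Situation V n d}
    (hm : ∀ x, (C.mem x).sn = s ∧ (C.mem x).rd = r ∧ (C.mem x).up = true ∧
      (C.mem x).cfl = false ∧ (C.mem x).val = y) : ¬ Excluded s r y C := by
  rintro (h | ⟨-, h⟩)
  · obtain ⟨x, hx⟩ := exists_good h
    have := hm x
    unfold Against at hx
    grind
  · obtain ⟨h1, h2, h3, h4, h5⟩ := hm 0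
    exact h ⟨C.mem 0, Or.inl ⟨0, rfl⟩, h1, h2, h3, h5⟩

/-- The decisions of instance `s` are those of processes that have left it. -/
def Left (s : ℕ) (C : Situation V n d) : Prop :=
  ∀ i X, C.dec i ≠ none → C.pend i = some X → s < X.sn

theorem Move.left {s : ℕ} {C C' : Situation V n d} (h : Move s C C') (hC : Left s C) :
    Left s C' := by
  intro j Y hj hY
  cases h with
  | idle => exact hC j Y hj hY
  | decide i a ρ hρ hp hd hm =>
    by_cases hji : j = i
    · subst hji
      simp [hp] at hY
    · exact hC j Y (by simpa [hji] using hj) hY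
  | copy i j' a hp hj' =>
    by_cases hji : j = i
    · subst hji
      simp [hp] at hY
    · exact hC j Y (by simpa [hji] using hj) hY
  | snap i X hp hX hd =>
    by_cases hji : j = i
    · subst hji
      simp at hY
      exact hY ▸ hd hj
    · exact hC j Y hj (by simpa [hji] using hY)
  | write i x X hp =>
    by_cases hji : j = i
    · subst hji
      simp at hY
    · exact hC j Y hj (by simpa [hji] using hY)

theorem encard_diff_singleton_ge {α : Type*} {S : Set α} {k : ℕ}
    (h : ((k + 1 : ℕ) : ℕ∞) ≤ S.encard) (y : α) : (k : ℕ∞) ≤ (S ∩ {z | z ≠ y}).encard := by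
  have h1 : S ⊆ insert y (S ∩ {z | z ≠ y}) := fun z hz => by
    by_cases hzy : z = y
    · exact Or.inl hzy
    · exact Or.inr ⟨hz, hzy⟩
  have h2 := h.trans ((Set.encard_le_encard h1).trans (Set.encard_insert_le _ _))
  push_cast at h2
  exact (ENat.add_le_add_iff_right (by simp)).1 h2

/-- The seals and exclusions persist because they rest on inherited properties. What remains is an
event that makes a new value `y` live. The registers then all agree on `y` in some round `ρ ≤ r`,
and the number of processes carrying live values yields the new seal or exclusion. -/
theorem Move.controlled {s k : ℕ} (hn : n ≤ k + d) {C C' : Situation V n d} (h : Move s C C')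
    (hside : Left s C) (hC : ∀ r, 1 ≤ r → Controlled s k r C) {r : ℕ} (hr : 1 ≤ r) :
    Controlled s k r C' := by
  have hside' := h.left hside
  rcases hC r hr with hE | ⟨hle, hseal⟩
  · exact Or.inl fun y => h.excluded (hE y)
  have hkey : ∀ S T : Set (WithBot V), S ⊆ T → T.encard ≤ k → S.encard = k → S = T := by
    intro S T hST hT hS
    exact ((Set.finite_of_encard_le_coe hT).subset hST).eq_of_subset_of_encard_le hST
      (by rw [hS]; exact hT)
  -- Without newcomers, having k live values after the event means that they are the same k as
  -- before, and the old seal survives.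
  by_cases hsub : live s r C' ⊆ live s r C
  · right
    refine ⟨(Set.encard_le_encard hsub).trans hle, fun heq => ?_⟩
    have hEq := hkey _ _ hsub hle heq
    rcases hseal (by rw [← hEq, heq]) with ⟨ρ, h1, h2, h3, h4⟩ | ⟨y, hy, ρ, h1, h2⟩ | h1
    · exact Or.inl ⟨ρ, h1, h2, h.badCount_le (inherited_ahead s ρ) h3,
        (Set.encard_le_encard (h.live_subset_of_ahead h1 (exists_good h3))).trans h4⟩
    · exact Or.inr (Or.inl ⟨y, hEq ▸ hy, ρ, h1, h.badCount_le (inherited_tied s ρ y) h2⟩)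
    · exact Or.inr (Or.inr (h.badCount_le (inherited_atLeast s r) h1))
  obtain ⟨hmem, ρ, y, hins, hyin, hρ, hcase⟩ := (h.live_subset hr).resolve_left hsub
  have hynot : y ∉ live s r C := fun hy => hsub (hins.trans (Set.insert_subset hy le_rfl))
  have hcard : (live s r C').encard ≤ (live s r C).encard + 1 :=
    (Set.encard_le_encard hins).trans (Set.encard_insert_le _ _)
  rcases hcase with ⟨hρr, hlρ, hm⟩ | ⟨hρr, hm⟩ | ⟨hρr, hU, c, hm⟩
  -- A decision in a round `ρ < r`. This round is not excluded, so at most k values are live for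
  -- `ρ`, hence for `r`. If k are live for `r`, their carriers and all registers are at level "up"
  -- of round `ρ` at least, which gives the seal `Ahead s ρ`.
  · have hρ' := (hC ρ hρ).resolve_left fun hE => not_excluded hm (hE y)
    have hle' : (live s ρ C').encard ≤ k := (Set.encard_le_encard hlρ).trans hρ'.1
    right
    refine ⟨(Set.encard_le_encard (live_anti hρr.le C')).trans hle', fun heq => ?_⟩
    refine Or.inl ⟨ρ, hρ, hρr, ?_, hle'⟩
    refine badCount_le_of_live (r := r) hside' ?_ ?_ ?_ Set.univ ?_
      (by rw [Set.inter_univ, heq]) hn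
    · intro x hx
      have := hm x
      rw [hmem] at hx
      unfold Ahead at hx
      omega
    · intro x
      have := hm x
      rw [hmem]
      unfold Ahead
      grind
    · exact fun Z hZ => Or.inl hZ
    · intro Z hZ hA _
      unfold Ahead at hA ⊢
      omega
  · right
    -- An announcement out of round `r - 1`. If k values were live before, each kind of seal would
    -- exclude it: the first freezes the live values, the second forces `y` to be the live value
    -- `y'`, and the third puts some register in round `r`.
    have hlt : (live s r C).encard < k := by
      refine lt_of_le_of_ne hle fun heq => ?_
      rcases hseal heq with ⟨ρ', h1, h2, h3, h4⟩ | ⟨y', hy', ρ', h1, h2⟩ | h1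
      · have e1 := h.live_subset_of_ahead h1 (exists_good h3)
        have e2 := hkey _ _ (live_anti h2.le C) h4 heq
        exact hsub (((live_anti h2.le C').trans e1).trans e2.symm.subset)
      · obtain rfl : ρ = ρ' := by omega
        obtain ⟨x, hx⟩ := exists_good h2
        have := hm x
        unfold Tied at hx
        have : y = y' := by grind
        exact hynot (this ▸ hy')
      · obtain ⟨x, hx⟩ := exists_good h1
        have := hm x
        unfold AtLeast at hx
        omega
    refine ⟨hcard.trans (Order.add_one_le_of_lt hlt), fun heq => ?_⟩
    refine Or.inr (Or.inl ⟨y, hyin, ρ, hρr, ?_⟩)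
    refine badCount_le_of_live (r := r) hside' ?_ ?_ ?_ Set.univ ?_
      (by rw [Set.inter_univ, heq]) hn
    · intro x hx
      have := hm x
      rw [hmem] at hx
      unfold Ahead at hx
      omega
    · intro x
      have := hm x
      rw [hmem]
      unfold Tied
      grind
    · exact fun Z hZ => Or.inl hZ
    · intro Z hZ hA _
      unfold Ahead at hA
      exact Or.inr ⟨hZ, Or.inl (by omega)⟩
  -- The registers agree at level "down" of round `r`, and the newcomer is written in round `r + 1`.
  -- This may exceed k, but then it makes decisions in round `r` impossible.
  · have hnA : ∀ x, ¬ Ahead s r (C'.mem x) := by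
      intro x hx
      have := hm x
      rw [hmem] at hx
      unfold Ahead at hx
      grind
    have hAL : (k : ℕ∞) ≤ (live s r C').encard → badCount (AtLeast s r) C' ≤ d := by
      intro hk
      refine badCount_le_of_live (r := r) hside' hnA ?_ ?_ Set.univ ?_
        (by rwa [Set.inter_univ]) hn
      · intro x
        have := hm x
        rw [hmem]
        unfold AtLeast
        omega
      · exact fun Z hZ => Or.inl hZ
      · intro Z hZ hA _
        unfold Ahead at hA
        unfold AtLeast
        omega
    by_cases hk1 : ((k + 1 : ℕ) : ℕ∞) ≤ (live s r C').encard
    · left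
      intro z
      -- If the registers have a conflict or a value other than `z`, they are against `z`, and so
      -- are the carriers of the at least k live values different from `z`. Otherwise `z = y` has no
      -- conflict; but `y` was not live, so it does not occur at level "up" of round `r`, and it
      -- cannot get there since some register remains in round `r` at least.
      by_cases hz : c = true ∨ y ≠ z
      · left
        refine badCount_le_of_live (r := r) hside' hnA ?_ ?_ {z' | z' ≠ z} ?_
          (encard_diff_singleton_ge hk1 z) hn
        · intro x
          have := hm x
          rw [hmem]
          unfold Against
          grind
        · exact fun Z hZ => Or.inl hZ
        · intro Z hZ hA hne
          have hne' : Z.val ≠ z := hne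
          unfold Ahead at hA
          unfold Against
          grind
      · right
        push Not at hz
        refine ⟨hAL (le_trans (by exact_mod_cast Nat.le_succ k) hk1), fun hzU => ?_⟩
        rw [← hz.2] at hzU
        exact hynot (liveUp_subset_live s r C (hU hzU))
    · right
      have hle' : (live s r C').encard ≤ k := by
        rw [not_le] at hk1
        push_cast at hk1
        exact Order.le_of_lt_add_one hk1
      exact ⟨hle', fun heq => Or.inr (Or.inr (hAL heq.ge))⟩

theorem decisions_subset_live (s r : ℕ) (C : Situation V n d) :
    (WithBot.some '' {a | ∃ i, C.dec i = some a} : Set (WithBot V)) ⊆ live s r C := by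
  rintro _ ⟨a, ⟨i, hi⟩, rfl⟩
  exact Or.inl ⟨i, a, hi, rfl⟩

/-- The invariant of an instance. -/
structure Safe (s k : ℕ) (C : Situation V n d) : Prop where
  left : Left s C
  controlled : ∀ r, 1 ≤ r → Controlled s k r C
  agreement : {a | ∃ i, C.dec i = some a}.encard ≤ k

/-- A decision in round `ρ` shows that `ρ` is not excluded, so at most k values are live for `ρ`;
all decisions, including the new one, are among them. -/
theorem Move.safe {s k : ℕ} (hn : n ≤ k + d) {C C' : Situation V n d} (h : Move s C C')
    (hC : Safe s k C) : Safe s k C' := by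
  refine ⟨h.left hC.left, fun r hr => h.controlled hn hC.left hC.controlled hr, ?_⟩
  cases h with
  | idle => exact hC.agreement
  | snap => exact hC.agreement
  | write => exact hC.agreement
  | copy i j a hp hj =>
    refine (Set.encard_le_encard ?_).trans hC.agreement
    rintro b ⟨j', hj'⟩
    by_cases hji : j' = i
    · subst hji
      simp at hj'
      exact ⟨j, by rw [hj, hj']⟩
    · exact ⟨j', by simpa [hji] using hj'⟩
  | decide i a ρ hρ hp hd hm =>
    have hρ' := (hC.controlled ρ hρ).resolve_left fun hE => not_excluded hm (hE a)
    rw [← WithBot.coe_injective.encard_image]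
    refine (Set.encard_le_encard ?_).trans hρ'.1
    refine (decisions_subset_live s ρ _).trans ?_
    refine (Move.decide i a ρ hρ hp hd hm).live_subset_of_ahead hρ ⟨0, ?_⟩
    have := hm 0
    unfold Ahead
    grind

/-- Nothing is live, and as k is positive, no seal is demanded. -/
theorem safe_of_quiescent {s k : ℕ} (hs : 1 ≤ s) (hk : 1 ≤ k) {C : Situation V n d}
    (hm : ∀ x, (C.mem x).sn = 0) (hp : ∀ i, C.pend i = none) (hd : ∀ i, C.dec i = none) :
    Safe s k C := by
  have hlive : ∀ r, live s r C = ∅ := by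
    intro r
    rw [Set.eq_empty_iff_forall_notMem]
    rintro y (⟨i, a, h, -⟩ | ⟨Z, ⟨x, rfl⟩ | ⟨i, h⟩, h2, -⟩)
    · simp [hd] at h
    · have := hm x
      omega
    · simp [hp] at h
  refine ⟨fun i X h => absurd (hd i) h, fun r _ => Or.inr ?_, ?_⟩
  · rw [hlive, Set.encard_empty]
    refine ⟨zero_le, fun h => ?_⟩
    have : (0 : ℕ) = k := by exact_mod_cast h
    omega
  · simp [hd]

end Situation

/-! ### The order on sixuplets, `sup`, and the computation after a snapshot -/

namespace Sixuplet

variable {V : Type u}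

theorem key_eq_iff {X Y : Sixuplet V} : X.key = Y.key ↔
    X.sn = Y.sn ∧ X.rd = Y.rd ∧ X.up = Y.up ∧ X.cfl = Y.cfl ∧ X.val = Y.val := by
  simp [key]

variable [LinearOrder V]

theorem key_le_iff {X Y : Sixuplet V} : X.key ≤ Y.key ↔
    X.sn < Y.sn ∨ X.sn = Y.sn ∧ (X.rd < Y.rd ∨ X.rd = Y.rd ∧ (X.up < Y.up ∨ X.up = Y.up ∧
      (X.cfl < Y.cfl ∨ X.cfl = Y.cfl ∧ X.val ≤ Y.val))) := by
  simp [key, Prod.Lex.toLex_le_toLex]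

/-- A sixuplet is not smaller than those from which it has been computed. -/
theorem key_le_sup {mx : List (Sixuplet V) → Sixuplet V} (hmx : IsMaxRule mx)
    {T : List (Sixuplet V)} {X : Sixuplet V} (hX : X ∈ T) : X.key ≤ (sup mx T).key := by
  obtain ⟨h1, h2⟩ := hmx T (List.ne_nil_of_mem hX)
  have h := h2 X hX
  -- `sup` changes only the flag of the maximum, and only upwards, because the maximum is itself one
  -- of the arguments.
  have hc : (mx T).cfl = true → (sup mx T).cfl = true := fun h => by
    simp only [sup, decide_eq_true_eq]
    exact Or.inl ⟨mx T, h1, rfl, rfl, h⟩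
  refine h.trans (key_le_iff.2 (Or.inr ⟨rfl, Or.inr ⟨rfl, Or.inr ⟨rfl, ?_⟩⟩⟩))
  by_cases hm : (mx T).cfl = true
  · exact Or.inr ⟨by rw [hm, hc hm], le_rfl⟩
  · by_cases hs : (sup mx T).cfl = true
    · left
      rw [hs]
      simp [Bool.lt_iff, hm]
    · exact Or.inr ⟨by simp_all, le_rfl⟩

theorem exists_eq_sup {mx : List (Sixuplet V) → Sixuplet V} (hmx : IsMaxRule mx)
    {T : List (Sixuplet V)} (hT : T ≠ []) : ∃ Z ∈ T, Z.sn = (sup mx T).sn ∧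
      Z.rd = (sup mx T).rd ∧ Z.up = (sup mx T).up ∧ Z.val = (sup mx T).val ∧
      Z.dcd = (sup mx T).dcd :=
  ⟨mx T, (hmx T hT).1, rfl, rfl, rfl, rfl, rfl⟩

/-- Of two different values at least one differs from the maximal one, so that a discovered conflict
can be tested against the value of `sup` alone. -/
theorem sup_cfl_iff {mx : List (Sixuplet V) → Sixuplet V} (hmx : IsMaxRule mx)
    {T : List (Sixuplet V)} (hT : T ≠ []) : (sup mx T).cfl = true ↔
      ∃ X ∈ T, X.sn = (sup mx T).sn ∧ X.rd = (sup mx T).rd ∧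
        (X.cfl = true ∨ X.val ≠ (sup mx T).val) := by
  have hmem := (hmx T hT).1
  simp only [sup, decide_eq_true_eq]
  constructor
  · rintro (⟨X, hX, h1, h2, h3⟩ | ⟨X, hX, Y, hY, ⟨h1, h2⟩, ⟨h3, h4⟩, h5⟩)
    · exact ⟨X, hX, h1, h2, Or.inl h3⟩
    · by_cases h : X.val = (mx T).val
      · exact ⟨Y, hY, h3, h4, Or.inr fun h' => h5 (h.trans h'.symm)⟩
      · exact ⟨X, hX, h1, h2, Or.inr h⟩
  · rintro ⟨X, hX, h1, h2, h3 | h3⟩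
    · exact Or.inl ⟨X, hX, h1, h2, h3⟩
    · exact Or.inr ⟨X, hX, mx T, hmem, ⟨h1, h2⟩, ⟨rfl, rfl⟩, h3⟩

theorem key_minIndex_le {d : ℕ} (view : Fin (d + 1) → Sixuplet V) (y : Fin (d + 1)) :
    (view (minIndex view)).key ≤ (view y).key := by
  have := Finset.min'_mem _ (exists_minimal view)
  simp only [Finset.mem_filter, Finset.mem_univ, true_and] at this
  exact this y

end Sixuplet

open Sixuplet

/-- All registers agree on their first five fields, with sequence number `s` and a positive
round. -/
def Homogeneous {V : Type u} {d : ℕ} (s : ℕ) (view : Fin (d + 1) → Sixuplet V) : Prop :=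
  (∀ x, (view x).key = (view 0).key) ∧ (view 0).sn = s ∧ 0 < (view 0).rd

theorem Homogeneous.fields {V : Type u} {d s : ℕ} {view : Fin (d + 1) → Sixuplet V} (h : Homogeneous s view)
    (x : Fin (d + 1)) : (view x).sn = s ∧ (view x).rd = (view 0).rd ∧ (view x).up = (view 0).up ∧
      (view x).cfl = (view 0).cfl ∧ (view x).val = (view 0).val := by
  obtain ⟨h1, h2, h3, h4, h5⟩ := key_eq_iff.1 (h.1 x)
  exact ⟨h1.trans h.2.1, h2, h3, h4, h5⟩

namespace Proposing

variable {V : Type u} {d : ℕ}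

/-- The sixuplet with which a process enters its current instance. -/
def entry (b : Proposing V d) : Sixuplet V := ⟨b.sn, 1, false, false, b.val, b.dcd⟩

/-- The arguments of the function `sup` after a snapshot. -/
def candidates (b : Proposing V d) (view : Fin (d + 1) → Sixuplet V) : List (Sixuplet V) :=
  List.ofFn view ++ [b.entry]

theorem mem_candidates {b : Proposing V d} {view : Fin (d + 1) → Sixuplet V} {X : Sixuplet V} :
    X ∈ b.candidates view ↔ (∃ x, view x = X) ∨ X = b.entry := by
  simp only [candidates, List.mem_append, List.mem_ofFn, List.mem_singleton]

theorem candidates_ne_nil (b : Proposing V d) (view : Fin (d + 1) → Sixuplet V) :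
    b.candidates view ≠ [] := by simp [candidates]

/-- What a process writes when all registers agree and it does not decide. -/
def raised (b : Proposing V d) (X : Sixuplet V) : Sixuplet V :=
  ⟨b.sn, X.rd + 1, !X.cfl, false, X.val, b.dcd⟩

variable [LinearOrder V]

/-- The two branches that raise the round merge into one, since the level that they write is the
negation of the conflict flag. -/
theorem afterSnapshot_cases (mx : List (Sixuplet V) → Sixuplet V) (b : Proposing V d)
    (view : Fin (d + 1) → Sixuplet V) :
    (Homogeneous b.sn view ∧ (view 0).up = true ∧ (view 0).cfl = false ∧
      b.afterSnapshot mx view = b.finish (view 0).val) ∨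
    (Homogeneous b.sn view ∧ ((view 0).cfl = false → (view 0).up = false) ∧
      b.afterSnapshot mx view = b.goWrite 0 (b.raised (view 0))) ∨
    (¬ Homogeneous b.sn view ∧ b.sn < (sup mx (b.candidates view)).sn ∧
      b.afterSnapshot mx view = b.finish (sup mx (b.candidates view)).dcd[b.sn - 1]?) ∨
    (¬ Homogeneous b.sn view ∧ (sup mx (b.candidates view)).sn ≤ b.sn ∧
      b.afterSnapshot mx view = b.goWrite (minIndex view) (sup mx (b.candidates view))) := by
  by_cases hH : Homogeneous b.sn view
  · have hH' := hH
    unfold Homogeneous at hH'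
    unfold afterSnapshot
    dsimp only
    rw [if_pos hH']
    cases h1 : (view 0).up <;> cases h2 : (view 0).cfl <;> simp [hH, raised, h2]
  · have hH' := hH
    unfold Homogeneous at hH'
    unfold afterSnapshot
    dsimp only
    rw [if_neg hH']
    change _ ∨ _ ∨ _ ∧ _ ∧ (if b.sn < (sup mx (b.candidates view)).sn then _ else _) = _ ∨
      _ ∧ _ ∧ (if b.sn < (sup mx (b.candidates view)).sn then _ else _) = _
    by_cases hs : b.sn < (sup mx (b.candidates view)).sn
    · rw [if_pos hs]
      exact Or.inr (Or.inr (Or.inl ⟨hH, hs, rfl⟩))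
    · rw [if_neg hs]
      exact Or.inr (Or.inr (Or.inr ⟨hH, not_lt.1 hs, rfl⟩))

end Proposing

/-! ### Runs on the snapshot object: invariants and validity -/

/-- The protocol of the repeated set agreement algorithm for `d + 1` registers. -/
def setAgreement {V : Type u} [LinearOrder V] (n d : ℕ)
    (mx : List (Sixuplet V) → Sixuplet V) : Protocol.{u, u, u} V n (d + 1) :=
  Protocol.anonymous n (fun _ => Sixuplet.bottom) (repeatedProgram d mx)

namespace setAgreement

open Protocol

variable {V : Type u} [LinearOrder V] {n d : ℕ} {mx : List (Sixuplet V) → Sixuplet V}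

/-- The content of the registers. -/
def reg (C : (setAgreement n d mx).Config) : Fin (d + 1) → Sixuplet V := C.mem

/-- The local state of a process. -/
def st (C : (setAgreement n d mx).Config) (i : Fin n) : List V ⊕ Proposing V d := C.loc i

/-- The return of an operation. -/
def returned (C : (setAgreement n d mx).Config) (i : Fin n) (a : V) (L : List V) :
    (setAgreement n d mx).Config :=
  C.settle i (Outcome.ret a L : Outcome V (List V) (Proposing V d))

/-- The continuation of an operation. -/
def stayed (C : (setAgreement n d mx).Config) (i : Fin n) (b : Proposing V d) :
    (setAgreement n d mx).Config :=
  C.settle i (Outcome.stay b : Outcome V (List V) (Proposing V d))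

section simps

variable (C : (setAgreement n d mx).Config) (i : Fin n) (a : V) (L : List V) (b : Proposing V d)

@[simp] theorem reg_returned : reg (returned C i a L) = reg C := rfl
@[simp] theorem sn_returned : (returned C i a L).sn = C.sn := rfl
@[simp] theorem dec_returned : (returned C i a L).dec =
    Function.update C.dec i (Function.update (C.dec i) (C.sn i) (some a)) := rfl
@[simp] theorem st_returned (j : Fin n) : st (returned C i a L) j =
    Function.update (st C) i (Sum.inl L) j := rfl
@[simp] theorem sn_stayed : (stayed C i b).sn = C.sn := rfl
@[simp] theorem prop_stayed : (stayed C i b).prop = C.prop := rfl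
@[simp] theorem st_stayed (j : Fin n) : st (stayed C i b) j =
    Function.update (st C) i (Sum.inr b) j := rfl

end simps

/-- The invocation of an operation. -/
def invoked (C : (setAgreement n d mx).Config) (i : Fin n) (a : V) (L : List V) :
    (setAgreement n d mx).Config :=
  stayed { C with
    sn := Function.update C.sn i (C.sn i + 1)
    prop := Function.update C.prop i (Function.update (C.prop i) (C.sn i + 1) (some a)) } i
    ⟨C.sn i + 1, a, L, none⟩

/-- A write. -/
def written (C : (setAgreement n d mx).Config) (i : Fin n) (b : Proposing V d) (x : Fin (d + 1))
    (X : Sixuplet V) : (setAgreement n d mx).Config :=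
  stayed ({ C with mem := Function.update (reg C) x X } : (setAgreement n d mx).Config) i
    { b with pending := none }

theorem step_idle {C : (setAgreement n d mx).Config} {e : Fin n × V} {L : List V}
    (h : st C e.1 = Sum.inl L) : C.step e = invoked C e.1 e.2 L := by
  unfold Config.step
  rw [show C.loc e.1 = Sum.inl L from h]
  rfl

theorem step_snapshot {C : (setAgreement n d mx).Config} {e : Fin n × V} {b : Proposing V d}
    (h : st C e.1 = Sum.inr b) (hb : b.pending = none) :
    C.step e = C.settle e.1 (b.afterSnapshot mx (reg C)) := by
  unfold Config.step
  rw [show C.loc e.1 = Sum.inr b from h]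
  obtain ⟨s, a, L, p⟩ := b
  dsimp only at hb
  subst hb
  rfl

theorem step_write {C : (setAgreement n d mx).Config} {e : Fin n × V} {b : Proposing V d}
    {x : Fin (d + 1)} {X : Sixuplet V} (h : st C e.1 = Sum.inr b)
    (hb : b.pending = some (x, X)) : C.step e = written C e.1 b x X := by
  unfold Config.step
  rw [show C.loc e.1 = Sum.inr b from h]
  obtain ⟨s, a, L, p⟩ := b
  dsimp only at hb
  subst hb
  rfl

end setAgreement

namespace setAgreement

open Protocol

variable {V : Type u} [LinearOrder V] {n d : ℕ} {mx : List (Sixuplet V) → Sixuplet V}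

/-- The list `L` contains decisions of the instances `1, 2, …`. -/
def Recorded (C : (setAgreement n d mx).Config) (L : List V) : Prop :=
  ∀ j a, L[j]? = some a → ∃ i, C.dec i (j + 1) = some a

/-- The properties of a sixuplet that is written in a run. -/
structure Sound (C : (setAgreement n d mx).Config) (X : Sixuplet V) : Prop where
  eq_bottom : X.sn = 0 → X = Sixuplet.bottom
  valid : 1 ≤ X.sn → ∃ a j, X.val = (a : V) ∧ C.prop j X.sn = some a
  length : 1 ≤ X.sn → X.dcd.length + 1 = X.sn
  recorded : Recorded C X.dcd

/-- The properties of a process that is executing an operation. -/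
structure SoundBusy (C : (setAgreement n d mx).Config) (i : Fin n) (b : Proposing V d) :
    Prop where
  sn_eq : b.sn = C.sn i
  length : b.dcd.length + 1 = b.sn
  prop : C.prop i b.sn = some b.val
  recorded : Recorded C b.dcd
  pending : ∀ x X, b.pending = some (x, X) → Sound C X ∧ X.sn = b.sn

/-- The invariant of the runs. -/
structure Valid (C : (setAgreement n d mx).Config) : Prop where
  mem : ∀ x, Sound C (reg C x)
  idle : ∀ i L, st C i = Sum.inl L → L.length = C.sn i ∧ Recorded C L
  busy : ∀ i b, st C i = Sum.inr b → SoundBusy C i b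
  dec : ∀ i s a, C.dec i s = some a → ∃ j, C.prop j s = some a

/-- Proposals and decisions are never revoked. -/
def Extends (C C' : (setAgreement n d mx).Config) : Prop :=
  (∀ i s a, C.prop i s = some a → C'.prop i s = some a) ∧
    ∀ i s a, C.dec i s = some a → C'.dec i s = some a

theorem extends_step {C : (setAgreement n d mx).Config} (hC : Reachable C) (e : Fin n × V) :
    Extends C (C.step e) :=
  ⟨fun _ _ _ => step_prop_of_some hC e, fun _ _ _ => step_dec_of_some hC e⟩

theorem Recorded.mono {C C' : (setAgreement n d mx).Config} (h : Extends C C') {L : List V}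
    (hL : Recorded C L) : Recorded C' L := fun j a hj => by
  obtain ⟨i, hi⟩ := hL j a hj
  exact ⟨i, h.2 _ _ _ hi⟩

theorem Sound.mono {C C' : (setAgreement n d mx).Config} (h : Extends C C') {X : Sixuplet V}
    (hX : Sound C X) : Sound C' X where
  eq_bottom := hX.eq_bottom
  valid hs := by
    obtain ⟨a, j, h1, h2⟩ := hX.valid hs
    exact ⟨a, j, h1, h.1 _ _ _ h2⟩
  length := hX.length
  recorded := hX.recorded.mono h

theorem SoundBusy.mono {C C' : (setAgreement n d mx).Config} (h : Extends C C') {i : Fin n}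
    (hs : C'.sn i = C.sn i) {b : Proposing V d} (hb : SoundBusy C i b) : SoundBusy C' i b where
  sn_eq := by rw [hs, hb.sn_eq]
  length := hb.length
  prop := h.1 _ _ _ hb.prop
  recorded := hb.recorded.mono h
  pending x X hX := ⟨(hb.pending x X hX).1.mono h, (hb.pending x X hX).2⟩

theorem Sound.entry {C : (setAgreement n d mx).Config} {i : Fin n} {b : Proposing V d}
    (hb : SoundBusy C i b) : Sound C b.entry where
  eq_bottom h := by
    have := hb.length
    have h' : b.sn = 0 := h
    omega
  valid _ := ⟨b.val, i, rfl, hb.prop⟩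
  length _ := hb.length
  recorded := hb.recorded

theorem Sound.sup {C : (setAgreement n d mx).Config} (hmx : IsMaxRule mx)
    {T : List (Sixuplet V)} (hT : T ≠ []) (h : ∀ X ∈ T, Sound C X)
    (hs : 1 ≤ (Sixuplet.sup mx T).sn) : Sound C (Sixuplet.sup mx T) := by
  obtain ⟨Z, hZ, h1, h2, h3, h4, h5⟩ := exists_eq_sup hmx hT
  have := h Z hZ
  refine ⟨fun h0 => by omega, ?_, ?_, ?_⟩
  · rw [← h1, ← h4]; exact this.valid
  · rw [← h1, ← h5]; exact this.length
  · rw [← h5]; exact this.recorded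

theorem sound_candidates {C : (setAgreement n d mx).Config} (hC : Valid C) {i : Fin n}
    {b : Proposing V d} (hb : SoundBusy C i b) : ∀ X ∈ b.candidates (reg C), Sound C X := by
  intro X hX
  rcases Proposing.mem_candidates.1 hX with ⟨x, rfl⟩ | rfl
  · exact hC.mem x
  · exact Sound.entry hb

theorem sn_le_sup (hmx : IsMaxRule mx) (b : Proposing V d) (view : Fin (d + 1) → Sixuplet V) :
    b.sn ≤ (Sixuplet.sup mx (b.candidates view)).sn := by
  have := key_le_sup hmx (Proposing.mem_candidates.2 (Or.inr rfl) : b.entry ∈ b.candidates view)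
  have h := key_le_iff.1 this
  have : b.entry.sn = b.sn := rfl
  omega

/-- The possible events. -/
inductive Event (C : (setAgreement n d mx).Config) (i : Fin n) (a : V) :
    (setAgreement n d mx).Config → Prop
  | invoke (L : List V) (h : st C i = Sum.inl L) : Event C i a (invoked C i a L)
  | decide (b : Proposing V d) (v : V) (h : st C i = Sum.inr b) (hp : b.pending = none)
      (hH : Homogeneous b.sn (reg C)) (hu : (reg C 0).up = true) (hc : (reg C 0).cfl = false)
      (hv : (reg C 0).val = v) : Event C i a (returned C i v (b.dcd ++ [v]))
  | copy (b : Proposing V d) (v : V) (x : Fin (d + 1)) (h : st C i = Sum.inr b)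
      (hp : b.pending = none) (hx : b.sn < (reg C x).sn)
      (hv : (reg C x).dcd[b.sn - 1]? = some v) : Event C i a (returned C i v (b.dcd ++ [v]))
  | raise (b : Proposing V d) (h : st C i = Sum.inr b) (hp : b.pending = none)
      (hH : Homogeneous b.sn (reg C)) (hu : (reg C 0).cfl = false → (reg C 0).up = false) :
      Event C i a (stayed C i { b with pending := some (0, b.raised (reg C 0)) })
  | adopt (b : Proposing V d) (h : st C i = Sum.inr b) (hp : b.pending = none)
      (hH : ¬ Homogeneous b.sn (reg C)) (hs : (Sixuplet.sup mx (b.candidates (reg C))).sn = b.sn) :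
      Event C i a (stayed C i { b with
        pending := some (minIndex (reg C), Sixuplet.sup mx (b.candidates (reg C))) })
  | write (b : Proposing V d) (x : Fin (d + 1)) (X : Sixuplet V) (h : st C i = Sum.inr b)
      (hp : b.pending = some (x, X)) : Event C i a (written C i b x X)

/-- The invariant rules out the default branch of `finish`: a register of a positive instance holds
a proposed value, and the list in a register of a later instance is long enough to have an entry for
the current one. -/
theorem Valid.event (hmx : IsMaxRule mx) {C : (setAgreement n d mx).Config} (hC : Valid C)
    (e : Fin n × V) : Event C e.1 e.2 (C.step e) := by
  cases hl : st C e.1 with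
  | inl L =>
    rw [step_idle hl]
    exact Event.invoke L hl
  | inr b =>
    have hb := hC.busy e.1 b hl
    cases hp : b.pending with
    | some p =>
      obtain ⟨x, X⟩ := p
      rw [step_write hl hp]
      exact Event.write b x X hl hp
    | none =>
      rw [step_snapshot hl hp]
      have hlen := hb.length
      rcases b.afterSnapshot_cases mx (reg C) with ⟨h1, h2, h3, h4⟩ | ⟨h1, h2, h3⟩ |
        ⟨h1, h2, h3⟩ | ⟨h1, h2, h3⟩
      · obtain ⟨a, j, ha, -⟩ := (hC.mem 0).valid (by rw [h1.2.1]; omega)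
        rw [h4, ha]
        exact Event.decide b a hl hp h1 h2 h3 ha
      · rw [h3]
        exact Event.raise b hl hp h1 h2
      · obtain ⟨Z, hZ, e1, e2, e3, e4, e5⟩ := exists_eq_sup hmx (b.candidates_ne_nil (reg C))
        rw [← e1] at h2
        -- The maximum belongs to a later instance, so it is not the process's own entry.
        have hZx : ∃ x, reg C x = Z := by
          rcases Proposing.mem_candidates.1 hZ with h | rfl
          · exact h
          · exact absurd h2 (lt_irrefl _)
        obtain ⟨x, rfl⟩ := hZx
        have hlt : b.sn - 1 < (reg C x).dcd.length := by
          have := (hC.mem x).length (by omega)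
          omega
        rw [h3, ← e5, List.getElem?_eq_getElem hlt]
        exact Event.copy b _ x hl hp h2 (List.getElem?_eq_getElem hlt)
      · rw [h3]
        exact Event.adopt b hl hp h1 (le_antisymm h2 (sn_le_sup hmx b _))

theorem recorded_append {C : (setAgreement n d mx).Config} {i : Fin n} {a : V} {L : List V}
    (hL : Recorded C L) (ha : C.dec i (L.length + 1) = some a) : Recorded C (L ++ [a]) := by
  intro j b hj
  rcases lt_trichotomy j L.length with h | h | h
  · rw [List.getElem?_append_left h] at hj
    exact hL j b hj
  · subst h
    simp at hj
    exact ⟨i, by rw [ha, hj]⟩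
  · rw [List.getElem?_eq_none (by simp; omega)] at hj
    cases hj

theorem Valid.step (hmx : IsMaxRule mx) {C : (setAgreement n d mx).Config} (hR : Reachable C)
    (hC : Valid C) (e : Fin n × V) : Valid (C.step e) := by
  have hE := extends_step hR e
  have hmemS : ∀ x, Sound (C.step e) (reg C x) := fun x => (hC.mem x).mono hE
  have hidle : ∀ i, i ≠ e.1 → ∀ L, st (C.step e) i = Sum.inl L →
      L.length = (C.step e).sn i ∧ Recorded (C.step e) L := by
    intro i hi L hL
    obtain ⟨h1, h2, h3, h4⟩ := sameAt_step C e hi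
    rw [h2]
    obtain ⟨h5, h6⟩ := hC.idle i L (h1.symm.trans hL)
    exact ⟨h5, h6.mono hE⟩
  have hbusy : ∀ i, i ≠ e.1 → ∀ b, st (C.step e) i = Sum.inr b → SoundBusy (C.step e) i b := by
    intro i hi b hb
    obtain ⟨h1, h2, h3, h4⟩ := sameAt_step C e hi
    exact (hC.busy i b (h1.symm.trans hb)).mono hE h2
  have hdec : ∀ i s a, C.dec i s = some a → ∃ j, (C.step e).prop j s = some a := by
    intro i s a h
    obtain ⟨j, hj⟩ := hC.dec i s a h
    exact ⟨j, hE.1 _ _ _ hj⟩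
  have hfin : ∀ b v, st C e.1 = Sum.inr b →
      C.step e = returned C e.1 v (b.dcd ++ [v]) → (∃ j, C.prop j b.sn = some v) →
      Valid (C.step e) := by
    intro b v hl hst ⟨j, hj⟩
    have hb := hC.busy e.1 b hl
    refine ⟨fun x => ?_, fun i L hL => ?_, fun i b' hb' => ?_, fun i s a' hs => ?_⟩
    · have := hmemS x
      rw [hst] at this ⊢
      exact this
    · by_cases hi : i = e.1
      · subst hi
        have hL' := hL
        rw [hst] at hL'
        simp only [st_returned, Function.update_self, Sum.inl.injEq] at hL'
        subst hL'
        constructor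
        · rw [hst, sn_returned, ← hb.sn_eq, ← hb.length]
          simp
        · refine recorded_append (i := e.1) (hb.recorded.mono hE) ?_
          rw [hst, dec_returned, hb.length, hb.sn_eq]
          simp
      · exact hidle i hi L hL
    · by_cases hi : i = e.1
      · subst hi
        rw [hst] at hb'
        simp at hb'
      · exact hbusy i hi b' hb'
    · have hs' := hs
      rw [hst, dec_returned] at hs
      by_cases hi : i = e.1
      · subst hi
        rw [Function.update_self] at hs
        by_cases hss : s = C.sn e.1
        · subst hss
          rw [Function.update_self] at hs
          cases hs
          exact ⟨j, hE.1 _ _ _ (by rw [← hb.sn_eq]; exact hj)⟩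
        · rw [Function.update_of_ne hss] at hs
          exact hdec _ _ _ hs
      · rw [Function.update_of_ne hi] at hs
        exact hdec _ _ _ hs
  have hstay : ∀ b b', st C e.1 = Sum.inr b → C.step e = stayed C e.1 b' →
      (SoundBusy C e.1 b → SoundBusy C e.1 b') → Valid (C.step e) := by
    intro b b' hl hst hb
    have hb := hb (hC.busy e.1 b hl)
    refine ⟨fun x => ?_, fun i L hL => ?_, fun i b'' hb'' => ?_, fun i s a' hs => ?_⟩
    · have := hmemS x
      rw [hst] at this ⊢
      exact this
    · by_cases hi : i = e.1
      · subst hi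
        rw [hst] at hL
        simp at hL
      · exact hidle i hi L hL
    · by_cases hi : i = e.1
      · subst hi
        have h := hb''
        rw [hst] at h
        simp only [st_stayed, Function.update_self, Sum.inr.injEq] at h
        subst h
        exact hb.mono hE (by rw [hst]; rfl)
      · exact hbusy i hi b'' hb''
    · rw [hst] at hs
      exact hdec _ _ _ hs
  have hev := hC.event hmx e
  generalize hst : C.step e = C' at hev
  rw [← hst]
  cases hev with
  | invoke L h =>
    refine ⟨fun x => ?_, fun i L hL => ?_, fun i b' hb' => ?_, fun i s a' hs => ?_⟩
    · have := hmemS x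
      rw [hst] at this ⊢
      exact this
    · by_cases hi : i = e.1
      · subst hi
        rw [hst] at hL
        simp [invoked] at hL
      · exact hidle i hi L hL
    · by_cases hi : i = e.1
      · subst hi
        obtain ⟨h1, h2⟩ := hC.idle _ _ h
        have h' := hb'
        rw [hst] at h'
        simp only [invoked, st_stayed, Function.update_self, Sum.inr.injEq] at h'
        subst h'
        refine ⟨?_, ?_, ?_, h2.mono hE, ?_⟩
        · rw [hst]; simp [invoked]
        · simp [h1]
        · rw [hst]; simp [invoked]
        · simp
      · exact hbusy i hi b' hb'
    · rw [hst] at hs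
      exact hdec _ _ _ hs
  | decide b v h hp hH hu hc hv =>
    refine hfin b v h hst ?_
    have h1 := (hC.busy _ _ h).length
    obtain ⟨a, j, h2, h3⟩ := (hC.mem 0).valid (by rw [hH.2.1]; omega)
    rw [hv, WithBot.coe_inj] at h2
    exact ⟨j, by rw [h2, ← hH.2.1, h3]⟩
  | copy b v x h hp hx hv =>
    refine hfin b v h hst ?_
    obtain ⟨i, hi⟩ := (hC.mem x).recorded _ _ hv
    rw [Nat.sub_add_cancel (by have := (hC.busy _ _ h).length; omega)] at hi
    exact hC.dec _ _ _ hi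
  | raise b h hp hH hu =>
    refine hstay b _ h hst fun hb => ⟨hb.sn_eq, hb.length, hb.prop, hb.recorded, ?_⟩
    rintro x X hX
    simp only [Option.some.injEq, Prod.mk.injEq] at hX
    obtain ⟨rfl, rfl⟩ := hX
    have hlen := hb.length
    refine ⟨⟨fun h0 => ?_, fun _ => ?_, fun _ => hb.length, hb.recorded⟩, rfl⟩
    · have : b.sn = 0 := h0
      omega
    · obtain ⟨a, j, h2, h3⟩ := (hC.mem 0).valid (by rw [hH.2.1]; omega)
      exact ⟨a, j, h2, by rw [← h3, hH.2.1]; rfl⟩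
  | adopt b h hp hH hs =>
    refine hstay b _ h hst fun hb => ⟨hb.sn_eq, hb.length, hb.prop, hb.recorded, ?_⟩
    rintro x X hX
    simp only [Option.some.injEq, Prod.mk.injEq] at hX
    obtain ⟨rfl, rfl⟩ := hX
    have hlen := hb.length
    exact ⟨Sound.sup hmx (b.candidates_ne_nil _) (sound_candidates hC hb) (by omega), hs⟩
  | write b x X h hp =>
    have hb := hC.busy _ _ h
    refine ⟨fun y => ?_, fun i L hL => ?_, fun i b' hb' => ?_, fun i s a' hs => ?_⟩
    · have : reg (C.step e) = Function.update (reg C) x X := by rw [hst]; rfl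
      rw [this]
      by_cases hyx : y = x
      · subst hyx
        rw [Function.update_self]
        exact ((hb.pending _ _ hp).1).mono hE
      · rw [Function.update_of_ne hyx]
        exact hmemS y
    · by_cases hi : i = e.1
      · subst hi
        rw [hst] at hL
        simp [written] at hL
      · exact hidle i hi L hL
    · by_cases hi : i = e.1
      · subst hi
        have h' := hb'
        rw [hst] at h'
        simp only [written, st_stayed, Function.update_self, Sum.inr.injEq] at h'
        subst h'
        exact SoundBusy.mono hE (by rw [hst]; rfl)
          ⟨hb.sn_eq, hb.length, hb.prop, hb.recorded, by simp⟩
      · exact hbusy i hi b' hb'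
    · rw [hst] at hs
      exact hdec _ _ _ hs

theorem valid_of_reachable (hmx : IsMaxRule mx) {C : (setAgreement n d mx).Config}
    (hR : Reachable C) : Valid C := by
  refine Reachable.induction (p := Valid) ?_ (fun C e hR hC => hC.step hmx hR e) hR
  refine ⟨fun x => ⟨fun _ => rfl, ?_, ?_, ?_⟩, ?_, ?_, ?_⟩
  · intro h
    exact absurd (show 1 ≤ 0 from h) (by omega)
  · intro h
    exact absurd (show 1 ≤ 0 from h) (by omega)
  · intro j a h
    have h' : ([] : List V)[j]? = some a := h
    simp at h'
  · intro i L hL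
    have : ([] : List V) = L := Sum.inl.inj hL
    subst this
    exact ⟨rfl, fun j a h => by simp at h⟩
  · intro i b hb
    cases hb
  · intro i s a h
    cases h

theorem validity (hmx : IsMaxRule mx) : (setAgreement n d mx).Validity := by
  intro σ t i s a h
  exact (valid_of_reachable hmx (reachable_run σ t)).dec i s a h

end setAgreement

/-! ### Agreement: runs as sequences of moves -/

theorem Proposing.fresh_raise {V : Type u} {d : ℕ} {b : Proposing V d} {view : Fin (d + 1) → Sixuplet V}
    (hH : Homogeneous b.sn view) (hu : (view 0).cfl = false → (view 0).up = false) (s : ℕ) :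
    Situation.Fresh s view (b.raised (view 0)) := by
  rcases lt_trichotomy b.sn s with h | h | h
  · exact .earlier h fun x => by rw [(hH.fields x).1]; exact h
  · exact .raise (view 0).rd (view 0).up (view 0).cfl (view 0).val hH.2.2
      (fun x => by rw [← h]; exact hH.fields x) hu h rfl rfl rfl rfl
  · exact .later h

namespace setAgreement

open Protocol

variable {V : Type u} [LinearOrder V] {n d : ℕ} {mx : List (Sixuplet V) → Sixuplet V}

/-- The sixuplet that a process is about to write. -/
def pendingOf (C : (setAgreement n d mx).Config) (i : Fin n) : Option (Sixuplet V) :=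
  match st C i with
  | Sum.inl _ => none
  | Sum.inr b => b.pending.map Prod.snd

theorem pendingOf_idle {C : (setAgreement n d mx).Config} {i : Fin n} {L : List V}
    (h : st C i = Sum.inl L) : pendingOf C i = none := by simp [pendingOf, h]

theorem pendingOf_busy {C : (setAgreement n d mx).Config} {i : Fin n} {b : Proposing V d}
    (h : st C i = Sum.inr b) : pendingOf C i = b.pending.map Prod.snd := by simp [pendingOf, h]

/-- A global state from the point of view of instance `s`. -/
def situation (s : ℕ) (C : (setAgreement n d mx).Config) : Situation V n d :=
  ⟨reg C, pendingOf C, fun i => C.dec i s⟩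

theorem pendingOf_stayed (C : (setAgreement n d mx).Config) (i : Fin n) (b : Proposing V d) :
    pendingOf (stayed C i b) = Function.update (pendingOf C) i (b.pending.map Prod.snd) := by
  funext j
  by_cases hj : j = i
  · subst hj
    simp [pendingOf]
  · simp [pendingOf, hj]

theorem pendingOf_returned (C : (setAgreement n d mx).Config) (i : Fin n) (a : V) (L : List V) :
    pendingOf (returned C i a L) = Function.update (pendingOf C) i none := by
  funext j
  by_cases hj : j = i
  · subst hj
    simp [pendingOf]
  · simp [pendingOf, hj]

theorem le_sup_of_reg (hmx : IsMaxRule mx) (b : Proposing V d) (view : Fin (d + 1) → Sixuplet V)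
    {S : Sixuplet V} (hS : Sixuplet.sup mx (b.candidates view) = S) (x : Fin (d + 1)) :
    (view x).sn < S.sn ∨ (view x).sn = S.sn ∧ ((view x).rd < S.rd ∨ (view x).rd = S.rd ∧
      ((view x).up = true → S.up = true) ∧ ((view x).cfl = true → S.cfl = true) ∧
      ((view x).val ≠ S.val → S.cfl = true)) := by
  have hx : view x ∈ b.candidates view := Proposing.mem_candidates.2 (Or.inl ⟨x, rfl⟩)
  have h := key_le_iff.1 (key_le_sup hmx hx)
  have hc := sup_cfl_iff hmx (b.candidates_ne_nil view)
  rw [hS] at h hc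
  rcases h with h | ⟨h1, h2 | ⟨h2, h3⟩⟩
  · exact Or.inl h
  · exact Or.inr ⟨h1, Or.inl h2⟩
  · refine Or.inr ⟨h1, Or.inr ⟨h2, fun hu => ?_, fun hcf => hc.2 ⟨_, hx, h1, h2, Or.inl hcf⟩,
      fun hv => hc.2 ⟨_, hx, h1, h2, Or.inr hv⟩⟩⟩
    rw [hu] at h3
    rcases h3 with h3 | h3
    · exact absurd h3 (by simp [Bool.lt_iff])
    · exact h3.1.symm

theorem fresh_adopt (hmx : IsMaxRule mx) {b : Proposing V d} {view : Fin (d + 1) → Sixuplet V}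
    (hs : (Sixuplet.sup mx (b.candidates view)).sn = b.sn) (s : ℕ) :
    Situation.Fresh s view (Sixuplet.sup mx (b.candidates view)) := by
  have hle := le_sup_of_reg hmx b view rfl
  rcases lt_trichotomy b.sn s with h | h | h
  · refine .earlier (by rw [hs]; exact h) fun x => ?_
    have := hle x
    omega
  · refine .adopt (by rw [hs, h]) (fun x => ?_) ?_
    · have := hle x
      rwa [hs, h] at this
    · obtain ⟨Z, hZ, e1, e2, e3, e4, e5⟩ := exists_eq_sup hmx (b.candidates_ne_nil view)
      rw [← e2, ← e3, ← e4]
      rcases Proposing.mem_candidates.1 hZ with ⟨x, rfl⟩ | rfl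
      · exact Or.inr ⟨x, by rw [e1, hs, h], rfl, rfl, rfl⟩
      · exact Or.inl ⟨rfl, rfl⟩
  · exact .later (by rw [hs]; exact h)

/-- Invocations, and returns in other instances, are invisible in instance `s`. Snapshots and writes
always count, as sixuplets of other instances occupy registers too. -/
theorem move_situation (hmx : IsMaxRule mx) {C : (setAgreement n d mx).Config} (hR : Reachable C)
    (e : Fin n × V) (s : ℕ) : Situation.Move s (situation s C) (situation s (C.step e)) := by
  have hV := valid_of_reachable hmx hR
  have hev := hV.event hmx e
  generalize hst : C.step e = C' at hev
  have hnone : ∀ b, st C e.1 = Sum.inr b → b.pending = none → pendingOf C e.1 = none :=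
    fun b h hp => by rw [pendingOf_busy h, hp]; rfl
  have hdec : ∀ b, st C e.1 = Sum.inr b → ∀ s, C.dec e.1 s ≠ none → s < b.sn := by
    intro b h s hs
    have h1 := ((hR.history e.1).dec_iff s).1 hs
    rw [show C.loc e.1 = Sum.inr b from h, ← (hV.busy _ _ h).sn_eq] at h1
    rcases h1.2 with h1 | ⟨-, h1⟩
    · exact h1
    · cases h1
  have hret : ∀ b v, st C e.1 = Sum.inr b → b.pending = none →
      situation s (returned C e.1 v (b.dcd ++ [v])) =
        if b.sn = s then { situation s C with
          dec := Function.update (situation s C).dec e.1 (some v) } else situation s C := by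
    intro b v h hp
    have hpend : pendingOf (returned C e.1 v (b.dcd ++ [v])) = pendingOf C := by
      rw [pendingOf_returned, Function.update_eq_self_iff, hnone b h hp]
    have hsn := (hV.busy _ _ h).sn_eq
    unfold situation
    rw [hpend, reg_returned]
    split_ifs with hs
    · congr 1
      funext i
      by_cases hi : i = e.1
      · subst hi
        simp [← hsn, hs]
      · simp [hi]
    · congr 1
      funext i
      by_cases hi : i = e.1
      · subst hi
        simp [← hsn, Ne.symm hs]
      · simp [hi]
  cases hev with
  | invoke L h =>
    have : situation s (invoked C e.1 e.2 L) = situation s C := by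
      unfold situation invoked
      rw [pendingOf_stayed]
      congr 1
      rw [Function.update_eq_iff]
      exact ⟨(pendingOf_idle h).symm, fun _ _ => rfl⟩
    rw [this]
    exact .idle
  | decide b v h hp hH hu hc hv =>
    rw [hret b v h hp]
    split_ifs with hs
    · subst hs
      refine .decide e.1 v (reg C 0).rd hH.2.2 (hnone b h hp) ?_ fun x => ?_
      · by_contra hne
        exact lt_irrefl _ (hdec b h _ hne)
      · have := hH.fields x
        rw [hu, hc, hv] at this
        exact this
    · exact .idle
  | copy b v x h hp hx hv =>
    rw [hret b v h hp]
    split_ifs with hs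
    · subst hs
      obtain ⟨j, hj⟩ := (hV.mem x).recorded _ _ hv
      rw [Nat.sub_add_cancel (by have := (hV.busy _ _ h).length; omega)] at hj
      exact .copy e.1 j v (hnone b h hp) hj
    · exact .idle
  | raise b h hp hH hu =>
    unfold situation
    rw [pendingOf_stayed]
    exact .snap (C := situation s C) e.1 _ (hnone b h hp) (Proposing.fresh_raise hH hu s)
      fun hne => hdec b h s hne
  | adopt b h hp hH hs =>
    unfold situation
    rw [pendingOf_stayed]
    exact .snap (C := situation s C) e.1 _ (hnone b h hp) (fresh_adopt hmx hs s)
      fun hne => by rw [hs]; exact hdec b h s hne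
  | write b x X h hp =>
    unfold situation written
    rw [pendingOf_stayed]
    exact .write (C := situation s C) e.1 x X (by
      change pendingOf C e.1 = some X
      rw [pendingOf_busy h, hp]
      rfl)

theorem safe_situation (hmx : IsMaxRule mx) {k s : ℕ} (hs : 1 ≤ s) (hk : 1 ≤ k) (hn : n ≤ k + d)
    {C : (setAgreement n d mx).Config} (hR : Reachable C) : (situation s C).Safe s k := by
  refine Reachable.induction (p := fun C => (situation s C).Safe s k) ?_
    (fun C e hR hC => (move_situation hmx hR e s).safe hn hC) hR
  exact Situation.safe_of_quiescent hs hk (fun _ => rfl) (fun _ => rfl) (fun _ => rfl)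

theorem encard_decisions_le (hmx : IsMaxRule mx) {k : ℕ} (hk : 1 ≤ k) (hn : n ≤ k + d)
    {C : (setAgreement n d mx).Config} (hR : Reachable C) (s : ℕ) :
    {a | ∃ i, C.dec i s = some a}.encard ≤ k := by
  rcases Nat.eq_zero_or_pos s with rfl | hs
  · have : {a | ∃ i, C.dec i 0 = some a} = ∅ := by
      rw [Set.eq_empty_iff_forall_notMem]
      rintro a ⟨i, hi⟩
      have := ((hR.history i).dec_iff 0).1 (by simp [hi])
      omega
    rw [this, Set.encard_empty]
    exact zero_le
  · exact (safe_situation hmx hs hk hn hR).agreement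

end setAgreement

namespace Protocol

variable {V : Type u} {n m : ℕ} {P : Protocol.{u, v, w} V n m}

/-- It suffices to bound the number of decisions in every global state. -/
theorem agreement_of_reachable {k : ℕ}
    (h : ∀ C : P.Config, Reachable C → ∀ s, {a | ∃ i, C.dec i s = some a}.encard ≤ k) :
    P.Agreement k := by
  intro σ s
  by_contra hlt
  have hlt' : ((k + 1 : ℕ) : ℕ∞) ≤ {a | ∃ t i, (P.run σ t).dec i s = some a}.encard := by
    rw [not_le] at hlt
    exact_mod_cast Order.add_one_le_of_lt hlt
  obtain ⟨T, hT, hcard⟩ := Set.exists_subset_encard_eq hlt'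
  have hfin : T.Finite := Set.finite_of_encard_eq_coe hcard
  -- Decisions are permanent, so finitely many of them coexist at a late enough time.
  have : ∃ t, ∀ a ∈ T, ∃ i, (P.run σ t).dec i s = some a := by
    clear hcard
    induction T, hfin using Set.Finite.induction_on with
    | empty => exact ⟨0, by simp⟩
    | @insert a T _ _ ih =>
      obtain ⟨t, ht⟩ := ih fun b hb => hT (Set.mem_insert_of_mem _ hb)
      obtain ⟨t', i, hi⟩ := hT (Set.mem_insert _ _)
      refine ⟨max t t', fun b hb => ?_⟩
      rcases hb with rfl | hb
      · exact ⟨i, run_dec_of_some (le_max_right _ _) hi⟩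
      · obtain ⟨j, hj⟩ := ht b hb
        exact ⟨j, run_dec_of_some (le_max_left _ _) hj⟩
  obtain ⟨t, ht⟩ := this
  have h1 := (Set.encard_le_encard (show T ⊆ {a | ∃ i, (P.run σ t).dec i s = some a} from ht)).trans
    (h _ (reachable_run σ t) s)
  rw [hcard] at h1
  have : k + 1 ≤ k := by exact_mod_cast h1
  omega

end Protocol

theorem setAgreement.agreement {V : Type u} [LinearOrder V] {n d k : ℕ}
    {mx : List (Sixuplet V) → Sixuplet V} (hmx : IsMaxRule mx) (hk : 1 ≤ k) (hn : n ≤ k + d) :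
    (setAgreement n d mx).Agreement k :=
  Protocol.agreement_of_reachable fun _ hR s => encard_decisions_le hmx hk hn hR s

/-! ### Obstruction-free termination on the snapshot object -/

namespace Sixuplet

variable {V : Type u} [LinearOrder V]

theorem exists_max_eq_sup {mx : List (Sixuplet V) → Sixuplet V} (hmx : IsMaxRule mx)
    {T : List (Sixuplet V)} (hT : T ≠ []) : ∃ Z ∈ T, (∀ X ∈ T, X.key ≤ Z.key) ∧
      Z.sn = (sup mx T).sn ∧ Z.rd = (sup mx T).rd ∧ Z.up = (sup mx T).up ∧
      Z.val = (sup mx T).val :=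
  ⟨mx T, (hmx T hT).1, (hmx T hT).2, rfl, rfl, rfl, rfl⟩

/-- Adding the result of `sup` to its arguments, or removing others, does not change the result. -/
theorem key_sup_of_mem {mx : List (Sixuplet V) → Sixuplet V} (hmx : IsMaxRule mx)
    {T T' : List (Sixuplet V)} (hS : sup mx T ∈ T') (hT' : ∀ X ∈ T', X = sup mx T ∨ X ∈ T) :
    (sup mx T').key = (sup mx T).key := by
  have hne : T' ≠ [] := List.ne_nil_of_mem hS
  obtain ⟨Z, hZ, hmax, e1, e2, e3, e4⟩ := exists_max_eq_sup hmx hne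
  have hle : ∀ X ∈ T', X.key ≤ (sup mx T).key := fun X hX => by
    rcases hT' X hX with rfl | h
    · exact le_rfl
    · exact key_le_sup hmx h
  obtain ⟨f1, f2, f3, f4, f5⟩ := key_eq_iff.1 (le_antisymm (hle Z hZ) (hmax _ hS))
  have hc : (sup mx T').cfl = true ↔ (sup mx T).cfl = true := by
    rw [sup_cfl_iff hmx hne, ← e1, ← e2, ← e4]
    constructor
    · rintro ⟨X, hX, h1, h2, h3⟩
      rcases hT' X hX with rfl | h
      · exact h3.resolve_right fun h => h f5.symm
      · rw [sup_cfl_iff hmx (List.ne_nil_of_mem h)]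
        exact ⟨X, h, h1.trans f1, h2.trans f2, by rwa [f5] at h3⟩
    · intro h
      exact ⟨_, hS, f1.symm, f2.symm, Or.inl h⟩
  refine key_eq_iff.2 ⟨e1.symm.trans f1, e2.symm.trans f2, e3.symm.trans f3, ?_, e4.symm.trans f5⟩
  rw [Bool.eq_iff_iff]
  exact hc

/-- A sixuplet without conflict in a round which no other argument has reached. -/
theorem key_sup_of_lt {mx : List (Sixuplet V) → Sixuplet V} (hmx : IsMaxRule mx)
    {T : List (Sixuplet V)} {R : Sixuplet V} (hR : R ∈ T) (hc : R.cfl = false)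
    (h : ∀ X ∈ T, X = R ∨ X.sn = R.sn ∧ X.rd < R.rd) : (sup mx T).key = R.key := by
  have hne : T ≠ [] := List.ne_nil_of_mem hR
  obtain ⟨Z, hZ, hmax, e1, e2, e3, e4⟩ := exists_max_eq_sup hmx hne
  obtain rfl : Z = R := by
    rcases h Z hZ with h | h
    · exact h
    · have := key_le_iff.1 (hmax R hR)
      omega
  refine key_eq_iff.2 ⟨e1.symm, e2.symm, e3.symm, ?_, e4.symm⟩
  rw [hc, ← Bool.not_eq_true, sup_cfl_iff hmx hne, ← e1, ← e2, ← e4]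
  rintro ⟨X, hX, h1, h2, h3⟩
  rcases h X hX with rfl | h
  · simp [hc] at h3
  · omega

end Sixuplet

namespace Proposing

/-- The number of rounds that a process running solo still needs. -/
def rounds {V : Type u} (X : Sixuplet V) : ℕ := if X.cfl then 2 else if X.up then 0 else 1

theorem rounds_congr {V : Type u} {X Y : Sixuplet V} (h : X.key = Y.key) : rounds X = rounds Y := by
  obtain ⟨-, -, h1, h2, -⟩ := key_eq_iff.1 h
  rw [rounds, rounds, h1, h2]

variable {V : Type u} [LinearOrder V] {d : ℕ}

open Classical in
/-- The sixuplet that a process running solo is going to write into all the registers. -/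
noncomputable def target (mx : List (Sixuplet V) → Sixuplet V) (b : Proposing V d)
    (view : Fin (d + 1) → Sixuplet V) : Sixuplet V :=
  if Homogeneous b.sn view then view 0 else sup mx (b.candidates view)

open Classical in
/-- The number of registers which a process running solo still has to write. -/
noncomputable def distance (X : Sixuplet V) (view : Fin (d + 1) → Sixuplet V) : ℕ :=
  (Finset.univ.filter fun x => (view x).key ≠ X.key).card

/-- Bounds the number of writes of a process running solo until it decides. -/
noncomputable def measure (mx : List (Sixuplet V) → Sixuplet V) (b : Proposing V d)
    (view : Fin (d + 1) → Sixuplet V) : ℕ :=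
  rounds (b.target mx view) * (d + 2) + distance (b.target mx view) view

theorem distance_le (X : Sixuplet V) (view : Fin (d + 1) → Sixuplet V) :
    distance X view ≤ d + 1 :=
  (Finset.card_filter_le _ _).trans (by simp)

theorem distance_update_lt {X : Sixuplet V} {view : Fin (d + 1) → Sixuplet V} {x : Fin (d + 1)}
    {Y : Sixuplet V} (hx : (view x).key ≠ X.key) (hY : Y.key = X.key) :
    distance Y (Function.update view x X) < distance X view := by
  refine Finset.card_lt_card ⟨fun y hy => ?_, fun hsub => ?_⟩
  · simp only [Finset.mem_filter, Finset.mem_univ, true_and] at hy ⊢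
    by_cases hyx : y = x
    · subst hyx
      exact hx
    · rwa [Function.update_of_ne hyx, hY] at hy
  · have := hsub (show x ∈ _ by simpa using hx)
    simp [hY] at this

/-- The raised sixuplet is alone in its round and becomes the new target. One round fewer is worth d
+ 2, more than any distance, which is at most d + 1. -/
theorem measure_raise_lt {mx : List (Sixuplet V) → Sixuplet V} (hmx : IsMaxRule mx)
    {b : Proposing V d} {view : Fin (d + 1) → Sixuplet V} (hH : Homogeneous b.sn view)
    (hu : (view 0).cfl = false → (view 0).up = false) :
    b.measure mx (Function.update view 0 (b.raised (view 0))) < b.measure mx view := by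
  have ht : b.target mx view = view 0 := by simp [target, hH]
  have hr := hH.2.2
  have ht' : (b.target mx (Function.update view 0 (b.raised (view 0)))).key =
      (b.raised (view 0)).key := by
    unfold target
    split_ifs with h
    · simp
    · refine key_sup_of_lt hmx (mem_candidates.2 (Or.inl ⟨0, by simp⟩)) rfl fun X hX => ?_
      rcases mem_candidates.1 hX with ⟨x, rfl⟩ | rfl
      · by_cases hx : x = 0
        · subst hx
          simp
        · rw [Function.update_of_ne hx]
          obtain ⟨h1, h2, -⟩ := hH.fields x
          exact Or.inr ⟨h1, by rw [h2]; exact Nat.lt_succ_self _⟩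
      · exact Or.inr ⟨rfl, Nat.succ_lt_succ hr⟩
  have hround : rounds (b.raised (view 0)) + 1 = rounds (view 0) := by
    unfold rounds raised
    cases hc : (view 0).cfl
    · simp [hu hc]
    · simp
  have := distance_le (b.target mx (Function.update view 0 (b.raised (view 0))))
    (Function.update view 0 (b.raised (view 0)))
  unfold measure
  rw [rounds_congr ht', ht, ← hround, Nat.add_mul]
  omega

/-- If a minimal entry had the key of `sup`, all entries would. Its round is positive, because the
process's own entry, of round 1, is an argument of `sup`; so the view would be homogeneous. -/
theorem key_minIndex_ne {mx : List (Sixuplet V) → Sixuplet V} (hmx : IsMaxRule mx)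
    {b : Proposing V d} {view : Fin (d + 1) → Sixuplet V} (hH : ¬ Homogeneous b.sn view)
    (hs : (sup mx (b.candidates view)).sn = b.sn) :
    (view (minIndex view)).key ≠ (sup mx (b.candidates view)).key := by
  intro heq
  have hall : ∀ x, (view x).key = (sup mx (b.candidates view)).key := fun x =>
    le_antisymm (key_le_sup hmx (mem_candidates.2 (Or.inl ⟨x, rfl⟩)))
      (heq ▸ key_minIndex_le view x)
  have hentry := key_le_iff.1 (key_le_sup hmx
    (mem_candidates.2 (Or.inr rfl) : b.entry ∈ b.candidates view))
  obtain ⟨h1, h2, -⟩ := key_eq_iff.1 (hall 0)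
  refine hH ⟨fun x => (hall x).trans (hall 0).symm, h1.trans hs, ?_⟩
  have h3 : b.entry.sn = b.sn := rfl
  have h4 : b.entry.rd = 1 := rfl
  omega

/-- Writing the target into a register does not change the key of the target, and one more register
agrees with it. -/
theorem measure_adopt_lt {mx : List (Sixuplet V) → Sixuplet V} (hmx : IsMaxRule mx)
    {b : Proposing V d} {view : Fin (d + 1) → Sixuplet V} (hH : ¬ Homogeneous b.sn view)
    (hs : (sup mx (b.candidates view)).sn = b.sn) :
    b.measure mx (Function.update view (minIndex view) (sup mx (b.candidates view))) <
      b.measure mx view := by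
  have ht : b.target mx view = sup mx (b.candidates view) := by simp [target, hH]
  have ht' : (b.target mx (Function.update view (minIndex view)
      (sup mx (b.candidates view)))).key = (sup mx (b.candidates view)).key := by
    unfold target
    split_ifs with h
    · rw [← h.1 (minIndex view), Function.update_self]
    · refine key_sup_of_mem hmx (mem_candidates.2 (Or.inl ⟨minIndex view, by simp⟩)) fun X hX => ?_
      rcases mem_candidates.1 hX with ⟨x, rfl⟩ | rfl
      · by_cases hx : x = minIndex view
        · subst hx
          simp
        · rw [Function.update_of_ne hx]
          exact Or.inr (mem_candidates.2 (Or.inl ⟨x, rfl⟩))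
      · exact Or.inr (mem_candidates.2 (Or.inr rfl))
  have := distance_update_lt (key_minIndex_ne hmx hH hs) ht'
  unfold measure
  rw [rounds_congr ht', ht]
  omega

end Proposing

namespace setAgreement

open Protocol

variable {V : Type u} [LinearOrder V] {n d : ℕ} {mx : List (Sixuplet V) → Sixuplet V}

theorem solo_decides_of_measure (hmx : IsMaxRule mx) (i : Fin n) (a : V) (N : ℕ)
    {C : (setAgreement n d mx).Config} (hR : Reachable C) {b : Proposing V d}
    (hb : st C i = Sum.inr b) (hp : b.pending = none) (hN : b.measure mx (reg C) ≤ N) :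
    ∃ t, (C.exec (solo i a t)).dec i (C.sn i) ≠ none := by
  induction N using Nat.strong_induction_on generalizing C b with
  | _ N ih =>
    have hV := valid_of_reachable hmx hR
    have hev := hV.event hmx (i, a)
    have hR' := hR.step (i, a)
    have hV' := valid_of_reachable hmx hR'
    have hfin : ∀ v L, C.step (i, a) = returned C i v L →
        ∃ t, (C.exec (solo i a t)).dec i (C.sn i) ≠ none := fun v L h => by
      refine ⟨1, ?_⟩
      change (C.step (i, a)).dec i (C.sn i) ≠ none
      rw [h]
      simp
    -- A snapshot and the write that follows it form one round trip, which lowers the measure.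
    have hgo : ∀ x X, C.step (i, a) = stayed C i { b with pending := some (x, X) } →
        b.measure mx (Function.update (reg C) x X) < b.measure mx (reg C) →
        ∃ t, (C.exec (solo i a t)).dec i (C.sn i) ≠ none := by
      intro x X hst hlt
      have h1 : st (C.step (i, a)) i = Sum.inr { b with pending := some (x, X) } := by
        rw [hst]; simp
      have h2 := step_write (e := (i, a)) h1 rfl
      have h3 : st ((C.step (i, a)).step (i, a)) i = Sum.inr b := by
        rw [h2]
        simp [written, ← hp]
      have h4 : reg ((C.step (i, a)).step (i, a)) = Function.update (reg C) x X := by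
        rw [h2, hst]
        rfl
      have h5 : ((C.step (i, a)).step (i, a)).sn i = C.sn i := by
        rw [h2, hst]
        rfl
      obtain ⟨t, ht⟩ := ih _ (lt_of_lt_of_le hlt hN) (hR'.step (i, a)) h3 hp (by rw [h4])
      rw [h5] at ht
      refine ⟨2 + t, ?_⟩
      rw [exec_solo_add]
      exact ht
    generalize hst : C.step (i, a) = C' at hev
    cases hev with
    | invoke L h => rw [hb] at h; cases h
    | decide b' v h => exact hfin _ _ hst
    | copy b' v x h => exact hfin _ _ hst
    | raise b' h hp' hH hu =>
      rw [hb] at h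
      cases h
      exact hgo _ _ hst (Proposing.measure_raise_lt hmx hH hu)
    | adopt b' h hp' hH hs =>
      rw [hb] at h
      cases h
      exact hgo _ _ hst (Proposing.measure_adopt_lt hmx hH hs)
    | write b' x X h hp' =>
      rw [hb] at h
      cases h
      rw [hp] at hp'
      cases hp'

theorem solo_decides (hmx : IsMaxRule mx) {C : (setAgreement n d mx).Config} (hR : Reachable C)
    (i : Fin n) (a : V) (hb : (C.loc i).isRight = true) :
    ∃ t, (C.exec (solo i a t)).dec i (C.sn i) ≠ none := by
  obtain ⟨b, hb⟩ := Sum.isRight_iff.1 hb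
  have hb' : st C i = Sum.inr b := hb
  rcases hp : b.pending with _ | ⟨x, X⟩
  · exact solo_decides_of_measure hmx i a _ hR hb' hp le_rfl
  · have h2 := step_write (e := (i, a)) hb' hp
    have h3 : st (C.step (i, a)) i = Sum.inr { b with pending := none } := by
      rw [h2]
      simp [written]
    obtain ⟨t, ht⟩ := solo_decides_of_measure hmx i a _ (hR.step (i, a)) h3 rfl le_rfl
    refine ⟨1 + t, ?_⟩
    rw [exec_solo_add]
    have h5 : (C.step (i, a)).sn i = C.sn i := by
      rw [h2]
      rfl
    rw [h5] at ht
    exact ht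

end setAgreement

namespace Protocol

variable {V : Type u} {n m : ℕ} {P : Protocol.{u, v, w} V n m}

theorem step_congr_of_busy {C : P.Config} {i : Fin n} (h : (C.loc i).isRight = true) (a b : V) :
    C.step (i, a) = C.step (i, b) := by
  obtain ⟨s, hs⟩ := Sum.isRight_iff.1 h
  unfold Config.step
  dsimp only
  rw [hs]
  dsimp only
  cases (P.code i).access s <;> rfl

/-- A process that never decides in an instance that it has started is stuck in it. -/
theorem stuck_of_never_decides {σ : ℕ → Fin n × V} {i : Fin n} {s t : ℕ}
    (hs : (P.run σ t).prop i s ≠ none) (hd : ∀ t, (P.run σ t).dec i s = none) {t' : ℕ}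
    (ht : t ≤ t') : (P.run σ t').sn i = s ∧ ((P.run σ t').loc i).isRight = true := by
  have hR := reachable_run (P := P) σ t'
  have hs' : (P.run σ t').prop i s ≠ none := by
    obtain ⟨a, ha⟩ := Option.ne_none_iff_exists'.1 hs
    induction t', ht using Nat.le_induction with
    | base => exact hs
    | succ k hk ih =>
      obtain ⟨b, hb⟩ := Option.ne_none_iff_exists'.1 (ih (reachable_run σ _))
      rw [show (P.run σ (k + 1)).prop i s = _ from step_prop_of_some (reachable_run σ k) _ hb]
      simp
  have hh := hR.history i
  have h1 := (hh.prop_iff s).1 hs'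
  have h2 := mt (hh.dec_iff s).2 (not_not.2 (hd t'))
  have hs1 : (P.run σ t').sn i = s := by
    by_contra hne
    exact h2 ⟨h1.1, Or.inl (by omega)⟩
  refine ⟨hs1, ?_⟩
  rw [← Sum.not_isLeft]
  exact fun hl => h2 ⟨h1.1, Or.inr ⟨hs1.symm, hl⟩⟩

/-- Obstruction-free termination in terms of global states. The proposed values do not matter
because the process is executing an operation. -/
theorem obTermination_of_solo
    (h : ∀ (C : P.Config), Reachable C → ∀ i (a : V), (C.loc i).isRight = true →
      ∃ t, (C.exec (solo i a t)).dec i (C.sn i) ≠ none) : P.OBTermination := by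
  intro σ i T hσ t s hs
  by_contra! hnone
  have hstuck : ∀ d, _ := fun d => stuck_of_never_decides hs hnone
    (show t ≤ max T t + d from (le_max_right _ _).trans (Nat.le_add_right _ _))
  obtain ⟨a⟩ : Nonempty V := ⟨(σ 0).2⟩
  obtain ⟨d, hd⟩ := h _ (reachable_run σ (max T t)) i a (hstuck 0).2
  rw [show (P.run σ (max T t)).sn i = s from (hstuck 0).1] at hd
  -- The schedule may carry arbitrary values, but a process that never decides stays busy and does
  -- not use them.
  have key : ∀ d, P.run σ (max T t + d) = (P.run σ (max T t)).exec (solo i a d) := by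
    intro d
    induction d with
    | zero => rfl
    | succ d ih =>
      have e5 : σ (max T t + d) = (i, (σ (max T t + d)).2) := by
        rw [← hσ (max T t + d) (le_trans (le_max_left _ _) (Nat.le_add_right _ _))]
      change (P.run σ (max T t + d)).step (σ (max T t + d)) = _
      rw [exec_solo_succ, ← ih, e5]
      exact step_congr_of_busy (hstuck d).2 _ _
  rw [← key d] at hd
  exact hd (hnone _)

end Protocol

theorem setAgreement.obTermination {V : Type u} [LinearOrder V] {n d : ℕ}
    {mx : List (Sixuplet V) → Sixuplet V} (hmx : IsMaxRule mx) :
    (setAgreement n d mx).OBTermination :=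
  Protocol.obTermination_of_solo fun _ hR i a hb => setAgreement.solo_decides hmx hR i a hb

/-! ### SV-termination -/

namespace Sixuplet

variable {V : Type u}

/-- The form of the sixuplets of the instances up to `s` when a single value is proposed to each
of these instances. -/
def Tame (s : ℕ) (X : Sixuplet V) : Prop :=
  X.sn ≤ s → X.cfl = false ∧
    (X = bottom ∨ 1 ≤ X.sn ∧ (X.rd = 1 ∧ X.up = false ∨ X.rd = 2 ∧ X.up = true))

/-- The progress of an execution in which a single value is proposed to the instances up to `s`. -/
def rank (s : ℕ) (X : Sixuplet V) : ℕ :=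
  if s < X.sn then 2 * s + 2 else 2 * X.sn + (if X.up then 1 else 0)

theorem rank_of_lt {s : ℕ} {X : Sixuplet V} (h : s < X.sn) : X.rank s = 2 * s + 2 := if_pos h

theorem rank_of_le {s : ℕ} {X : Sixuplet V} (h : X.sn ≤ s) :
    X.rank s = 2 * X.sn + (if X.up then 1 else 0) := if_neg (not_lt.2 h)

theorem rank_le (s : ℕ) (X : Sixuplet V) : X.rank s ≤ 2 * s + 2 := by
  unfold rank
  split_ifs <;> omega

/-- Within one positive instance up to `s`, tame sixuplets are in round 1 at level "down" or in
round 2 at level "up", so the level cannot drop when the key grows. -/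
theorem rank_mono [LinearOrder V] {s : ℕ} {X Y : Sixuplet V} (hX : Tame s X) (hY : Tame s Y)
    (h : X.key ≤ Y.key) : X.rank s ≤ Y.rank s := by
  by_cases hs : s < Y.sn
  · rw [rank_of_lt hs]
    exact rank_le s X
  · have h := key_le_iff.1 h
    have hYs : Y.sn ≤ s := not_lt.1 hs
    have hXs : X.sn ≤ s := by omega
    rw [rank_of_le hYs, rank_of_le hXs]
    rcases h with h | ⟨h1, h⟩
    · split_ifs <;> omega
    · rw [h1]
      gcongr
      rcases (hX hXs).2 with rfl | ⟨a, hX'⟩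
      · exact Nat.zero_le _
      · rcases (hY hYs).2 with rfl | ⟨b, hY'⟩
        · have : (bottom : Sixuplet V).sn = 0 := rfl
          omega
        · rcases hX' with ⟨a1, a2⟩ | ⟨a1, a2⟩
          · simp [a2]
          · rcases hY' with ⟨b1, b2⟩ | ⟨b1, b2⟩
            · omega
            · simp [a2, b2]

end Sixuplet

namespace setAgreement

open Protocol

variable {V : Type u} [LinearOrder V] {n d : ℕ} {mx : List (Sixuplet V) → Sixuplet V}

/-- At most one value has been proposed to each instance up to `s`. -/
def Unanimous (s : ℕ) (C : (setAgreement n d mx).Config) : Prop :=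
  ∀ r, r ≤ s → ∀ i j a b, C.prop i r = some a → C.prop j r = some b → a = b

/-- All sixuplets in play are tame. -/
def AllTame (s : ℕ) (C : (setAgreement n d mx).Config) : Prop :=
  (∀ x, Tame s (reg C x)) ∧ ∀ i X, pendingOf C i = some X → Tame s X

theorem Unanimous.val_eq {s : ℕ} {C : (setAgreement n d mx).Config} (hC : Unanimous s C)
    {X Y : Sixuplet V} (hX : Sound C X) (hY : Sound C Y) (h : X.sn = Y.sn) (h1 : 1 ≤ X.sn)
    (hs : X.sn ≤ s) : X.val = Y.val := by
  obtain ⟨a, i, ha, hi⟩ := hX.valid h1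
  obtain ⟨b, j, hb, hj⟩ := hY.valid (by omega)
  rw [ha, hb, hC _ hs i j a b hi (by rw [h]; exact hj)]

/-- What a process is about to write after a snapshot. -/
theorem pendingOf_step (hmx : IsMaxRule mx) {C : (setAgreement n d mx).Config} (hR : Reachable C)
    (e : Fin n × V) {X : Sixuplet V} (h : pendingOf (C.step e) e.1 = some X) :
    ∃ b, st C e.1 = Sum.inr b ∧ b.pending = none ∧
      ((Homogeneous b.sn (reg C) ∧ ((reg C 0).cfl = false → (reg C 0).up = false) ∧
        X = b.raised (reg C 0)) ∨
      (¬ Homogeneous b.sn (reg C) ∧ (sup mx (b.candidates (reg C))).sn = b.sn ∧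
        X = sup mx (b.candidates (reg C)))) := by
  have hev := (valid_of_reachable hmx hR).event hmx e
  generalize C.step e = C' at hev h
  cases hev with
  | invoke L hl => simp [invoked, pendingOf_stayed] at h
  | decide b v hl hp hH hu hc hv => simp [pendingOf_returned] at h
  | copy b v x hl hp hx hv => simp [pendingOf_returned] at h
  | raise b hl hp hH hu =>
    simp only [pendingOf_stayed, Function.update_self, Option.map_some, Option.some.injEq] at h
    exact ⟨b, hl, hp, Or.inl ⟨hH, hu, h.symm⟩⟩
  | adopt b hl hp hH hs =>
    simp only [pendingOf_stayed, Function.update_self, Option.map_some, Option.some.injEq] at h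
    exact ⟨b, hl, hp, Or.inr ⟨hH, hs, h.symm⟩⟩
  | write b x X hl hp => simp [written, pendingOf_stayed] at h

theorem pendingOf_step_of_ne (C : (setAgreement n d mx).Config) (e : Fin n × V) {i : Fin n}
    (h : i ≠ e.1) : pendingOf (C.step e) i = pendingOf C i := by
  unfold pendingOf
  rw [show st (C.step e) i = st C i from (sameAt_step C e h).1]

theorem reg_step (hmx : IsMaxRule mx) {C : (setAgreement n d mx).Config} (hR : Reachable C)
    (e : Fin n × V) : reg (C.step e) = reg C ∨ ∃ b x X, st C e.1 = Sum.inr b ∧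
      b.pending = some (x, X) ∧ pendingOf C e.1 = some X ∧
      reg (C.step e) = Function.update (reg C) x X := by
  have hev := (valid_of_reachable hmx hR).event hmx e
  generalize C.step e = C' at hev
  cases hev with
  | write b x X hl hp => exact Or.inr ⟨b, x, X, hl, hp, by rw [pendingOf_busy hl, hp]; rfl, rfl⟩
  | _ => exact Or.inl rfl

theorem tame_entry (s : ℕ) {C : (setAgreement n d mx).Config} {i : Fin n} {b : Proposing V d}
    (hb : SoundBusy C i b) : Tame s b.entry := fun _ =>
  ⟨rfl, Or.inr ⟨by have := hb.length; change 1 ≤ b.sn; omega, Or.inl ⟨rfl, rfl⟩⟩⟩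

theorem AllTame.candidates {s : ℕ} {C : (setAgreement n d mx).Config} (hC : AllTame s C)
    {i : Fin n} {b : Proposing V d} (hb : SoundBusy C i b) :
    ∀ X ∈ b.candidates (reg C), Tame s X := by
  intro X hX
  rcases Proposing.mem_candidates.1 hX with ⟨x, rfl⟩ | rfl
  · exact hC.1 x
  · exact tame_entry s hb

/-- No flag is set among the candidates of the instance, and unanimity gives them all the same
value, so no conflict is discovered. -/
theorem AllTame.sup (hmx : IsMaxRule mx) {s : ℕ} {C : (setAgreement n d mx).Config}
    (hV : Valid C) (hU : Unanimous s C) (hC : AllTame s C) {i : Fin n} {b : Proposing V d}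
    (hb : SoundBusy C i b) (hs : (sup mx (b.candidates (reg C))).sn = b.sn) :
    Tame s (sup mx (b.candidates (reg C))) := by
  intro hle
  have hlen := hb.length
  have hne := b.candidates_ne_nil (reg C)
  obtain ⟨Z, hZ, e1, e2, e3, e4, e5⟩ := exists_eq_sup hmx hne
  have hT := hC.candidates hb
  constructor
  · rw [← Bool.not_eq_true, sup_cfl_iff hmx hne]
    rintro ⟨X, hX, h1, h2, h3⟩
    rcases h3 with h3 | h3
    · rw [(hT X hX (by omega)).1] at h3
      cases h3
    · exact h3 (e4 ▸ hU.val_eq (sound_candidates hV hb X hX) (sound_candidates hV hb Z hZ)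
        (h1.trans e1.symm) (by omega) (by omega))
  · right
    rw [← e1, ← e2, ← e3]
    rcases (hT Z hZ (by omega)).2 with rfl | h
    · have : (bottom : Sixuplet V).sn = 0 := rfl
      omega
    · exact h

theorem AllTame.step (hmx : IsMaxRule mx) {s : ℕ} {C : (setAgreement n d mx).Config}
    (hR : Reachable C) (hU : Unanimous s C) (hC : AllTame s C) (e : Fin n × V) :
    AllTame s (C.step e) := by
  have hV := valid_of_reachable hmx hR
  constructor
  · intro x
    rcases reg_step hmx hR e with h | ⟨b, y, X, -, -, hX, h⟩
    · rw [h]; exact hC.1 x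
    · rw [h]
      by_cases hxy : x = y
      · subst hxy
        rw [Function.update_self]
        exact hC.2 _ _ hX
      · rw [Function.update_of_ne hxy]
        exact hC.1 x
  · intro i X hX
    by_cases hi : i = e.1
    · subst hi
      obtain ⟨b, hl, hp, ⟨hH, hu, rfl⟩ | ⟨hH, hs, rfl⟩⟩ := pendingOf_step hmx hR e hX
      · intro hle
        have hlen := (hV.busy _ _ hl).length
        have hb : b.sn ≤ s := hle
        obtain ⟨h1, h2⟩ := hC.1 0 (by rw [hH.2.1]; exact hb)
        refine ⟨rfl, Or.inr ⟨by change 1 ≤ b.sn; omega, Or.inr ?_⟩⟩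
        rcases h2 with h2 | ⟨-, h2 | h2⟩
        · have := hH.2.2
          rw [h2] at this
          exact absurd this (lt_irrefl 0)
        · simp [Proposing.raised, h1, h2.1]
        · simp [hu h1] at h2
      · exact hC.sup hmx hV hU (hV.busy _ _ hl) hs
    · rw [pendingOf_step_of_ne C e hi] at hX
      exact hC.2 i X hX

theorem allTame_of_reachable (hmx : IsMaxRule mx) {s : ℕ} {σ : ℕ → Fin n × V}
    (hU : ∀ t, Unanimous s ((setAgreement n d mx).run σ t)) (t : ℕ) :
    AllTame s ((setAgreement n d mx).run σ t) := by
  induction t with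
  | zero =>
    refine ⟨fun x _ => ⟨rfl, Or.inl rfl⟩, fun i X hX => ?_⟩
    have h : (none : Option (Sixuplet V)) = some X := hX
    cases h
  | succ t ih => exact ih.step hmx (reachable_run σ t) (hU t) (σ t)

/-- Whatever is written after a snapshot has a higher rank than the lowest register. -/
theorem lt_rank_of_step (hmx : IsMaxRule mx) {s l : ℕ} {C : (setAgreement n d mx).Config}
    (hR : Reachable C) (hU : Unanimous s C) (hC : AllTame s C) (hl : l < 2 * s + 2)
    (hreg : ∀ x, l ≤ (reg C x).rank s) (e : Fin n × V) {X : Sixuplet V}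
    (h : pendingOf (C.step e) e.1 = some X) : l < X.rank s := by
  have hV := valid_of_reachable hmx hR
  obtain ⟨b, hbl, hp, ⟨hH, hu, rfl⟩ | ⟨hH, hs, rfl⟩⟩ := pendingOf_step hmx hR e h
  -- There is no conflict, so a raise in an instance up to `s` leads from level "down" to level
  -- "up", one rank higher.
  · by_cases hle : b.sn ≤ s
    · have hr := hreg 0
      have h0 : (reg C 0).sn = b.sn := hH.2.1
      obtain ⟨h1, -⟩ := hC.1 0 (by rw [h0]; exact hle)
      have e1 : (b.raised (reg C 0)).rank s = 2 * b.sn + 1 := by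
        rw [rank_of_le (by exact hle)]
        simp [Proposing.raised, h1]
      rw [rank_of_le (by omega), hu h1, h0] at hr
      simp at hr
      omega
    · rw [rank_of_lt (by exact not_le.1 hle)]
      exact hl
  · have hb := hV.busy _ _ hbl
    have hlen := hb.length
    have htame := hC.sup hmx hV hU hb hs
    by_cases hle : b.sn ≤ s
    swap
    · rw [rank_of_lt (by omega)]
      exact hl
    have hsound := Sound.sup hmx (b.candidates_ne_nil _) (sound_candidates hV hb) (by omega)
    have hmin := Proposing.key_minIndex_ne hmx hH hs
    have hkey := key_le_sup hmx
      (Proposing.mem_candidates.2 (Or.inl ⟨minIndex (reg C), rfl⟩) :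
        reg C (minIndex (reg C)) ∈ b.candidates (reg C))
    generalize sup mx (b.candidates (reg C)) = S at *
    generalize minIndex (reg C) = x at *
    have hrk := rank_mono (hC.1 x) htame hkey
    -- With equal ranks, tameness and unanimity would make the keys of the minimal entry and of
    -- `sup` equal.
    refine lt_of_le_of_ne ((hreg x).trans hrk) fun heq => hmin ?_
    have hx : (reg C x).rank s = S.rank s := le_antisymm hrk (heq ▸ hreg x)
    have hSs : S.sn ≤ s := by omega
    have hxs : (reg C x).sn ≤ s := by
      by_contra hcon
      rw [rank_of_lt (not_le.1 hcon)] at hx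
      omega
    rw [rank_of_le hSs, rank_of_le hxs] at hx
    obtain ⟨c1, c2⟩ := hC.1 x hxs
    obtain ⟨c3, c4⟩ := htame hSs
    have hsn : (reg C x).sn = S.sn := by split_ifs at hx <;> omega
    have hup : (reg C x).up = S.up := by
      cases h1 : (reg C x).up <;> cases h2 : S.up <;> simp [h1, h2, hsn] at hx ⊢
    have hval := hU.val_eq (hV.mem x) hsound hsn (by omega) hxs
    have hrd : (reg C x).rd = S.rd := by
      rcases c2 with c2 | ⟨-, c2⟩
      · rw [c2] at hsn
        have : (bottom : Sixuplet V).sn = 0 := rfl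
        omega
      · rcases c4 with c4 | ⟨-, c4⟩
        · rw [c4] at hs
          have : (bottom : Sixuplet V).sn = 0 := rfl
          omega
        · grind
    exact key_eq_iff.2 ⟨hsn, hrd, hup, c1.trans c3.symm, hval⟩

end setAgreement

/-- A process that is activated infinitely often has a next activation. -/
theorem exists_next_activation {n : ℕ} {V : Type u} {σ : ℕ → Fin n × V} {i : Fin n}
    (h : ∀ T, ∃ t, T ≤ t ∧ (σ t).1 = i) (T : ℕ) :
    ∃ t, T ≤ t ∧ (σ t).1 = i ∧ ∀ u, T ≤ u → u < t → (σ u).1 ≠ i := by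
  classical
  have hex := h T
  obtain ⟨h1, h2⟩ := Nat.find_spec hex
  exact ⟨_, h1, h2, fun u hu hlt hi => Nat.find_min hex hlt ⟨hu, hi⟩⟩

namespace Protocol

variable {V : Type u} {n m : ℕ} {P : Protocol.{u, v, w} V n m}

theorem sameAt_run {σ : ℕ → Fin n × V} {i : Fin n} {T t : ℕ} (hT : T ≤ t)
    (h : ∀ u, T ≤ u → u < t → (σ u).1 ≠ i) : SameAt i (P.run σ t) (P.run σ T) := by
  induction t, hT using Nat.le_induction with
  | base => exact ⟨rfl, rfl, rfl, rfl⟩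
  | succ t ht ih =>
    exact (sameAt_step _ _ (h t ht (Nat.lt_succ_self t)).symm).trans
      (ih fun u hu hlt => h u hu (hlt.trans (Nat.lt_succ_self t)))

end Protocol

namespace setAgreement

open Protocol

variable {V : Type u} [LinearOrder V] {n d : ℕ} {mx : List (Sixuplet V) → Sixuplet V}

/-- A process that is stuck in its operation takes a snapshot again and again. -/
theorem exists_snapshot {σ : ℕ → Fin n × V} {i : Fin n}
    (hi : ∀ T, ∃ t, T ≤ t ∧ (σ t).1 = i) {T : ℕ}
    (hbusy : ∀ t, T ≤ t → (((setAgreement n d mx).run σ t).loc i).isRight = true) :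
    ∃ t b, T ≤ t ∧ (σ t).1 = i ∧ st ((setAgreement n d mx).run σ t) i = Sum.inr b ∧
      b.pending = none := by
  obtain ⟨t, ht, hti, -⟩ := exists_next_activation hi T
  obtain ⟨b, hb⟩ := Sum.isRight_iff.1 (hbusy t ht)
  have hb' : st ((setAgreement n d mx).run σ t) i = Sum.inr b := hb
  rcases hp : b.pending with _ | ⟨x, X⟩
  · exact ⟨t, b, ht, hti, hb', hp⟩
  · obtain ⟨t', ht', hti', hno⟩ := exists_next_activation hi (t + 1)
    have h1 : st ((setAgreement n d mx).run σ (t + 1)) i = Sum.inr { b with pending := none } := by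
      change st (Config.step _ (σ t)) i = _
      rw [step_write (e := σ t) (by rw [hti]; exact hb') hp, ← hti]
      simp [written]
    exact ⟨t', _, by omega, hti', (sameAt_run ht' hno).1.trans h1, rfl⟩

/-- Suppose that process `i` is stuck in instance `s`. By induction on `l`, eventually all registers
and all pending writes that can still take effect have rank at least `l`. For `l = 2 * s + 2` all
registers belong to later instances, and the next snapshot of `i` makes it copy a decision. -/
theorem svTermination (hmx : IsMaxRule mx) : (setAgreement n d mx).SVTermination := by
  classical
  intro σ s hSV i hi t₀ hprop
  by_contra! hnone
  set C : ℕ → (setAgreement n d mx).Config := (setAgreement n d mx).run σ with hC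
  have hR : ∀ t, Reachable (C t) := reachable_run σ
  have hV : ∀ t, Valid (C t) := fun t => valid_of_reachable hmx (hR t)
  have hU : ∀ t, Unanimous s (C t) := fun t r hr i j a b => hSV r hr t i j a b
  have hA := allTame_of_reachable hmx hU
  have hstep : ∀ t, C (t + 1) = (C t).step (σ t) := fun t => rfl
  have hstuck : ∀ t, t₀ ≤ t → (C t).sn i = s ∧ ((C t).loc i).isRight = true := fun t ht =>
    stuck_of_never_decides hprop hnone ht
  let Active : Fin n → Prop := fun j => ∀ T, ∃ t, T ≤ t ∧ (σ t).1 = j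
  -- From `T₀` on the processes that crash are silent, so their old pending writes, whatever their
  -- rank, are never performed.
  obtain ⟨T₀, hT₀, hact⟩ : ∃ T, t₀ ≤ T ∧ ∀ t, T ≤ t → Active (σ t).1 := by
    have : ∀ j, ∃ T, ¬ Active j → ∀ t, T ≤ t → (σ t).1 ≠ j := by
      intro j
      by_cases hj : Active j
      · exact ⟨0, fun h => absurd hj h⟩
      · obtain ⟨T, hT⟩ := not_forall.1 hj
        exact ⟨T, fun _ t ht h => hT ⟨t, ht, h⟩⟩
    choose F hF using this
    refine ⟨max t₀ (Finset.univ.sup F), le_max_left _ _, fun t ht => ?_⟩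
    by_contra hcon
    exact hF _ hcon t ((Finset.le_sup (Finset.mem_univ _)).trans ((le_max_right _ _).trans ht)) rfl
  have hlevel : ∀ l, l ≤ 2 * s + 2 → ∃ T, T₀ ≤ T ∧ ∀ t, T ≤ t →
      (∀ x, l ≤ (reg (C t) x).rank s) ∧
      ∀ j X, Active j → pendingOf (C t) j = some X → l ≤ X.rank s := by
    intro l
    induction l with
    | zero => exact fun _ => ⟨T₀, le_rfl, fun _ _ => ⟨fun _ => Nat.zero_le _,
        fun _ _ _ _ => Nat.zero_le _⟩⟩
    | succ l ih =>
      intro hl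
      obtain ⟨T, hT₀T, hT⟩ := ih (by omega)
      -- Once every active process has acted after `T`, each of its pending writes stems from a
      -- snapshot taken after `T` and has rank above `l`.
      obtain ⟨T₂, hTT₂, hT₂⟩ : ∃ T₂, T ≤ T₂ ∧ ∀ t, T₂ ≤ t → ∀ j X, Active j →
          pendingOf (C t) j = some X → l < X.rank s := by
        have hgood : ∀ t, T ≤ t → ∀ X, pendingOf (C (t + 1)) (σ t).1 = some X → l < X.rank s :=
          fun t ht X hX => lt_rank_of_step hmx (hR t) (hU t) (hA t) hl (hT t ht).1 (σ t) hX
        have : ∀ j, ∃ T₂, T ≤ T₂ ∧ (Active j → ∀ t, T₂ ≤ t → ∀ X, pendingOf (C t) j = some X →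
            l < X.rank s) := by
          intro j
          by_cases hj : Active j
          swap
          · exact ⟨T, le_rfl, fun h => absurd h hj⟩
          obtain ⟨t₁, ht₁, hj₁⟩ := hj T
          refine ⟨t₁ + 1, by omega, fun _ t ht => ?_⟩
          induction t, ht using Nat.le_induction with
          | base =>
            rw [← hj₁]
            exact hgood t₁ ht₁
          | succ t ht ih' =>
            intro X hX
            by_cases h : j = (σ t).1
            · subst h
              exact hgood t (by omega) X hX
            · rw [hstep, pendingOf_step_of_ne _ _ h] at hX
              exact ih' X hX
        choose F hF1 hF2 using this
        refine ⟨max T (Finset.univ.sup F), le_max_left _ _, fun t ht j X hj hX => ?_⟩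
        exact hF2 j hj t ((Finset.le_sup (Finset.mem_univ j)).trans
          ((le_max_right _ _).trans ht)) X hX
      let low : ℕ → Finset (Fin (d + 1)) := fun t =>
        Finset.univ.filter fun x => (reg (C t) x).rank s ≤ l
      have hlow : ∀ {t t'}, T₂ ≤ t → t ≤ t' → low t' ⊆ low t := by
        intro t t' ht htt
        induction t', htt using Nat.le_induction with
        | base => exact subset_rfl
        | succ t' htt ih' =>
          refine subset_trans (fun x hx => ?_) ih'
          simp only [low, Finset.mem_filter, Finset.mem_univ, true_and] at hx ⊢
          rcases reg_step hmx (hR t') (σ t') with h | ⟨b, y, X, -, -, hX, h⟩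
          · rw [hstep, h] at hx
            exact hx
          · have := hT₂ t' (by omega) _ X (hact t' (by omega)) hX
            rw [hstep, h] at hx
            by_cases hxy : x = y
            · subst hxy
              rw [Function.update_self] at hx
              omega
            · rwa [Function.update_of_ne hxy] at hx
      -- Registers never become low again. The stuck process `i` writes again and again into a
      -- register that was minimal in its snapshot; if any register was low, so was this one.
      have hzero : ∀ N t, T₂ ≤ t → (low t).card ≤ N → ∃ t', t ≤ t' ∧ low t' = ∅ := by
        intro N
        induction N with
        | zero => exact fun t _ h => ⟨t, le_rfl, Finset.card_eq_zero.1 (Nat.le_zero.1 h)⟩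
        | succ N ihN =>
          intro t ht hN
          obtain ⟨t₂, b, h1, h2, h3, h4⟩ := exists_snapshot (T := t) hi
            fun u hu => (hstuck u (by omega)).2
          by_cases hemp : low t₂ = ∅
          · exact ⟨t₂, h1, hemp⟩
          obtain ⟨y, hy⟩ := Finset.nonempty_iff_ne_empty.2 hemp
          obtain ⟨b', hb'⟩ := Sum.isRight_iff.1 (hstuck (t₂ + 1) (by omega)).2
          have hmin : ∃ x ∈ low t₂, ∃ b' X, st (C (t₂ + 1)) i = Sum.inr b' ∧
              b'.pending = some (x, X) := by
            simp only [low, Finset.mem_filter, Finset.mem_univ, true_and] at hy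
            have hmono : ∀ x, (reg (C t₂) x).key ≤ (reg (C t₂) y).key → x ∈ low t₂ := by
              intro x hx
              simp only [low, Finset.mem_filter, Finset.mem_univ, true_and]
              exact (rank_mono ((hA t₂).1 x) ((hA t₂).1 y) hx).trans hy
            have hev := (hV t₂).event hmx (σ t₂)
            have hdec := hnone (t₂ + 1)
            have hsn : (C t₂).sn i = s := (hstuck t₂ (by omega)).1
            change ((C t₂).step (σ t₂)).dec i s = none at hdec
            rw [hstep]
            rw [h2] at hev
            generalize (C t₂).step (σ t₂) = C' at hev hdec
            cases hev with
            | invoke L hl => rw [h3] at hl; cases hl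
            | decide b v => simp [hsn] at hdec
            | copy b v => simp [hsn] at hdec
            | raise b' hl hp hH hu =>
              exact ⟨0, hmono 0 (hH.1 y).ge, _, _, by rw [st_stayed, Function.update_self], rfl⟩
            | adopt b' hl hp hH hs =>
              exact ⟨minIndex _, hmono _ (key_minIndex_le _ y), _, _,
                by rw [st_stayed, Function.update_self], rfl⟩
            | write b' x X hl hp =>
              rw [h3] at hl
              cases hl
              rw [h4] at hp
              cases hp
          obtain ⟨x, hx, b', X, hb', hpX⟩ := hmin
          obtain ⟨t₃, h5, h6, h7⟩ := exists_next_activation hi (t₂ + 1)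
          have hb₃ : st (C t₃) i = Sum.inr b' := (sameAt_run h5 h7).1.trans hb'
          have hX : l < X.rank s := hT₂ t₃ (by omega) i X hi (by
            rw [pendingOf_busy hb₃, hpX]; rfl)
          have hreg : reg (C (t₃ + 1)) = Function.update (reg (C t₃)) x X := by
            rw [hstep, step_write (e := σ t₃) (by rw [h6]; exact hb₃) hpX]
            rfl
          have hxn : x ∉ low (t₃ + 1) := by
            simp [low, hreg, hX]
          have hcard : (low (t₃ + 1)).card < (low t).card := by
            refine Finset.card_lt_card ⟨hlow ht (by omega), fun hsub => ?_⟩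
            exact hxn (hsub (hlow ht h1 hx))
          obtain ⟨t', h8, h9⟩ := ihN (t₃ + 1) (by omega) (by omega)
          exact ⟨t', by omega, h9⟩
      obtain ⟨T₃, h1, h2⟩ := hzero _ T₂ le_rfl le_rfl
      refine ⟨T₃, by omega, fun t ht => ⟨fun x => ?_, fun j X hj hX => hT₂ t (by omega) j X hj hX⟩⟩
      by_contra hx
      have : x ∈ low t := by
        simp only [low, Finset.mem_filter, Finset.mem_univ, true_and]
        omega
      have := hlow h1 ht this
      rw [h2] at this
      simp at this
  obtain ⟨T, hT₀T, hT⟩ := hlevel _ le_rfl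
  obtain ⟨t, b, h1, h2, h3, h4⟩ := exists_snapshot (T := T) hi
    fun u hu => (hstuck u (by omega)).2
  have htop : ∀ x, s < (reg (C t) x).sn := by
    intro x
    by_contra hx
    have := (hT t h1).1 x
    rw [rank_of_le (not_lt.1 hx)] at this
    split_ifs at this <;> omega
  have hsn : (C t).sn i = s := (hstuck t (by omega)).1
  have hbs : b.sn = s := ((hV t).busy i b h3).sn_eq.trans hsn
  have hev := (hV t).event hmx (σ t)
  have hdec := hnone (t + 1)
  change ((C t).step (σ t)).dec i s = none at hdec
  rw [h2] at hev
  generalize (C t).step (σ t) = C' at hev hdec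
  cases hev with
  | invoke L hl => rw [h3] at hl; cases hl
  | decide b v => simp [hsn] at hdec
  | copy b v => simp [hsn] at hdec
  | raise b' hl hp hH hu =>
    rw [h3] at hl
    cases hl
    have := htop 0
    rw [hH.2.1] at this
    omega
  | adopt b' hl hp hH hs =>
    rw [h3] at hl
    cases hl
    have := htop 0
    have h5 := key_le_iff.1 (key_le_sup hmx (Proposing.mem_candidates.2 (Or.inl ⟨0, rfl⟩) :
      reg (C t) 0 ∈ b.candidates (reg (C t))))
    omega
  | write b' x X hl hp =>
    rw [h3] at hl
    cases hl
    rw [h4] at hp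
    cases hp

end setAgreement

/-! ### The register version: forgetting timestamps and readings -/

namespace Protocol

variable {V : Type u} {n m : ℕ} {P : Protocol.{u, v, w} V n m}

theorem config_ext {C D : P.Config} (hm : C.mem = D.mem) (h : ∀ i, SameAt i C D) : C = D := by
  obtain ⟨m1, l1, s1, p1, d1⟩ := C
  obtain ⟨m2, l2, s2, p2, d2⟩ := D
  obtain rfl : m1 = m2 := hm
  obtain rfl : l1 = l2 := funext fun i => (h i).1
  obtain rfl : s1 = s2 := funext fun i => (h i).2.1
  obtain rfl : p1 = p2 := funext fun i => (h i).2.2.1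
  obtain rfl : d1 = d2 := funext fun i => (h i).2.2.2
  rfl

/-- The local computation of a process commutes with the events of the others. -/
theorem exec_settle_comm (C : P.Config) (i : Fin n) (o) (L : List (Fin n × V))
    (hL : ∀ e ∈ L, e.1 ≠ i) : (C.settle i o).exec L = (C.exec L).settle i o := by
  obtain ⟨h1, h2⟩ := exec_congr (C := C.settle i o) (D := C) {j | j ≠ i} L hL (settle_mem _ _ _)
    fun j hj => sameAt_settle C o hj
  refine config_ext (by rw [h1, settle_mem]) fun j => ?_
  by_cases hj : j = i
  · subst hj
    exact (sameAt_exec _ L hL).trans (SameAt.settle o (sameAt_exec C L hL).symm)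
  · exact (h2 j hj).trans (sameAt_settle _ o hj).symm

/-- The global state after an invocation, before the local computation. -/
def started (C : P.Config) (i : Fin n) (a : V) : P.Config :=
  { C with
    sn := Function.update C.sn i (C.sn i + 1)
    prop := Function.update C.prop i (Function.update (C.prop i) (C.sn i + 1) (some a)) }

theorem step_of_idle {C : P.Config} {e : Fin n × V} {s}
    (h : C.loc e.1 = Sum.inl s) : C.step e =
      (started C e.1 e.2).settle e.1 ((P.code e.1).propose (C.sn e.1 + 1) e.2 s) := by
  unfold Config.step
  rw [h]
  rfl

theorem step_of_read {C : P.Config} {e : Fin n × V} {b x next}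
    (h : C.loc e.1 = Sum.inr b) (ha : (P.code e.1).access b = .read x next) :
    C.step e = C.settle e.1 (next (C.mem x)) := by
  unfold Config.step
  rw [h]
  dsimp only
  rw [ha]

theorem step_of_snapshot {C : P.Config} {e : Fin n × V} {b next}
    (h : C.loc e.1 = Sum.inr b) (ha : (P.code e.1).access b = .snapshot next) :
    C.step e = C.settle e.1 (next C.mem) := by
  unfold Config.step
  rw [h]
  dsimp only
  rw [ha]

theorem step_of_write {C : P.Config} {e : Fin n × V}
    {b x r next} (h : C.loc e.1 = Sum.inr b) (ha : (P.code e.1).access b = .write x r next) :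
    C.step e = Config.settle { C with mem := Function.update C.mem x r } e.1 next := by
  unfold Config.step
  rw [h]
  dsimp only
  rw [ha]

end Protocol

namespace Program

open Protocol

variable {V : Type u} {R : Type v} {m : ℕ}

/-- The program `A` executed by `n` anonymous processes on an atomic snapshot object. -/
abbrev atomic (n : ℕ) (mem : Fin m → R) (A : Program.{u, v, max v w} V R m) :
    Protocol.{u, v, max v w} V n m :=
  Protocol.anonymous n mem A

variable {n : ℕ} {mem : Fin m → R} {A : Program.{u, v, max v w} V R m}

/-- The local state of a process without the implementation of snapshots and writes. -/
def innerState : (A.Idle × ℕ) ⊕ Layered.{u, v, w} A → A.Idle ⊕ A.Busy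
  | Sum.inl s => Sum.inl s.1
  | Sum.inr b => Sum.inr b.inner

variable [NeZero m] [DecidableEq R]

/-- The program `A` executed by `n` anonymous processes on read/write registers. -/
abbrev layered (n : ℕ) (mem : Fin m → R) (A : Program.{u, v, max v w} V R m) :
    Protocol.{u, v, max v w} V n m :=
  Protocol.anonymous n (fun x => ((none : Option ℕ), mem x)) (Program.onRegisters.{u, v, w} n mem A)

/-- The local state of a process. -/
def lst (C : (layered.{u, v, w} n mem A).Config) (i : Fin n) :
    (A.Idle × ℕ) ⊕ Layered.{u, v, w} A := C.loc i

/-- The global state without the implementation of snapshots and writes. -/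
def proj (C : (layered.{u, v, w} n mem A).Config) : (atomic.{u, v, w} n mem A).Config where
  mem := fun x => (C.mem x).2
  loc := fun i => innerState (R := R) (A := A) (lst (R := R) (A := A) C i)
  sn := C.sn
  prop := C.prop
  dec := C.dec

/-- Process `i` is going to perform a read that does not terminate its snapshot. -/
def Silent (C : (layered.{u, v, w} n mem A).Config) (i : Fin n) : Prop :=
  ∃ b next S, lst C i = Sum.inr b ∧ A.access b.inner = .snapshot next ∧
    b.scan.next n (C.mem b.scan.y) = Sum.inl S

/-- The global state after a silent read. -/
def rescan (C : (layered.{u, v, w} n mem A).Config) (i : Fin n) (b : Layered.{u, v, w} A)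
    (S : Scan m R) : (layered.{u, v, w} n mem A).Config :=
  C.settle i (Outcome.stay { b with scan := S } :
    Outcome V (A.Idle × ℕ) (Layered.{u, v, w} A))

/-- The global state after process `i` has performed the outcome `o` of `A`. -/
def lifted (C : (layered.{u, v, w} n mem A).Config) (i : Fin n) (ts : ℕ)
    (o : Outcome V A.Idle A.Busy) : (layered.{u, v, w} n mem A).Config :=
  C.settle i (Layered.lift.{u, v, w} mem ts o)

theorem proj_rescan {C : (layered.{u, v, w} n mem A).Config} {i : Fin n}
    {b : Layered.{u, v, w} A} (h : lst C i = Sum.inr b) (S : Scan m R) :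
    proj (rescan C i b S) = proj C := by
  refine config_ext rfl fun j => ⟨?_, rfl, rfl, rfl⟩
  change innerState (lst (rescan C i b S) j) = innerState (lst C j)
  by_cases hj : j = i
  · subst hj
    rw [h]
    simp [lst, rescan, Config.settle, innerState]
  · simp [lst, rescan, Config.settle, hj]

theorem proj_lifted (C : (layered.{u, v, w} n mem A).Config) (i : Fin n) (ts : ℕ)
    (o : Outcome V A.Idle A.Busy) : proj (lifted C i ts o) =
      Config.settle (P := atomic.{u, v, w} n mem A) (proj C) i o := by
  cases o with
  | ret a s =>
    refine config_ext rfl fun j => ⟨?_, rfl, rfl, rfl⟩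
    change innerState (lst (lifted C i ts _) j) = Function.update (proj C).loc i (Sum.inl s) j
    by_cases hj : j = i
    · subst hj
      simp [lst, lifted, Config.settle, innerState, Layered.lift]
      rfl
    · rw [Function.update_of_ne hj]
      simp [lst, lifted, Config.settle, Layered.lift, hj, proj]
  | stay b =>
    refine config_ext rfl fun j => ⟨?_, rfl, rfl, rfl⟩
    change innerState (lst (lifted C i ts _) j) = Function.update (proj C).loc i (Sum.inr b) j
    by_cases hj : j = i
    · subst hj
      simp [lst, lifted, Config.settle, innerState, Layered.lift]
      rfl
    · rw [Function.update_of_ne hj]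
      simp [lst, lifted, Config.settle, Layered.lift, hj, proj]

/-- The possible events of a process on read/write registers. -/
inductive LEvent (C : (layered.{u, v, w} n mem A).Config) (i : Fin n) (a : V) :
    (layered.{u, v, w} n mem A).Config → Prop
  | invoke (s : A.Idle × ℕ) (h : lst C i = Sum.inl s) :
      LEvent C i a (lifted (started C i a) i s.2 (A.propose (C.sn i + 1) a s.1))
  | read (b : Layered.{u, v, w} A) (x : Fin m) (next) (h : lst C i = Sum.inr b)
      (ha : A.access b.inner = .read x next) :
      LEvent C i a (lifted C i b.ts (next (C.mem x).2))
  | write (b : Layered.{u, v, w} A) (x : Fin m) (r) (next) (h : lst C i = Sum.inr b)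
      (ha : A.access b.inner = .write x r next) :
      LEvent C i a (lifted { C with mem := Function.update C.mem x (some b.ts, r) } i (b.ts + 1)
        next)
  | silent (b : Layered.{u, v, w} A) (next) (S : Scan m R) (h : lst C i = Sum.inr b)
      (ha : A.access b.inner = .snapshot next)
      (hS : b.scan.next n (C.mem b.scan.y) = Sum.inl S) : LEvent C i a (rescan C i b S)
  | complete (b : Layered.{u, v, w} A) (next) (view : Fin m → R) (h : lst C i = Sum.inr b)
      (ha : A.access b.inner = .snapshot next)
      (hS : b.scan.next n (C.mem b.scan.y) = Sum.inr view) :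
      LEvent C i a (lifted C i b.ts (next view))

theorem onRegisters_read {b : Layered.{u, v, w} A} {x next} (h : A.access b.inner = .read x next) :
    (onRegisters.{u, v, w} n mem A).access b =
      .read x fun (r : Option ℕ × R) => Layered.lift.{u, v, w} mem b.ts (next r.2) := by
  change (match A.access b.inner with
    | .read x next => _ | .snapshot next => _ | .write x r next => _) = _
  rw [h]; rfl

theorem onRegisters_write {b : Layered.{u, v, w} A} {x r next}
    (h : A.access b.inner = .write x r next) :
    (onRegisters.{u, v, w} n mem A).access b =
      .write x (some b.ts, r) (Layered.lift.{u, v, w} mem (b.ts + 1) next) := by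
  change (match A.access b.inner with
    | .read x next => _ | .snapshot next => _ | .write x r next => _) = _
  rw [h]; rfl

/-- The local computation after a read of a snapshot. -/
def afterScan (mem : Fin m → R) (b : Layered.{u, v, w} A)
    (next : (Fin m → R) → Outcome V A.Idle A.Busy) :
    Scan m R ⊕ (Fin m → R) → Outcome V (A.Idle × ℕ) (Layered.{u, v, w} A)
  | .inl S => .stay { b with scan := S }
  | .inr view => Layered.lift mem b.ts (next view)

theorem onRegisters_snapshot {b : Layered.{u, v, w} A} {next}
    (h : A.access b.inner = .snapshot next) :
    (onRegisters.{u, v, w} n mem A).access b =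
      .read b.scan.y fun (r : Option ℕ × R) => afterScan mem b next (b.scan.next n r) := by
  change (match A.access b.inner with
    | .read x next => _ | .snapshot next => _ | .write x r next => _) = _
  rw [h]
  rfl

theorem levent (C : (layered.{u, v, w} n mem A).Config) (e : Fin n × V) :
    LEvent C e.1 e.2 (C.step e) := by
  cases h : lst C e.1 with
  | inl s =>
    rw [step_of_idle (show C.loc e.1 = Sum.inl s from h)]
    exact .invoke s h
  | inr b =>
    have h' : C.loc e.1 = Sum.inr b := h
    cases ha : A.access b.inner with
    | read x next =>
      rw [step_of_read h' (onRegisters_read ha)]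
      exact .read b x next h ha
    | write x r next =>
      rw [step_of_write h' (onRegisters_write ha)]
      exact .write b x r next h ha
    | snapshot next =>
      rw [step_of_read h' (onRegisters_snapshot ha)]
      cases hS : b.scan.next n (C.mem b.scan.y) with
      | inl S => exact .silent b next S h ha hS
      | inr view => exact .complete b next view h ha hS

end Program

/-! ### Linearizability of the repeated readings -/

namespace Program

open Protocol

variable {V : Type u} {R : Type v} {m : ℕ} {n : ℕ} {mem : Fin m → R}
  {A : Program.{u, v, max v w} V R m} [NeZero m] [DecidableEq R]

theorem lst_rescan (C : (layered.{u, v, w} n mem A).Config) (i : Fin n) (b : Layered.{u, v, w} A)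
    (S : Scan m R) : lst (rescan C i b S) i = Sum.inr { b with scan := S } := by
  simp [lst, rescan, Config.settle]
  rfl

theorem lst_lifted (C : (layered.{u, v, w} n mem A).Config) (i : Fin n) (ts : ℕ)
    (o : Outcome V A.Idle A.Busy) :
    (∃ s, lst (lifted C i ts o) i = Sum.inl (s, ts)) ∨
      ∃ b, lst (lifted C i ts o) i = Sum.inr ⟨b, ts, Scan.begin mem⟩ := by
  cases o with
  | ret a s =>
    refine Or.inl ⟨s, ?_⟩
    simp [lst, lifted, Config.settle, Layered.lift]
    rfl
  | stay b =>
    refine Or.inr ⟨b, ?_⟩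
    simp [lst, lifted, Config.settle, Layered.lift]
    rfl

theorem lst_step_of_ne (C : (layered.{u, v, w} n mem A).Config) (e : Fin n × V) {j : Fin n}
    (h : j ≠ e.1) : lst (C.step e) j = lst C j := (sameAt_step C e h).1

theorem mem_lifted (C : (layered.{u, v, w} n mem A).Config) (i : Fin n) (ts : ℕ)
    (o : Outcome V A.Idle A.Busy) : (lifted C i ts o).mem = C.mem := settle_mem _ _ _

theorem mem_rescan (C : (layered.{u, v, w} n mem A).Config) (i : Fin n) (b : Layered.{u, v, w} A)
    (S : Scan m R) : (rescan C i b S).mem = C.mem := settle_mem _ _ _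

/-- The counter of a process. -/
def counter (C : (layered.{u, v, w} n mem A).Config) (i : Fin n) : ℕ :=
  (lst C i).elim (fun s => s.2) fun b => b.ts

theorem counter_lifted (C : (layered.{u, v, w} n mem A).Config) (i : Fin n) (ts : ℕ)
    (o : Outcome V A.Idle A.Busy) : counter (lifted C i ts o) i = ts := by
  rcases lst_lifted C i ts o with ⟨s, h⟩ | ⟨b, h⟩ <;> simp [counter, h]

theorem counter_step_le (C : (layered.{u, v, w} n mem A).Config) (e : Fin n × V) (i : Fin n) :
    counter C i ≤ counter (C.step e) i := by
  by_cases hi : i = e.1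
  swap
  · rw [counter, counter, lst_step_of_ne C e hi]
  subst hi
  have hev := levent C e
  generalize C.step e = C' at hev
  cases hev with
  | invoke s h => rw [counter_lifted]; simp [counter, h]
  | read b x next h ha => rw [counter_lifted]; simp [counter, h]
  | write b x r next h ha => rw [counter_lifted]; simp [counter, h]
  | silent b next S h ha hS => simp [counter, h, lst_rescan]
  | complete b next view h ha hS => rw [counter_lifted]; simp [counter, h]

/-- Process `i` is going to write `μ x` into register `x`. -/
def Writes (C : (layered.{u, v, w} n mem A).Config) (i : Fin n) (μ : Fin m → Option ℕ × R)
    (x : Fin m) : Prop :=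
  ∃ b r next, lst C i = Sum.inr b ∧ A.access b.inner = .write x r next ∧ μ x = (some b.ts, r)

theorem mem_step (C : (layered.{u, v, w} n mem A).Config) (e : Fin n × V) (x : Fin m) :
    (C.step e).mem x = C.mem x ∨ Writes C e.1 (C.step e).mem x := by
  have hev := levent C e
  generalize C.step e = C' at hev
  cases hev with
  | invoke s h => exact Or.inl (by rw [mem_lifted]; rfl)
  | read b x next h ha => exact Or.inl (by rw [mem_lifted])
  | write b y r next h ha =>
    rw [mem_lifted]
    by_cases hx : x = y
    · subst hx
      exact Or.inr ⟨b, r, next, h, ha, Function.update_self _ _ _⟩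
    · exact Or.inl (Function.update_of_ne hx _ _)
  | silent b next S h ha hS => exact Or.inl (by rw [mem_rescan])
  | complete b next view h ha hS => exact Or.inl (by rw [mem_lifted])

theorem counter_lt_of_writes {C : (layered.{u, v, w} n mem A).Config} {e : Fin n × V} {μ x}
    (h : Writes C e.1 μ x) :
    (μ x).1 = some (counter C e.1) ∧ counter C e.1 < counter (C.step e) e.1 := by
  obtain ⟨b, r, next, h1, h2, h3⟩ := h
  have hc : counter C e.1 = b.ts := by simp [counter, h1]
  refine ⟨by rw [h3, hc], ?_⟩
  have hev := levent C e
  generalize C.step e = C' at hev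
  cases hev with
  | invoke s h => rw [h1] at h; cases h
  | read b x next h ha => rw [h1] at h; cases h; rw [h2] at ha; cases ha
  | write b y r next h ha => rw [h1] at h; cases h; rw [counter_lifted, hc]; omega
  | silent b next S h ha hS => rw [h1] at h; cases h; rw [h2] at ha; cases ha
  | complete b next view h ha hS => rw [h1] at h; cases h; rw [h2] at ha; cases ha

theorem Silent.not_writes {C : (layered.{u, v, w} n mem A).Config} {i : Fin n} {μ x}
    (h : Silent C i) : ¬ Writes C i μ x := by
  rintro ⟨b, r, next, h1, h2, -⟩
  obtain ⟨b', next', S, h3, h4, -⟩ := h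
  rw [h1] at h3
  cases h3
  rw [h2] at h4
  cases h4

variable (mem A) in
/-- All events of process `q` from time `c` to time `t` are silent reads. -/
def Quiet (σ : ℕ → Fin n × V) (q : Fin n) (c t : ℕ) : Prop :=
  ∀ u, c ≤ u → u < t → (σ u).1 = q → Silent ((layered.{u, v, w} n mem A).run σ u) q

theorem Quiet.mono {σ : ℕ → Fin n × V} {q : Fin n} {c c' t t' : ℕ}
    (h : Quiet.{u, v, w} mem A σ q c t) (hc : c ≤ c') (ht : t' ≤ t) :
    Quiet.{u, v, w} mem A σ q c' t' :=
  fun u h1 h2 => h u (by omega) (by omega)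

theorem Quiet.succ {σ : ℕ → Fin n × V} {q : Fin n} {c t : ℕ} (h : Quiet.{u, v, w} mem A σ q c t)
    (ht : (σ t).1 = q → Silent ((layered.{u, v, w} n mem A).run σ t) q) :
    Quiet.{u, v, w} mem A σ q c (t + 1) := by
  intro u h1 h2 h3
  rcases Nat.lt_succ_iff_lt_or_eq.1 h2 with h4 | rfl
  · exact h u h1 h4 h3
  · exact ht h3

variable (mem A) in
/-- At time `u`, some process other than `q` writes an entry of the array `μ` at its place. -/
def Refresh (σ : ℕ → Fin n × V) (q : Fin n) (μ : Fin m → Option ℕ × R) (u : ℕ) : Prop :=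
  (σ u).1 ≠ q ∧ ∃ x, Writes ((layered.{u, v, w} n mem A).run σ u) (σ u).1 μ x

variable (mem A) in
open Classical in
/-- The times from `c` to `t` at which `μ` is refreshed. -/
noncomputable def refreshes (σ : ℕ → Fin n × V) (q : Fin n) (μ : Fin m → Option ℕ × R) (c t : ℕ) : Finset ℕ :=
  (Finset.Ico c t).filter (Refresh.{u, v, w} mem A σ q μ)

theorem refreshes_mono (σ : ℕ → Fin n × V) (q : Fin n) (μ : Fin m → Option ℕ × R) {c t t' : ℕ}
    (h : t ≤ t') :
    refreshes.{u, v, w} mem A σ q μ c t ⊆ refreshes.{u, v, w} mem A σ q μ c t' := by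
  classical
  exact Finset.filter_subset_filter _ (Finset.Ico_subset_Ico le_rfl h)

theorem counter_mono (σ : ℕ → Fin n × V) (i : Fin n) :
    Monotone fun t => counter ((layered.{u, v, w} n mem A).run σ t) i :=
  monotone_nat_of_le_succ fun t => counter_step_le _ (σ t) i

/-- Every process writes a given pair at most once. -/
theorem card_refreshes_le (σ : ℕ → Fin n × V) (q : Fin n) (μ : Fin m → Option ℕ × R) (c t : ℕ) :
    (refreshes.{u, v, w} mem A σ q μ c t).card ≤ m * (n - 1) := by
  classical
  have hx : ∀ u, ∃ x, Refresh.{u, v, w} mem A σ q μ u →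
      Writes ((layered.{u, v, w} n mem A).run σ u) (σ u).1 μ x := by
    intro u
    by_cases h : Refresh.{u, v, w} mem A σ q μ u
    · exact ⟨h.2.choose, fun _ => h.2.choose_spec⟩
    · exact ⟨0, fun h' => absurd h' h⟩
  choose f hf using hx
  have hcard : (Finset.univ ×ˢ Finset.univ.erase q : Finset (Fin m × Fin n)).card =
      m * (n - 1) := by
    rw [Finset.card_product, Finset.card_erase_of_mem (Finset.mem_univ q)]
    simp
  rw [← hcard]
  -- The register determines the timestamp of the entry, this must be the counter of the writer, and
  -- the write increments the counter. So a refresh is determined by the register and the writer.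
  -- Different anonymous processes may write the same pair, whence the factor n - 1.
  refine Finset.card_le_card_of_injOn (fun u => (f u, (σ u).1)) ?_ ?_
  · intro u hu
    have hu := (Finset.mem_filter.1 hu).2
    simpa using hu.1
  · have key : ∀ u u', Refresh.{u, v, w} mem A σ q μ u → Refresh.{u, v, w} mem A σ q μ u' →
        f u = f u' → (σ u).1 = (σ u').1 → ¬ u < u' := by
      intro u u' h h' h1 h2 hlt
      obtain ⟨a1, a2⟩ := counter_lt_of_writes (hf u h)
      obtain ⟨b1, -⟩ := counter_lt_of_writes (hf u' h')
      rw [← h1, a1, Option.some_inj, ← h2] at b1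
      have := counter_mono (mem := mem) (A := A) σ (σ u).1 (show u + 1 ≤ u' from hlt)
      change counter (((layered.{u, v, w} n mem A).run σ u).step (σ u)) _ ≤ _ at this
      dsimp only at this
      omega
    intro u hu u' hu' h
    simp only [Prod.mk.injEq] at h
    have hu := (Finset.mem_filter.1 hu).2
    have hu' := (Finset.mem_filter.1 hu').2
    rcases lt_trichotomy u u' with h1 | h1 | h1
    · exact absurd h1 (key u u' hu hu' h.1 h.2)
    · exact h1
    · exact absurd h1 (key u' u hu' hu h.1.symm h.2.symm)

/-- As `q` only reads, the register can take the content `μ x` only by a write of another process.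
-/
theorem exists_refresh {σ : ℕ → Fin n × V} {q : Fin n} {μ : Fin m → Option ℕ × R} {c t : ℕ}
    (hq : Quiet.{u, v, w} mem A σ q c t) {x : Fin m}
    (h1 : ((layered.{u, v, w} n mem A).run σ c).mem x ≠ μ x) (hct : c ≤ t)
    (h2 : ((layered.{u, v, w} n mem A).run σ t).mem x = μ x) :
    ∃ u, c ≤ u ∧ u < t ∧ Refresh.{u, v, w} mem A σ q μ u := by
  induction t, hct using Nat.le_induction with
  | base => exact absurd h2 h1
  | succ t hct ih =>
    by_cases h : ((layered.{u, v, w} n mem A).run σ t).mem x = μ x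
    · obtain ⟨u, a, b, c⟩ := ih (hq.mono le_rfl (Nat.le_succ t)) h
      exact ⟨u, a, by omega, c⟩
    · have hs : (layered.{u, v, w} n mem A).run σ (t + 1) =
        ((layered.{u, v, w} n mem A).run σ t).step (σ t) := rfl
      rw [hs] at h2
      have hw : Writes ((layered.{u, v, w} n mem A).run σ t) (σ t).1 μ x := by
        rcases mem_step ((layered.{u, v, w} n mem A).run σ t) (σ t) x with h3 | h3
        · exact absurd (h3.symm.trans h2) h
        · obtain ⟨b, r, next, a1, a2, a3⟩ := h3
          exact ⟨b, r, next, a1, a2, h2.symm.trans a3⟩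
      exact ⟨t, hct, Nat.lt_succ_self t,
        fun h4 => (hq t hct (Nat.lt_succ_self t) h4).not_writes (h4 ▸ hw), x, hw⟩

variable (mem A) in
/-- What is known of the shared memory when process `q` has reached the state `S` of a snapshot at
time `t`, where the last identical arrays have been read from time `c₁` on, and the reading of the
current array has begun at time `c`. -/
structure Scanning (σ : ℕ → Fin n × V) (q : Fin n) (S : Scan m R) (t c₁ c : ℕ) : Prop where
  le : c₁ ≤ c
  le' : c ≤ t
  quiet : Quiet.{u, v, w} mem A σ q c₁ t
  good : (∃ c₀, c₁ ≤ c₀ ∧ c₀ ≤ t ∧ ((layered.{u, v, w} n mem A).run σ c₀).mem = S.sm1) ∨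
    S.count ≤ (refreshes.{u, v, w} mem A σ q S.sm1 c₁ c).card + 1
  seen : ∀ x, x < S.y → ∃ τ, c ≤ τ ∧ τ < t ∧
    ((layered.{u, v, w} n mem A).run σ τ).mem x = S.sm2 x

/-- If the memory differs from `S.sm1` at a register when the reading begins at time `c`, but this
register is then read as in `S.sm1`, it has been refreshed during the reading, after all refreshes
counted before. -/
theorem Scanning.full {σ : ℕ → Fin n × V} {q : Fin n} {S : Scan m R} {t c₁ c : ℕ}
    (h : Scanning.{u, v, w} mem A σ q S t c₁ c) (hy : ¬ S.y.val + 1 < m)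
    (hS : S.sm1 = Function.update S.sm2 S.y (((layered.{u, v, w} n mem A).run σ t).mem S.y)) :
    (∃ c₀, c₁ ≤ c₀ ∧ c₀ ≤ t ∧ ((layered.{u, v, w} n mem A).run σ c₀).mem = S.sm1) ∨
      S.count ≤ (refreshes.{u, v, w} mem A σ q S.sm1 c₁ t).card := by
  classical
  by_cases hg : ((layered.{u, v, w} n mem A).run σ c).mem = S.sm1
  · exact Or.inl ⟨c, h.le, h.le', hg⟩
  refine h.good.imp_right fun hc => ?_
  obtain ⟨x, hx⟩ := Function.ne_iff.1 hg
  obtain ⟨u, h1, h2, h3⟩ : ∃ u, c ≤ u ∧ u < t ∧ Refresh.{u, v, w} mem A σ q S.sm1 u := by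
    by_cases hxy : x = S.y
    · subst hxy
      refine exists_refresh (h.quiet.mono h.le le_rfl) hx h.le' ?_
      exact ((congrFun hS S.y).trans (Function.update_self S.y _ S.sm2)).symm
    · obtain ⟨τ, a, b, hτ⟩ := h.seen x (by have := x.isLt; omega)
      obtain ⟨u, h1, h2, h3⟩ := exists_refresh (h.quiet.mono h.le b.le) hx a
        (hτ.trans ((congrFun hS x).trans (Function.update_of_ne hxy _ S.sm2)).symm)
      exact ⟨u, h1, by omega, h3⟩
  have hsub : insert u (refreshes.{u, v, w} mem A σ q S.sm1 c₁ c) ⊆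
      refreshes.{u, v, w} mem A σ q S.sm1 c₁ t := by
    refine Finset.insert_subset ?_
      (refreshes_mono _ _ _ h.le')
    have := h.le
    exact Finset.mem_filter.2 ⟨Finset.mem_Ico.2 ⟨by omega, h2⟩, h3⟩
  have hu : u ∉ refreshes.{u, v, w} mem A σ q S.sm1 c₁ c := by
    intro hu
    have := (Finset.mem_Ico.1 (Finset.mem_filter.1 hu).1).2
    omega
  have := Finset.card_le_card hsub
  rw [Finset.card_insert_of_notMem hu] at this
  omega

/-- The three ways to go on with a snapshot. -/
theorem scan_next_cases {S S' : Scan m R} {r : Option ℕ × R} (h : S.next n r = Sum.inl S') :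
    (∃ hy : S.y.val + 1 < m,
      S' = { S with y := ⟨S.y.val + 1, hy⟩, sm2 := Function.update S.sm2 S.y r }) ∨
    ¬ S.y.val + 1 < m ∧ (S.initial = false ∧ S.sm1 = Function.update S.sm2 S.y r ∧
        S.count + 1 ≠ m * (n - 1) + 2 ∧ S' = ⟨0, S.sm1, S.sm1, false, S.count + 1⟩ ∨
      ¬ (S.initial = false ∧ S.sm1 = Function.update S.sm2 S.y r) ∧
        S' = ⟨0, Function.update S.sm2 S.y r, Function.update S.sm2 S.y r, false, 1⟩) := by
  unfold Scan.next at h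
  dsimp only at h
  split_ifs at h with h1 h2 h3
  · exact Or.inl ⟨h1, (Sum.inl.inj h).symm⟩
  · refine Or.inr ⟨h1, Or.inl ⟨h2.1, h2.2, h3, ?_⟩⟩
    rw [h2.2]
    exact (Sum.inl.inj h).symm
  · exact Or.inr ⟨h1, Or.inr ⟨h2, (Sum.inl.inj h).symm⟩⟩

theorem scan_next_inr {S : Scan m R} {r : Option ℕ × R} {view : Fin m → R}
    (h : S.next n r = Sum.inr view) :
    ¬ S.y.val + 1 < m ∧ S.initial = false ∧ S.sm1 = Function.update S.sm2 S.y r ∧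
      S.count + 1 = m * (n - 1) + 2 ∧ view = fun x => (S.sm1 x).2 := by
  unfold Scan.next at h
  dsimp only at h
  split_ifs at h with h1 h2 h3
  exact ⟨h1, h2.1, h2.2, h3, (Sum.inr.inj h).symm⟩

/-- When a different array is found, both times restart after this reading with `count = 1`. Hence
the first of the identical readings is charged to no refresh, which is the `+ 1` in `Scanning.good`;
each further one pays by `Scanning.full`. -/
theorem exists_scanning (σ : ℕ → Fin n × V) (q : Fin n) (t : ℕ) (b : Layered.{u, v, w} A)
    (hb : lst ((layered.{u, v, w} n mem A).run σ t) q = Sum.inr b) (hi : b.scan.initial = false) :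
    ∃ c₁ c, Scanning.{u, v, w} mem A σ q b.scan t c₁ c := by
  induction t generalizing b with
  | zero => cases hb
  | succ t ih =>
    have hs : (layered.{u, v, w} n mem A).run σ (t + 1) =
      ((layered.{u, v, w} n mem A).run σ t).step (σ t) := rfl
    rw [hs] at hb
    by_cases hq : q = (σ t).1
    swap
    · rw [lst_step_of_ne _ _ hq] at hb
      obtain ⟨c₁, c, h⟩ := ih b hb hi
      refine ⟨c₁, c, h.le, h.le'.trans (Nat.le_succ t), h.quiet.succ fun h => absurd h.symm hq,
        h.good.imp_left ?_, ?_⟩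
      · rintro ⟨c₀, a1, a2, a3⟩
        exact ⟨c₀, a1, a2.trans (Nat.le_succ t), a3⟩
      · intro x hx
        obtain ⟨τ, a1, a2, a3⟩ := h.seen x hx
        exact ⟨τ, a1, a2.trans (Nat.lt_succ_self t), a3⟩
    subst hq
    have hlift : ∀ (D : (layered.{u, v, w} n mem A).Config) (ts : ℕ) (o : Outcome V A.Idle A.Busy),
        lst (lifted D (σ t).1 ts o) (σ t).1 ≠ Sum.inr b := by
      intro D ts o h
      rcases lst_lifted D (σ t).1 ts o with ⟨s, h'⟩ | ⟨b', h'⟩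
      · rw [h'] at h; cases h
      · rw [h'] at h
        cases h
        cases hi
    have hev := levent ((layered.{u, v, w} n mem A).run σ t) (σ t)
    generalize ((layered.{u, v, w} n mem A).run σ t).step (σ t) = C' at hev hb
    cases hev with
    | invoke s h => exact absurd hb (hlift _ _ _)
    | read b x next h ha => exact absurd hb (hlift _ _ _)
    | write b y r next h ha => exact absurd hb (hlift _ _ _)
    | complete b next view h ha hS => exact absurd hb (hlift _ _ _)
    | silent b' next S h ha hS =>
      rw [lst_rescan] at hb
      cases hb
      have hsil : Silent ((layered.{u, v, w} n mem A).run σ t) (σ t).1 := ⟨b', next, S, h, ha, hS⟩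
      dsimp only at hi ⊢
      rcases scan_next_cases hS with ⟨hy, rfl⟩ | ⟨hy, ⟨h1, h2, -, rfl⟩ | ⟨-, rfl⟩⟩
      · obtain ⟨c₁, c, h'⟩ := ih b' h hi
        refine ⟨c₁, c, h'.le, h'.le'.trans (Nat.le_succ t), h'.quiet.succ fun _ => hsil,
          h'.good.imp_left ?_, ?_⟩
        · rintro ⟨c₀, a1, a2, a3⟩
          exact ⟨c₀, a1, a2.trans (Nat.le_succ t), a3⟩
        · intro x hx
          dsimp only at hx ⊢
          by_cases hxy : x = b'.scan.y
          · subst hxy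
            exact ⟨t, h'.le', Nat.lt_succ_self t, (Function.update_self b'.scan.y _ b'.scan.sm2).symm⟩
          · have hne : x.val ≠ b'.scan.y.val := fun h => hxy (Fin.ext h)
            have hlt : x.val < b'.scan.y.val + 1 := hx
            obtain ⟨τ, a1, a2, a3⟩ := h'.seen x (by rw [Fin.lt_def]; omega)
            exact ⟨τ, a1, a2.trans (Nat.lt_succ_self t), 
              a3.trans (Function.update_of_ne hxy _ b'.scan.sm2).symm⟩
      · obtain ⟨c₁, c, h'⟩ := ih b' h h1
        have hf := h'.full hy h2
        refine ⟨c₁, t + 1, (h'.le.trans h'.le').trans (Nat.le_succ t), le_rfl,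
          h'.quiet.succ fun _ => hsil, ?_, fun x hx => absurd hx (Fin.not_lt_zero x)⟩
        rcases hf with ⟨c₀, a1, a2, a3⟩ | hf
        · exact Or.inl ⟨c₀, a1, a2.trans (Nat.le_succ t), a3⟩
        · refine Or.inr (Nat.succ_le_succ (hf.trans (Finset.card_le_card ?_)))
          exact refreshes_mono _ _ _ (Nat.le_succ t)
      · exact ⟨t + 1, t + 1, le_rfl, le_rfl, fun u h1 h2 => by omega,
          Or.inr (Nat.le_add_left _ _), fun x hx => absurd hx (Fin.not_lt_zero x)⟩

/-- A snapshot returns the content of the memory at some time after which the process has performed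
silent reads only. -/
theorem exists_linearization_point {σ : ℕ → Fin n × V} {t : ℕ} {q : Fin n}
    {b : Layered.{u, v, w} A} {view : Fin m → R}
    (hb : lst ((layered.{u, v, w} n mem A).run σ t) q = Sum.inr b)
    (h : b.scan.next n (((layered.{u, v, w} n mem A).run σ t).mem b.scan.y) = Sum.inr view) :
    ∃ c, c ≤ t ∧ Quiet.{u, v, w} mem A σ q c t ∧
      view = fun x => (((layered.{u, v, w} n mem A).run σ c).mem x).2 := by
  obtain ⟨h1, h2, h3, h4, rfl⟩ := scan_next_inr h
  obtain ⟨c₁, c, hsc⟩ := exists_scanning σ q t b hb h2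
  rcases hsc.full h1 h3 with ⟨c₀, a1, a2, a3⟩ | hf
  · exact ⟨c₀, a2, hsc.quiet.mono a1 le_rfl, by rw [a3]⟩
  -- At the last read `count` is `m * (n - 1) + 1`, one more than the possible refreshes; the
  -- threshold `m * (n - 1) + 2` is chosen for this.
  · have := card_refreshes_le (mem := mem) (A := A) σ q b.scan.sm1 c₁ t
    omega

/-- The effect of an event on registers, in terms of the snapshot object: none for a silent read, a
local computation for the last read of a snapshot, and otherwise the same event. -/
theorem proj_step (C : (layered.{u, v, w} n mem A).Config) (e : Fin n × V) :
    (Silent C e.1 ∧ proj (C.step e) = proj C) ∨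
    (¬ Silent C e.1 ∧ proj (C.step e) = (proj C).step e) ∨
    (¬ Silent C e.1 ∧ ∃ b next view, lst C e.1 = Sum.inr b ∧ A.access b.inner = .snapshot next ∧
      b.scan.next n (C.mem b.scan.y) = Sum.inr view ∧ proj (C.step e) =
        Config.settle (P := atomic.{u, v, w} n mem A) (proj C) e.1 (next view)) := by
  have hloc : ∀ {l}, lst C e.1 = l → (proj C).loc e.1 = innerState l := by
    rintro l rfl
    rfl
  have hev := levent C e
  generalize C.step e = C' at hev
  cases hev with
  | invoke s h =>
    refine Or.inr (Or.inl ⟨?_, ?_⟩)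
    · rintro ⟨b, next, S, h', -⟩
      rw [h] at h'
      cases h'
    · rw [proj_lifted, step_of_idle (hloc h)]
      rfl
  | read b x next h ha =>
    refine Or.inr (Or.inl ⟨?_, ?_⟩)
    · rintro ⟨b', next, S, h', ha', -⟩
      rw [h] at h'
      cases h'
      rw [ha] at ha'
      cases ha'
    · rw [proj_lifted, step_of_read (hloc h) ha]
      rfl
  | write b x r next h ha =>
    refine Or.inr (Or.inl ⟨?_, ?_⟩)
    · rintro ⟨b', next, S, h', ha', -⟩
      rw [h] at h'
      cases h'
      rw [ha] at ha'
      cases ha'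
    · rw [proj_lifted, step_of_write (hloc h) ha]
      congr 1
      refine config_ext (funext fun y => ?_) fun j => ⟨rfl, rfl, rfl, rfl⟩
      change (Function.update C.mem x (some b.ts, r) y).2 =
        Function.update (fun x => (C.mem x).2) x r y
      by_cases hy : y = x
      · subst hy
        exact (congrArg Prod.snd (Function.update_self y (some b.ts, r) C.mem)).trans
          (Function.update_self y r fun x => (C.mem x).2).symm
      · exact (congrArg Prod.snd (Function.update_of_ne hy (some b.ts, r) C.mem)).trans
          (Function.update_of_ne hy r fun x => (C.mem x).2).symm
  | silent b next S h ha hS =>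
    exact Or.inl ⟨⟨b, next, S, h, ha, hS⟩, proj_rescan h S⟩
  | complete b next view h ha hS =>
    refine Or.inr (Or.inr ⟨?_, b, next, view, h, ha, hS, proj_lifted _ _ _ _⟩)
    rintro ⟨b', next', S, h', ha', hS'⟩
    rw [h] at h'
    cases h'
    rw [hS] at hS'
    cases hS'

/-- An execution on a snapshot object that has the same effect as the first `t` events of `σ`, and
where a silent process can be placed earlier. -/
theorem exists_linearization (σ : ℕ → Fin n × V) (t : ℕ) :
    ∃ L, (atomic.{u, v, w} n mem A).first.exec L = proj ((layered.{u, v, w} n mem A).run σ t) ∧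
      ∀ p c, c ≤ t → Quiet.{u, v, w} mem A σ p c t → ∃ L₁ L₂, L = L₁ ++ L₂ ∧
        (∀ e ∈ L₂, e.1 ≠ p) ∧ ((atomic.{u, v, w} n mem A).first.exec L₁).mem =
          fun x => (((layered.{u, v, w} n mem A).run σ c).mem x).2 := by
  -- The second clause is what makes the induction work: as long as `p` reads silently, a snapshot
  -- of `p` can still be inserted where the memory is that of time `c`.
  induction t with
  | zero =>
    refine ⟨[], rfl, fun p c hc _ => ⟨[], [], rfl, by simp, ?_⟩⟩
    rw [Nat.le_zero.1 hc]
    rfl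
  | succ t ih =>
    obtain ⟨L, hL, hI⟩ := ih
    suffices h : ∃ L', (atomic.{u, v, w} n mem A).first.exec L' =
        proj (((layered.{u, v, w} n mem A).run σ t).step (σ t)) ∧
        ∀ p c, c ≤ t → Quiet.{u, v, w} mem A σ p c (t + 1) → ∃ L₁ L₂, L' = L₁ ++ L₂ ∧
          (∀ e ∈ L₂, e.1 ≠ p) ∧ ((atomic.{u, v, w} n mem A).first.exec L₁).mem =
            fun x => (((layered.{u, v, w} n mem A).run σ c).mem x).2 by
      obtain ⟨L', h1, h2⟩ := h
      refine ⟨L', h1, fun p c hc hq => ?_⟩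
      rcases Nat.le_succ_iff.1 hc with hc | rfl
      · exact h2 p c hc hq
      · exact ⟨L', [], (List.append_nil _).symm, by simp, by rw [h1]; rfl⟩
    rcases proj_step ((layered.{u, v, w} n mem A).run σ t) (σ t) with
      ⟨-, h⟩ | ⟨hn, h⟩ | ⟨hn, b, next, view, hb, ha, hS, h⟩
    · exact ⟨L, hL.trans h.symm, fun p c hc hq => hI p c hc (hq.mono le_rfl (Nat.le_succ t))⟩
    · refine ⟨L ++ [σ t], by rw [h, Config.exec_append, hL]; rfl, fun p c hc hq => ?_⟩
      obtain ⟨L₁, L₂, h1, h2, h3⟩ := hI p c hc (hq.mono le_rfl (Nat.le_succ t))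
      refine ⟨L₁, L₂ ++ [σ t], by rw [h1, List.append_assoc], ?_, h3⟩
      intro e he
      rcases List.mem_append.1 he with he | he
      · exact h2 e he
      · rw [List.mem_singleton.1 he]
        rintro rfl
        exact hn (hq t hc (Nat.lt_succ_self t) rfl)
    -- The completed snapshot is inserted at its linearization point, between `M₁` and `M₂`. It does
    -- not write, and `M₂` contains no event of the process, so it commutes with `M₂`.
    · obtain ⟨c₀, hc₀, hq₀, hv⟩ := exists_linearization_point hb hS
      obtain ⟨M₁, M₂, rfl, hM, hmem⟩ := hI _ c₀ hc₀ hq₀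
      rw [← hv] at hmem
      have hloc : ((atomic.{u, v, w} n mem A).first.exec M₁).loc (σ t).1 = Sum.inr b.inner := by
        rw [← (sameAt_exec _ M₂ hM).1, ← Config.exec_append, hL]
        change innerState (lst _ _) = _
        rw [hb]
        rfl
      have hstep : ((atomic.{u, v, w} n mem A).first.exec M₁).step (σ t) =
          ((atomic.{u, v, w} n mem A).first.exec M₁).settle (σ t).1 (next view) := by
        rw [step_of_snapshot hloc ha, hmem]
      refine ⟨M₁ ++ σ t :: M₂, ?_, fun p c hc hq => ?_⟩
      · rw [h, ← hL, Config.exec_append, Config.exec_append, Config.exec_cons, hstep]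
        exact exec_settle_comm _ _ _ _ hM
      obtain ⟨L₁, L₂, h1, h2, h3⟩ := hI p c hc (hq.mono le_rfl (Nat.le_succ t))
      have hp : (σ t).1 ≠ p := by
        rintro rfl
        exact hn (hq t hc (Nat.lt_succ_self t) rfl)
      -- The place reserved for `p` is after or before the inserted event. In the first case the
      -- memory there is unchanged; in the second the inserted event is not one of `p`, which is
      -- quiet.
      rcases List.append_eq_append_iff.1 h1 with ⟨K, rfl, rfl⟩ | ⟨K, rfl, rfl⟩
      · refine ⟨M₁ ++ σ t :: K, L₂, by simp, h2, ?_⟩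
        rw [← h3, Config.exec_append, Config.exec_append, Config.exec_cons, hstep]
        exact (congrArg Config.mem (exec_settle_comm _ _ _ _ fun e he =>
          hM e (List.mem_append_left _ he))).trans (settle_mem _ _ _)
      · refine ⟨L₁, K ++ σ t :: M₂, by simp, ?_, h3⟩
        intro e he
        rcases List.mem_append.1 he with he | he
        · exact h2 e (List.mem_append_left _ he)
        · rcases List.mem_cons.1 he with rfl | he
          · exact hp
          · exact h2 e (List.mem_append_right _ he)

/-- Transfers safety, because `proj` keeps proposals and decisions. If there are no events, there
are no schedules either, and only the initial state is reachable. -/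
theorem reachable_proj {C : (layered.{u, v, w} n mem A).Config} (h : Reachable C) :
    Reachable (proj C) := by
  by_cases hV : Nonempty (Fin n × V)
  · obtain ⟨σ, t, rfl⟩ := h.exists_run hV.some
    obtain ⟨L, hL, -⟩ := exists_linearization (mem := mem) (A := A) σ t
    exact ⟨L, hL⟩
  · obtain ⟨L, rfl⟩ := h
    cases L with
    | nil => exact ⟨[], rfl⟩
    | cons e L => exact absurd ⟨e⟩ hV

end Program

/-! ### Termination of the register version -/

namespace Protocol

variable {V : Type u} {n m : ℕ}

theorem dec_of_idle {P : Protocol.{u, v, w} V n m} {C : P.Config} (h : Reachable C) {i : Fin n}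
    (hl : (C.loc i).isRight = false) {s : ℕ} (h1 : 1 ≤ s) (hs : s ≤ C.sn i) : C.dec i s ≠ none := by
  have hl' : (C.loc i).isLeft = true := by
    cases h' : C.loc i with
    | inl => rfl
    | inr => rw [h'] at hl; cases hl
  refine ((h.history i).dec_iff s).2 ⟨h1, ?_⟩
  rcases hs.lt_or_eq with h2 | h2
  · exact Or.inl h2
  · exact Or.inr ⟨h2, hl'⟩

end Protocol

namespace Scan

variable {m : ℕ} {R : Type v}

/-- If the registers read so far have not changed, the array being read is the memory. -/
theorem update_eq_of_agree {S : Scan m R} {μ : Fin m → Option ℕ × R} (hy : ¬ S.y.val + 1 < m)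
    (h : ∀ x, x < S.y → S.sm2 x = μ x) : Function.update S.sm2 S.y (μ S.y) = μ := by
  funext x
  by_cases hx : x = S.y
  · subst hx
    exact Function.update_self _ _ _
  · rw [Function.update_of_ne hx]
    have hne : x.val ≠ S.y.val := fun h => hx (Fin.ext h)
    exact h x (by have := x.isLt; rw [Fin.lt_def]; omega)

theorem agree_succ {S : Scan m R} {μ : Fin m → Option ℕ × R} (hy : S.y.val + 1 < m)
    (h : ∀ x, x < S.y → S.sm2 x = μ x) (x : Fin m) (hx : x < ⟨S.y.val + 1, hy⟩) :
    Function.update S.sm2 S.y (μ S.y) x = μ x := by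
  by_cases hxy : x = S.y
  · subst hxy
    exact Function.update_self _ _ _
  · rw [Function.update_of_ne hxy]
    have hne : x.val ≠ S.y.val := fun h => hxy (Fin.ext h)
    have hlt : x.val < S.y.val + 1 := hx
    exact h x (by rw [Fin.lt_def]; omega)

end Scan

namespace Program

open Protocol

variable {V : Type u} {R : Type v} {m : ℕ} {n : ℕ} {mem : Fin m → R}
  {A : Program.{u, v, max v w} V R m} [NeZero m] [DecidableEq R]

variable (n) in
/-- A snapshot in state `S` returns the array `view` if the memory remains constant. -/
inductive ScanReturns (μ : Fin m → Option ℕ × R) : Scan m R → (Fin m → R) → Prop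
  | done {S : Scan m R} {view} (h : S.next n (μ S.y) = Sum.inr view) : ScanReturns μ S view
  | more {S S' : Scan m R} {view} (h : S.next n (μ S.y) = Sum.inl S') (h' : ScanReturns μ S' view) :
      ScanReturns μ S view

theorem scan_count_le {S S' : Scan m R} {r : Option ℕ × R} (h : S.next n r = Sum.inl S')
    (hS : S.count + 1 ≤ m * (n - 1) + 2) : S'.count + 1 ≤ m * (n - 1) + 2 := by
  rcases scan_next_cases h with ⟨hy, rfl⟩ | ⟨hy, ⟨-, -, h3, rfl⟩ | ⟨-, rfl⟩⟩
  · exact hS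
  · dsimp only
    omega
  · dsimp only
    omega

/-- The previous array is the memory, so every further reading repeats it. `N` bounds the missing
repetitions, weighted by m + 1, plus the reads left in the current reading. -/
theorem scanReturns_of_repeated (μ : Fin m → Option ℕ × R) (N : ℕ) (S : Scan m R)
    (hN : (m * (n - 1) + 2 - S.count) * (m + 1) + (m - S.y.val) ≤ N)
    (hc : S.count + 1 ≤ m * (n - 1) + 2) (hi : S.initial = false) (h1 : S.sm1 = μ)
    (h2 : ∀ x, x < S.y → S.sm2 x = μ x) : ScanReturns n μ S fun x => (μ x).2 := by
  induction N generalizing S with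
  | zero =>
    have := S.y.isLt
    omega
  | succ N ih =>
    have hlt := S.y.isLt
    cases h : S.next n (μ S.y) with
    | inl S' =>
      refine .more h ?_
      have hc' := scan_count_le h hc
      rcases scan_next_cases h with ⟨hy, rfl⟩ | ⟨hy, ⟨h3, h4, h5, rfl⟩ | ⟨h3, rfl⟩⟩
      · exact ih _ (by dsimp only; omega) hc' hi h1 (Scan.agree_succ hy h2)
      · refine ih _ ?_ hc' rfl h1 fun x hx => absurd hx (Fin.not_lt_zero x)
        dsimp only at hc' ⊢
        obtain ⟨K, hK⟩ := Nat.exists_eq_add_of_le hc'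
        rw [show m * (n - 1) + 2 - S.count = K + 2 by omega] at hN
        rw [show m * (n - 1) + 2 - (S.count + 1) = K + 1 by omega]
        have : (K + 2) * (m + 1) = (K + 1) * (m + 1) + (m + 1) := by ring
        rw [Fin.val_zero]
        omega
      · exact absurd ⟨hi, by rw [Scan.update_eq_of_agree hy h2, h1]⟩ h3
    | inr view =>
      obtain ⟨-, -, -, -, rfl⟩ := scan_next_inr h
      rw [h1] at h
      exact .done h

theorem scanReturns_of_agree (μ : Fin m → Option ℕ × R) (N : ℕ) (S : Scan m R)
    (hN : m - S.y.val ≤ N) (hc : S.count + 1 ≤ m * (n - 1) + 2)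
    (h2 : ∀ x, x < S.y → S.sm2 x = μ x) : ScanReturns n μ S fun x => (μ x).2 := by
  induction N generalizing S with
  | zero =>
    have := S.y.isLt
    omega
  | succ N ih =>
    have hlt := S.y.isLt
    cases h : S.next n (μ S.y) with
    | inl S' =>
      refine .more h ?_
      have hc' := scan_count_le h hc
      rcases scan_next_cases h with ⟨hy, rfl⟩ | ⟨hy, ⟨h3, h4, h5, rfl⟩ | ⟨h3, rfl⟩⟩
      · exact ih _ (by dsimp only; omega) hc' (Scan.agree_succ hy h2)
      · rw [Scan.update_eq_of_agree hy h2] at h4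
        exact scanReturns_of_repeated μ _ _ le_rfl hc' rfl h4
          fun x hx => absurd hx (Fin.not_lt_zero x)
      · exact scanReturns_of_repeated μ _ _ le_rfl hc' rfl (Scan.update_eq_of_agree hy h2)
          fun x hx => absurd hx (Fin.not_lt_zero x)
    | inr view =>
      obtain ⟨hy, -, h3, -, rfl⟩ := scan_next_inr h
      rw [h3, Scan.update_eq_of_agree hy h2] at h
      exact .done h

/-- The reading in progress may contain outdated entries, but the next one starts with no register
read, hence trivially in agreement with the memory. -/
theorem exists_scanReturns (μ : Fin m → Option ℕ × R) (N : ℕ) (S : Scan m R)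
    (hN : m - S.y.val ≤ N) (hc : S.count + 1 ≤ m * (n - 1) + 2) :
    ∃ view, ScanReturns n μ S view := by
  induction N generalizing S with
  | zero =>
    have := S.y.isLt
    omega
  | succ N ih =>
    have hlt := S.y.isLt
    cases h : S.next n (μ S.y) with
    | inl S' =>
      have hc' := scan_count_le h hc
      suffices h' : ∃ view, ScanReturns n μ S' view from h'.imp fun _ => .more h
      rcases scan_next_cases h with ⟨hy, rfl⟩ | ⟨hy, ⟨h3, h4, h5, rfl⟩ | ⟨h3, rfl⟩⟩
      · exact ih _ (by dsimp only; omega) hc'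
      · exact ⟨_, scanReturns_of_agree μ _ _ le_rfl hc' fun x hx => absurd hx (Fin.not_lt_zero x)⟩
      · exact ⟨_, scanReturns_of_agree μ _ _ le_rfl hc' fun x hx => absurd hx (Fin.not_lt_zero x)⟩
    | inr view => exact ⟨view, .done h⟩

theorem step_of_silent {C : (layered.{u, v, w} n mem A).Config} {e : Fin n × V}
    {b : Layered.{u, v, w} A} {next S} (h : lst C e.1 = Sum.inr b)
    (ha : A.access b.inner = .snapshot next)
    (hS : b.scan.next n (C.mem b.scan.y) = Sum.inl S) : C.step e = rescan C e.1 b S := by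
  have h' : C.loc e.1 = Sum.inr b := h
  rw [step_of_read h' (onRegisters_snapshot ha)]
  exact congrArg (fun o => C.settle e.1 (afterScan mem b next o)) hS

theorem step_of_complete {C : (layered.{u, v, w} n mem A).Config} {e : Fin n × V}
    {b : Layered.{u, v, w} A} {next view} (h : lst C e.1 = Sum.inr b)
    (ha : A.access b.inner = .snapshot next)
    (hS : b.scan.next n (C.mem b.scan.y) = Sum.inr view) :
    C.step e = lifted C e.1 b.ts (next view) := by
  have h' : C.loc e.1 = Sum.inr b := h
  rw [step_of_read h' (onRegisters_snapshot ha)]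
  exact congrArg (fun o => C.settle e.1 (afterScan mem b next o)) hS

theorem lifted_rescan (C : (layered.{u, v, w} n mem A).Config) (i : Fin n) (b : Layered.{u, v, w} A)
    (S : Scan m R) (ts : ℕ) (o : Outcome V A.Idle A.Busy) :
    lifted (rescan C i b S) i ts o = lifted C i ts o := by
  cases o <;> simp [lifted, rescan, Layered.lift, Config.settle]

/-- A solo execution completes the snapshot. -/
theorem exec_of_scanReturns {S : Scan m R} {view : Fin m → R} {μ : Fin m → Option ℕ × R}
    (hr : ScanReturns n μ S view) (i : Fin n) (a : V) {b : Layered.{u, v, w} A} {next}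
    (ha : A.access b.inner = .snapshot next) (C : (layered.{u, v, w} n mem A).Config)
    (hC : lst C i = Sum.inr { b with scan := S }) (hμ : C.mem = μ) :
    ∃ t, C.exec (solo i a t) = lifted C i b.ts (next view) := by
  induction hr generalizing C with
  | @done S view h =>
    subst hμ
    exact ⟨1, step_of_complete (e := (i, a)) (b := { b with scan := S }) hC ha h⟩
  | @more S S' view h h' ih =>
    have hs : C.step (i, a) = rescan C i { b with scan := S } S' := by
      subst hμ
      exact step_of_silent (e := (i, a)) (b := { b with scan := S }) hC ha h
    obtain ⟨t, ht⟩ := ih (C.step (i, a)) (by rw [hs, lst_rescan]) (by rw [hs, mem_rescan, hμ])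
    refine ⟨t + 1, ?_⟩
    rw [hs, lifted_rescan] at ht
    rw [← ht, ← hs]
    rfl

/-- Process `i` is not in the middle of a snapshot. -/
def Fresh (C : (layered.{u, v, w} n mem A).Config) (i : Fin n) : Prop :=
  ∀ b, lst C i = Sum.inr b → b.scan = Scan.begin mem

theorem fresh_lifted (C : (layered.{u, v, w} n mem A).Config) (i : Fin n) (ts : ℕ)
    (o : Outcome V A.Idle A.Busy) : Fresh (lifted C i ts o) i := by
  intro b hb
  rcases lst_lifted C i ts o with ⟨s, h⟩ | ⟨b', h⟩
  · rw [h] at hb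
    cases hb
  · rw [h] at hb
    cases hb
    rfl

theorem fresh_step {C : (layered.{u, v, w} n mem A).Config} {e : Fin n × V}
    {b : Layered.{u, v, w} A} (h : lst C e.1 = Sum.inr b)
    (ha : ∀ next, A.access b.inner ≠ .snapshot next) :
    Fresh (C.step e) e.1 ∧ proj (C.step e) = (proj C).step e := by
  refine ⟨?_, ?_⟩
  · have hev := levent C e
    generalize C.step e = C' at hev
    cases hev with
    | invoke s h' => rw [h] at h'; cases h'
    | read b' x next h' ha' => exact fresh_lifted _ _ _ _
    | write b' x r next h' ha' => exact fresh_lifted _ _ _ _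
    | silent b' next S h' ha' => rw [h] at h'; cases h'; exact absurd ha' (ha next)
    | complete b' next view h' ha' => rw [h] at h'; cases h'; exact absurd ha' (ha next)
  · rcases proj_step C e with ⟨⟨b', next, S, h', ha', -⟩, -⟩ | ⟨-, h1⟩ |
      ⟨-, b', next, view, h', ha', -⟩
    · rw [h] at h'; cases h'; exact absurd ha' (ha next)
    · exact h1
    · rw [h] at h'; cases h'; exact absurd ha' (ha next)

/-- A solo execution on registers performs the next event of the execution on a snapshot object. -/
theorem exists_solo_step {C : (layered.{u, v, w} n mem A).Config} {i : Fin n} (a : V)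
    {b : Layered.{u, v, w} A} (hb : lst C i = Sum.inr b) (hf : Fresh C i) :
    ∃ t, Fresh (C.exec (solo i a t)) i ∧
      proj (C.exec (solo i a t)) = (proj C).step (i, a) := by
  by_cases ha : ∃ next, A.access b.inner = .snapshot next
  swap
  · exact ⟨1, fresh_step (e := (i, a)) hb (not_exists.1 ha)⟩
  obtain ⟨next, ha⟩ := ha
  have hs := hf b hb
  have hr : ScanReturns n C.mem b.scan fun x => (C.mem x).2 := by
    refine scanReturns_of_agree C.mem _ _ le_rfl ?_ ?_
    · rw [hs]
      exact Nat.le_add_left _ _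
    · rw [hs]
      exact fun x hx => absurd hx (Fin.not_lt_zero x)
  obtain ⟨t, ht⟩ := exec_of_scanReturns hr i a ha C hb rfl
  refine ⟨t, by rw [ht]; exact fresh_lifted _ _ _ _, ?_⟩
  have hloc : (proj C).loc i = Sum.inr b.inner := by
    change innerState (lst C i) = _
    rw [hb]
    rfl
  rw [ht, proj_lifted, step_of_snapshot (e := (i, a)) hloc ha]
  rfl

theorem scan_count_of_reachable {C : (layered.{u, v, w} n mem A).Config} (h : Reachable C)
    (i : Fin n) (b : Layered.{u, v, w} A) (hb : lst C i = Sum.inr b) :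
    b.scan.count + 1 ≤ m * (n - 1) + 2 := by
  refine Reachable.induction (p := fun C => ∀ b, lst C i = Sum.inr b →
    b.scan.count + 1 ≤ m * (n - 1) + 2) ?_ ?_ h b hb
  · intro b hb
    cases hb
  · intro C e _ ih b hb
    by_cases hi : i = e.1
    swap
    · rw [lst_step_of_ne C e hi] at hb
      exact ih b hb
    subst hi
    have hlift : ∀ (D : (layered.{u, v, w} n mem A).Config) (ts : ℕ) (o : Outcome V A.Idle A.Busy),
        lst (lifted D e.1 ts o) e.1 = Sum.inr b → b.scan.count + 1 ≤ m * (n - 1) + 2 := by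
      intro D ts o h
      rw [fresh_lifted D e.1 ts o b h]
      exact Nat.le_add_left _ _
    have hev := levent C e
    generalize C.step e = C' at hev hb
    cases hev with
    | invoke s h => exact hlift _ _ _ hb
    | read b' x next h ha => exact hlift _ _ _ hb
    | write b' x r next h ha => exact hlift _ _ _ hb
    | silent b' next S h ha hS =>
      rw [lst_rescan] at hb
      cases hb
      exact scan_count_le hS (ih b' h)
    | complete b' next view h ha hS => exact hlift _ _ _ hb

/-- Each of the `N` solo events on the snapshot object is simulated by finitely many events on
registers, until the process is idle, when it has decided already. -/
theorem dec_of_solo_dec {C : (layered.{u, v, w} n mem A).Config} (h : Reachable C) {i : Fin n}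
    (a : V) (hf : Fresh C i) {s N : ℕ} (h1 : 1 ≤ s) (hs : s ≤ C.sn i)
    (hN : ((proj C).exec (solo i a N)).dec i s ≠ none) :
    ∃ t, (C.exec (solo i a t)).dec i s ≠ none := by
  induction N generalizing C with
  | zero => exact ⟨0, hN⟩
  | succ N ih =>
    cases hl : (C.loc i).isRight with
    | false => exact ⟨0, dec_of_idle h hl h1 hs⟩
    | true =>
      obtain ⟨b, hb⟩ := Sum.isRight_iff.1 hl
      obtain ⟨t, h2, h3⟩ := exists_solo_step a (show lst C i = Sum.inr b from hb) hf
      obtain ⟨t', ht'⟩ := ih (h.exec (solo i a t)) h2 (hs.trans (sn_le_exec _ _ _))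
        (by rw [h3]; exact hN)
      exact ⟨t + t', by rw [exec_solo_add]; exact ht'⟩

/-- If the processes decide in solo executions on a snapshot object, they also do so on registers. -/
theorem layered_solo_decides (hA : ∀ C : (atomic.{u, v, w} n mem A).Config, Reachable C →
      ∀ i a, (C.loc i).isRight = true → ∃ t, (C.exec (solo i a t)).dec i (C.sn i) ≠ none)
    {C : (layered.{u, v, w} n mem A).Config} (h : Reachable C) (i : Fin n) (a : V)
    (hb : (C.loc i).isRight = true) : ∃ t, (C.exec (solo i a t)).dec i (C.sn i) ≠ none := by
  have h1 : 1 ≤ C.sn i := (h.history i).pos hb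
  obtain ⟨b, hb⟩ := Sum.isRight_iff.1 hb
  -- A snapshot in progress is completed first. Its result may differ from the present memory, but
  -- the state reached still projects to a reachable one, from which the solo run decides.
  obtain ⟨t, ht⟩ : ∃ t, Fresh (C.exec (solo i a t)) i := by
    by_cases ha : ∃ next, A.access b.inner = .snapshot next
    swap
    · exact ⟨1, (fresh_step (e := (i, a)) hb (not_exists.1 ha)).1⟩
    obtain ⟨next, ha⟩ := ha
    obtain ⟨view, hr⟩ := exists_scanReturns C.mem _ b.scan le_rfl
      (scan_count_of_reachable h i b hb)
    obtain ⟨t, ht⟩ := exec_of_scanReturns hr i a ha C hb rfl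
    exact ⟨t, by rw [ht]; exact fresh_lifted _ _ _ _⟩
  have hR := h.exec (solo i a t)
  have hs := sn_le_exec C (solo i a t) i
  suffices h' : ∃ t', ((C.exec (solo i a t)).exec (solo i a t')).dec i (C.sn i) ≠ none by
    obtain ⟨t', h'⟩ := h'
    exact ⟨t + t', by rw [exec_solo_add]; exact h'⟩
  generalize C.exec (solo i a t) = D at ht hR hs
  cases hl : (D.loc i).isRight with
  | false => exact ⟨0, dec_of_idle hR hl h1 hs⟩
  | true =>
    rcases hs.lt_or_eq with hlt | heq
    · exact ⟨0, ((hR.history i).dec_iff _).2 ⟨h1, Or.inl hlt⟩⟩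
    · obtain ⟨b', hb'⟩ := Sum.isRight_iff.1 hl
      have hloc : ((proj D).loc i).isRight = true := by
        change (innerState (lst D i)).isRight = true
        rw [show lst D i = Sum.inr b' from hb']
        rfl
      obtain ⟨N, hN⟩ := hA _ (reachable_proj hR) i a hloc
      refine dec_of_solo_dec hR a ht h1 hs (N := N) ?_
      rw [heq]
      exact hN

theorem layered_readWrite : (layered.{u, v, w} n mem A).ReadWrite := by
  intro i b next h
  change (onRegisters.{u, v, w} n mem A).access b = _ at h
  cases ha : A.access b.inner with
  | read x next' => rw [onRegisters_read ha] at h; cases h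
  | write x r next' => rw [onRegisters_write ha] at h; cases h
  | snapshot next' => rw [onRegisters_snapshot ha] at h; cases h

end Program

/-! ### The theorem -/

open Protocol in
theorem registerProtocol_solves {V : Type u} [LinearOrder V] {n k : ℕ} (hk : 1 ≤ k)
    {mx : List (Sixuplet V) → Sixuplet V} (hmx : IsMaxRule mx) :
    (registerProtocol n k mx).SolvesRepeatedSetAgreement k := by
  have hproj : ∀ C : (registerProtocol n k mx).Config, Reachable C →
      Reachable (P := setAgreement n (n - k) mx) (Program.proj C) :=
    fun C h => Program.reachable_proj h
  refine ⟨?_, ?_, ?_⟩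
  · intro σ t i s a h
    exact (setAgreement.valid_of_reachable hmx (hproj _ (reachable_run σ t))).dec i s a h
  · refine agreement_of_reachable fun C h s => ?_
    exact setAgreement.encard_decisions_le hmx hk (by omega) (hproj C h) s
  · refine obTermination_of_solo fun C h i a hb => ?_
    refine Program.layered_solo_decides (fun D hD j b hj => ?_) h i a hb
    exact setAgreement.solo_decides hmx hD j b hj

theorem mainTheorem3 {V : Type u} [LinearOrder V] (n k : ℕ) (hk : 1 ≤ k) (hkn : k ≤ n) :
    (∀ mx : List (Sixuplet V) → Sixuplet V, Sixuplet.IsMaxRule mx →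
      ((snapshotProtocol n k mx).SolvesRepeatedSetAgreement k ∧
        (snapshotProtocol n k mx).SVTermination) ∧
      ((registerProtocol n k mx).ReadWrite ∧
        (registerProtocol n k mx).SolvesRepeatedSetAgreement k)) ∧
    (k < n → (k : ℕ∞) < ENat.card V →
      ∀ (m : ℕ) (P : Protocol.{u, v, w} V n m), P.SolvesRepeatedSetAgreement k →
        n - k + 1 ≤ m) :=
  ⟨fun mx hmx =>
    ⟨⟨⟨setAgreement.validity hmx, setAgreement.agreement hmx hk (by omega),
        setAgreement.obTermination hmx⟩, setAgreement.svTermination hmx⟩,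
      Program.layered_readWrite, registerProtocol_solves hk hmx⟩,
    fun hkn' hV _ _ hP => Protocol.register_lower_bound hkn' hV hP⟩
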